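/- All manifolds are smooth, finite-dimensional, without boundary. Put $\tau_1=\tau_2=-1$, $\tau_3=1$. An almost paraquaternionic structure on $M$ is a rank-three subbundle $\sigma\subset\mathrm{End}(TM)$ admitting, near each point, a local basis, i.e. a triple of smooth $(1,1)$-tensor fields $(J_1,J_2,J_3)$ spanning $\sigma$ with $J_a^2=-\tau_a I$ and $J_aJ_b=\tau_cJ_c=-J_bJ_a$ for each cyclic permutation $(a,b,c)$ of $(1,2,3)$. A triple $(M,\sigma,g)$ is a paraquaternionic Kähler manifold if $g$ is a semi-Riemannian metric with $g(X,J_aY)+g(J_aX,Y)=0$ for every local basis $(J_a)$ of $\sigma$, and the Levi-Civita connection $\nabla$ of $g$ preserves $\sigma$. Let $(M,\sigma,g)$ and $(M',\sigma',g')$ be paraquaternionic Kähler manifolds. A smooth map $\pi:M\to M'$ is a paraquaternionic submersion if * it is a semi-Riemannian submersion: a surjective submersion such that $g$ is nondegenerate on $\mathcal V=\ker d\pi$ and $g'(d\pi X,d\pi Y)=g(X,Y)$ for all $X,Y$ in the horizontal distribution $\mathcal H=\mathcal V^{\perp}$; * it is $(\sigma,\sigma')$-paraholomorphic: each $x\in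 M$ has an open neighbourhood $U$ with a local basis $(J_a)$ of $\sigma$ on $U$, and $\pi(x)$ an open neighbourhood $U'$ with a local basis $(J'_a)$ of $\sigma'$ on $U'$, such that $(J'_a)_{\pi(y)}\circ d\pi_y=d\pi_y\circ (J_a)_y$ for all $y\in U\cap\pi^{-1}(U')$ and $a\in\{1,2,3\}$. Let $v,h$ be the projections of $TM=\mathcal V\oplus\mathcal H$ onto $\mathcal V$ and $\mathcal H$. **Proposition.** Let $(M,\sigma,g)$, $(M',\sigma',g')$ be paraquaternionic Kähler manifolds and $\pi:M\to M'$ a paraquaternionic submersion. Then: 1. the O'Neill tensor $A_XY=v\nabla_{hX}(hY)+h\nabla_{hX}(vY)$ vanishes identically; 2. $\mathcal H$ is integrable: through each point of $M$ there passes an integral manifold of $\mathcal H$, i.e. an injectively immersed submanifold $N$ with $T_yN=\mathcal H_y$ for all $y\in N$; 3. each integral manifold $N$ of $\mathcal H$ is a totally geodesic paraquaternionic Kähler submanifold of $M$: its second fundamental form vanishes, $J(T_yN)\subset T_yN$ for all $y\in N$ and $J\in\sigma_y$, and $N$ with the restrictions of $\sigma$ and $g$ is a paraquaternionic Kähler manifold.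 -/

import Mathlib

open Set
open scoped Manifold ContDiff Topology

noncomputable section

namespace ParaQ

/-! Manifolds are finite-dimensional, smooth and without boundary: they are modelled on a
finite-dimensional real normed space `E` through `𝓘(ℝ, E)`. -/

/-! ### Tensor fields and metrics -/

section Tensors

variable {E : Type*} [NormedAddCommGroup E] [NormedSpace ℝ E]
  {M : Type*} [TopologicalSpace M] [ChartedSpace E M]

/-- Tensor fields of type `(0,2)` (no regularity). -/
abbrev BilinField (E : Type*) [NormedAddCommGroup E] [NormedSpace ℝ E]
    (M : Type*) [TopologicalSpace M] [ChartedSpace E M] : Type _ :=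
  Π x : M, TangentSpace 𝓘(ℝ, E) x →L[ℝ] TangentSpace 𝓘(ℝ, E) x →L[ℝ] ℝ

/-- Tensor fields of type `(1,1)` (no regularity). -/
abbrev EndField (E : Type*) [NormedAddCommGroup E] [NormedSpace ℝ E]
    (M : Type*) [TopologicalSpace M] [ChartedSpace E M] : Type _ :=
  Π x : M, TangentSpace 𝓘(ℝ, E) x →L[ℝ] TangentSpace 𝓘(ℝ, E) x

/-- Families of linear subspaces `σ x ⊆ End (T_x M)`. -/
abbrev EndSubspaceField (E : Type*) [NormedAddCommGroup E] [NormedSpace ℝ E]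
    (M : Type*) [TopologicalSpace M] [ChartedSpace E M] : Type _ :=
  Π x : M, Submodule ℝ (TangentSpace 𝓘(ℝ, E) x →L[ℝ] TangentSpace 𝓘(ℝ, E) x)

/-- The linear connections on `M`. In Mathlib's convention `∇ Y x v` is `(∇_v Y)(x)`. -/
abbrev LinearConnection (E : Type*) [NormedAddCommGroup E] [NormedSpace ℝ E]
    (M : Type*) [TopologicalSpace M] [ChartedSpace E M] [IsManifold 𝓘(ℝ, E) ∞ M] : Type _ :=
  CovariantDerivative 𝓘(ℝ, E) E (TangentSpace 𝓘(ℝ, E) : M → Type _)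

variable [IsManifold 𝓘(ℝ, E) ∞ M]

/-- The `(1,1)`-tensor field `S` is smooth on `U`. -/
def SmoothEndOn (S : EndField E M) (U : Set M) : Prop :=
  ContMDiffOn 𝓘(ℝ, E) (𝓘(ℝ, E).prod 𝓘(ℝ, E →L[ℝ] E)) ∞
    (fun x ↦ (⟨x, S x⟩ : Bundle.TotalSpace (E →L[ℝ] E)
      (fun x : M ↦ TangentSpace 𝓘(ℝ, E) x →L[ℝ] TangentSpace 𝓘(ℝ, E) x))) U

/-- `g` is a semi-Riemannian metric: a smooth, symmetric, nondegenerate `(0,2)`-tensor field.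
(Its index is locally constant; for the Hermitian metrics below it is half the dimension.) -/
structure IsSemiRiemannianMetric (g : BilinField E M) : Prop where
  symm : ∀ (x : M) (v w : TangentSpace 𝓘(ℝ, E) x), g x v w = g x w v
  nondegenerate : ∀ (x : M) (v : TangentSpace 𝓘(ℝ, E) x), (∀ w, g x v w = 0) → v = 0
  smooth : ContMDiff 𝓘(ℝ, E) (𝓘(ℝ, E).prod 𝓘(ℝ, E →L[ℝ] E →L[ℝ] ℝ)) ∞
    (fun x ↦ (⟨x, g x⟩ : Bundle.TotalSpace (E →L[ℝ] E →L[ℝ] ℝ)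
      (fun x : M ↦ TangentSpace 𝓘(ℝ, E) x →L[ℝ] TangentSpace 𝓘(ℝ, E) x →L[ℝ] ℝ)))

/-- `nabla` is the Levi-Civita connection of `g`: it is torsion-free and `∇ g = 0`, that is,
`v (g(Y, Z)) = g(∇_v Y, Z) + g(Y, ∇_v Z)`. -/
structure IsLeviCivita [FiniteDimensional ℝ E] (g : BilinField E M)
    (nabla : LinearConnection E M) : Prop where
  torsionFree : nabla.torsion = 0
  metric : ∀ (x : M) (Y Z : Π x : M, TangentSpace 𝓘(ℝ, E) x),
    MDiffAt (T% Y) x → MDiffAt (T% Z) x → ∀ v : TangentSpace 𝓘(ℝ, E) x,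
      mvfderiv 𝓘(ℝ, E) (fun y ↦ g y (Y y) (Z y)) x v =
        g x (nabla Y x v) (Z x) + g x (Y x) (nabla Z x v)

end Tensors

/-! ### Paraquaternionic structures -/

section Structures

variable {E : Type*} [NormedAddCommGroup E] [NormedSpace ℝ E]
  {M : Type*} [TopologicalSpace M] [ChartedSpace E M] [IsManifold 𝓘(ℝ, E) ∞ M]

/-- The signs `τ₁ = τ₂ = -1`, `τ₃ = 1`; the indices `1, 2, 3` are written `0, 1, 2 : Fin 3`. -/
def tau : Fin 3 → ℝ := ![-1, -1, 1]

/-- `(J 0, J 1, J 2)` is a local basis of `σ` on `U`. The cyclic permutations of the indices are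
`(a, a + 1, a + 2)`, with addition modulo `3`. -/
structure IsLocalBasis (σ : EndSubspaceField E M) (U : Set M) (J : Fin 3 → EndField E M) :
    Prop where
  smooth : ∀ a, SmoothEndOn (J a) U
  span_eq : ∀ x ∈ U, Submodule.span ℝ (range fun a ↦ J a x) = σ x
  sq : ∀ x ∈ U, ∀ a, (J a x).comp (J a x) =
    -tau a • ContinuousLinearMap.id ℝ (TangentSpace 𝓘(ℝ, E) x)
  mul : ∀ x ∈ U, ∀ a, (J a x).comp (J (a + 1) x) = tau (a + 2) • J (a + 2) x
  mul_swap : ∀ x ∈ U, ∀ a, (J (a + 1) x).comp (J a x) = -(tau (a + 2) • J (a + 2) x)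

/-- `σ` is an almost paraquaternionic structure: a rank-three subbundle of `End(TM)` with
local bases around each point (which make the subbundle smooth). -/
structure IsAlmostParaquaternionic (σ : EndSubspaceField E M) : Prop where
  rank : ∀ x, Module.finrank ℝ (σ x) = 3
  exists_basis : ∀ x : M, ∃ U : Set M, IsOpen U ∧ x ∈ U ∧ ∃ J, IsLocalBasis σ U J

/-- `(M, σ, g)` is an almost paraquaternionic Hermitian manifold. -/
structure IsAlmostParaquaternionicHermitian (σ : EndSubspaceField E M) (g : BilinField E M) :
    Prop where
  metric : IsSemiRiemannianMetric g
  almost : IsAlmostParaquaternionic σ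
  hermitian : ∀ (U : Set M) (J : Fin 3 → EndField E M), IsOpen U → IsLocalBasis σ U J →
    ∀ x ∈ U, ∀ (a : Fin 3) (v w : TangentSpace 𝓘(ℝ, E) x),
      g x v (J a x w) + g x (J a x v) w = 0

/-- The connection preserves `σ`: if `S` is a local smooth section of `σ`, then so is `∇_v S`,
where `(∇_v S) Y = ∇_v (S Y) - S (∇_v Y)`. -/
def PreservesSubbundle (nabla : LinearConnection E M) (σ : EndSubspaceField E M) : Prop :=
  ∀ (U : Set M) (S : EndField E M), IsOpen U → SmoothEndOn S U → (∀ x ∈ U, S x ∈ σ x) →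
    ∀ x ∈ U, ∀ v : TangentSpace 𝓘(ℝ, E) x, ∃ T ∈ σ x,
      ∀ Y : Π x : M, TangentSpace 𝓘(ℝ, E) x, MDiffAt (T% Y) x →
        nabla (fun y ↦ S y (Y y)) x v - S x (nabla Y x v) = T (Y x)

/-- `(M, σ, g)` is a paraquaternionic Kähler manifold: it is almost paraquaternionic Hermitian
and the Levi-Civita connection of `g` preserves `σ`. -/
structure IsParaquaternionicKahler [FiniteDimensional ℝ E] (σ : EndSubspaceField E M)
    (g : BilinField E M) : Prop where
  hermitian : IsAlmostParaquaternionicHermitian σ g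
  kahler : ∃ nabla : LinearConnection E M, IsLeviCivita g nabla ∧ PreservesSubbundle nabla σ

end Structures

/-! ### Distributions and submanifolds -/

section Submanifolds

variable {E : Type*} [NormedAddCommGroup E] [NormedSpace ℝ E]
  {M : Type*} [TopologicalSpace M] [ChartedSpace E M]
  {F : Type*} [NormedAddCommGroup F] [NormedSpace ℝ F]
  {N : Type*} [TopologicalSpace N] [ChartedSpace F N]

/-- Families of linear subspaces `D x ⊆ T_x M`. -/
abbrev SubspaceField (E : Type*) [NormedAddCommGroup E] [NormedSpace ℝ E]
    (M : Type*) [TopologicalSpace M] [ChartedSpace E M] : Type _ :=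
  Π x : M, Submodule ℝ (TangentSpace 𝓘(ℝ, E) x)

/-- The subspace `dι (T_y N)` of `T_{ι y} M`. -/
def tangentImage (ι : N → M) (y : N) : Submodule ℝ (TangentSpace 𝓘(ℝ, E) (ι y)) :=
  LinearMap.range (mfderiv 𝓘(ℝ, F) 𝓘(ℝ, E) ι y).toLinearMap

/-- `ι : N → M` is an (immersed) integral manifold of `D`: an injective immersion with
`dι (T_y N) = D (ι y)` for all `y`. -/
structure IsIntegralManifold (D : SubspaceField E M) (ι : N → M) : Prop where
  injective : Function.Injective ι
  immersion : Manifold.IsImmersion 𝓘(ℝ, F) 𝓘(ℝ, E) ∞ ι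
  tangent : ∀ y, tangentImage (F := F) ι y = D (ι y)

/-- `D` is integrable: through each point of `M` there passes an integral manifold of `D`. -/
def IsIntegrable (D : SubspaceField E M) : Prop :=
  ∀ p : M, ∃ (k : ℕ) (N : Type) (_ : TopologicalSpace N)
    (_ : ChartedSpace (EuclideanSpace ℝ (Fin k)) N)
    (_ : IsManifold 𝓘(ℝ, EuclideanSpace ℝ (Fin k)) ∞ N)
    (_ : T2Space N) (_ : SecondCountableTopology N) (ι : N → M),
    IsIntegralManifold (F := EuclideanSpace ℝ (Fin k)) D ι ∧ p ∈ range ι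

/-- The pull-back `ι^* g`, i.e. `(u, w) ↦ g (dι u, dι w)`. -/
def inducedMetric (ι : N → M) (g : BilinField E M) : BilinField F N := fun y ↦
  let d : TangentSpace 𝓘(ℝ, F) y →L[ℝ] TangentSpace 𝓘(ℝ, E) (ι y) :=
    mfderiv 𝓘(ℝ, F) 𝓘(ℝ, E) ι y
  (ContinuousLinearMap.precomp ℝ d).comp ((g (ι y)).comp d)

/-- The submanifold `ι` is `σ`-invariant: `J (T_y N) ⊆ T_y N` for all `J ∈ σ (ι y)`. -/
def IsInvariantSubmanifold (σ : EndSubspaceField E M) (ι : N → M) : Prop :=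
  ∀ y : N, ∀ J ∈ σ (ι y), ∀ v ∈ tangentImage (F := F) ι y, J v ∈ tangentImage (F := F) ι y

/-- The restriction of `σ` to the submanifold `ι`: the endomorphisms `K` of `T_y N` which are
restrictions of some `J ∈ σ (ι y)`, that is, `dι ∘ K = J ∘ dι`. -/
def inducedStructure (ι : N → M) (σ : EndSubspaceField E M) : EndSubspaceField F N := fun y ↦
  let d : TangentSpace 𝓘(ℝ, F) y →L[ℝ] TangentSpace 𝓘(ℝ, E) (ι y) :=
    mfderiv 𝓘(ℝ, F) 𝓘(ℝ, E) ι y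
  { carrier := {K | ∃ J ∈ σ (ι y), d.comp K = J.comp d}
    zero_mem' := ⟨0, zero_mem _, by simp⟩
    add_mem' := by
      rintro K K' ⟨J, hJ, h⟩ ⟨J', hJ', h'⟩
      exact ⟨J + J', add_mem hJ hJ', by
        rw [ContinuousLinearMap.comp_add, ContinuousLinearMap.add_comp, h, h']⟩
    smul_mem' := by
      rintro c K ⟨J, hJ, h⟩
      exact ⟨c • J, Submodule.smul_mem _ _ hJ, by
        rw [ContinuousLinearMap.comp_smul, ContinuousLinearMap.smul_comp, h]⟩ }

/-- The immersed submanifold `ι : N → M` is totally geodesic: its second fundamental form (the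
normal part of `∇_v Y`, for `v` tangent to `N` and `Y` a vector field of `M` which is tangent to
`N` along `N`, near the point considered) vanishes. -/
def IsTotallyGeodesic [FiniteDimensional ℝ E] [IsManifold 𝓘(ℝ, E) ∞ M] (g : BilinField E M)
    (ι : N → M) : Prop :=
  ∀ nabla : LinearConnection E M, IsLeviCivita g nabla →
    ∀ (y : N) (Y : Π x : M, TangentSpace 𝓘(ℝ, E) x), MDiffAt (T% Y) (ι y) →
      (∀ᶠ z in 𝓝 y, Y (ι z) ∈ tangentImage (F := F) ι z) →
        ∀ v ∈ tangentImage (F := F) ι y, nabla Y (ι y) v ∈ tangentImage (F := F) ι y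

/-- The immersed submanifold `ι : N → M` of `(M, σ, g)` is a paraquaternionic Kähler submanifold:
it is `σ`-invariant and, with the induced structure and the induced metric (which is in particular
nondegenerate), it is a paraquaternionic Kähler manifold. -/
structure IsParaquaternionicKahlerSubmanifold [FiniteDimensional ℝ F] [IsManifold 𝓘(ℝ, F) ∞ N]
    (σ : EndSubspaceField E M) (g : BilinField E M) (ι : N → M) : Prop where
  invariant : IsInvariantSubmanifold (F := F) σ ι
  kahler : IsParaquaternionicKahler (inducedStructure (F := F) ι σ) (inducedMetric (F := F) ι g)

end Submanifolds

/-! ### Submersions -/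

section Submersions

variable {E : Type*} [NormedAddCommGroup E] [NormedSpace ℝ E]
  {M : Type*} [TopologicalSpace M] [ChartedSpace E M]
  {E' : Type*} [NormedAddCommGroup E'] [NormedSpace ℝ E']
  {M' : Type*} [TopologicalSpace M'] [ChartedSpace E' M']

/-- The vertical distribution `ker dπ`. -/
def vertical (π : M → M') : SubspaceField E M := fun x ↦
  LinearMap.ker (mfderiv 𝓘(ℝ, E) 𝓘(ℝ, E') π x).toLinearMap

/-- The horizontal distribution, the `g`-orthogonal complement of the vertical one. -/
def horizontal (g : BilinField E M) (π : M → M') : SubspaceField E M := fun x ↦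
  { carrier := {w | ∀ v ∈ vertical (E' := E') π x, g x v w = 0}
    zero_mem' := by intro v _; simp
    add_mem' := by intro a b ha hb v hv; simp [ha v hv, hb v hv]
    smul_mem' := by intro c a ha v hv; simp [ha v hv] }

/-- `π : (M, g) → (M', g')` is a semi-Riemannian submersion: a smooth surjective submersion with
nondegenerate fibres, whose differential preserves scalar products of horizontal vectors. -/
structure IsSemiRiemannianSubmersion (g : BilinField E M) (g' : BilinField E' M') (π : M → M') :
    Prop where
  surjective : Function.Surjective π
  submersion : Manifold.IsSubmersion 𝓘(ℝ, E) 𝓘(ℝ, E') ∞ π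
  vertical_nondegenerate : ∀ x, ∀ v ∈ vertical (E' := E') π x,
    (∀ w ∈ vertical (E' := E') π x, g x v w = 0) → v = 0
  isometry : ∀ x, ∀ v ∈ horizontal (E' := E') g π x, ∀ w ∈ horizontal (E' := E') g π x,
    g' (π x) (mfderiv 𝓘(ℝ, E) 𝓘(ℝ, E') π x v) (mfderiv 𝓘(ℝ, E) 𝓘(ℝ, E') π x w) = g x v w

/-- `π` is `(σ, σ')`-paraholomorphic: around each `x` and `π x` there are local bases `J` of `σ`
and `J'` of `σ'` with `J'_a ∘ dπ = dπ ∘ J_a`. (One pair of bases is asked for: a basis `J` which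
varies along the fibres is not related to any `J'`, so asking for a `J'` for every `J` would
exclude all submersions with positive-dimensional fibres.) -/
def IsParaholomorphic [IsManifold 𝓘(ℝ, E) ∞ M] [IsManifold 𝓘(ℝ, E') ∞ M']
    (σ : EndSubspaceField E M) (σ' : EndSubspaceField E' M') (π : M → M') : Prop :=
  ContMDiff 𝓘(ℝ, E) 𝓘(ℝ, E') ∞ π ∧
  ∀ x : M, ∃ (U : Set M) (J : Fin 3 → EndField E M) (U' : Set M') (J' : Fin 3 → EndField E' M'),
    IsOpen U ∧ x ∈ U ∧ IsLocalBasis σ U J ∧ IsOpen U' ∧ π x ∈ U' ∧ IsLocalBasis σ' U' J' ∧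
    ∀ y ∈ U, π y ∈ U' → ∀ (a : Fin 3) (v : TangentSpace 𝓘(ℝ, E) y),
      J' a (π y) (mfderiv 𝓘(ℝ, E) 𝓘(ℝ, E') π y v) =
        mfderiv 𝓘(ℝ, E) 𝓘(ℝ, E') π y (J a y v)

/-- `π` is a paraquaternionic submersion. -/
structure IsParaquaternionicSubmersion [IsManifold 𝓘(ℝ, E) ∞ M] [IsManifold 𝓘(ℝ, E') ∞ M']
    (σ : EndSubspaceField E M) (g : BilinField E M)
    (σ' : EndSubspaceField E' M') (g' : BilinField E' M') (π : M → M') : Prop where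
  semiRiemannian : IsSemiRiemannianSubmersion g g' π
  paraholomorphic : IsParaholomorphic σ σ' π

variable [FiniteDimensional ℝ E] [IsManifold 𝓘(ℝ, E) ∞ M]
  {g : BilinField E M} {g' : BilinField E' M'} {π : M → M'}

/-- The tangent space is the direct sum of the vertical and the horizontal space. -/
theorem isCompl_vertical_horizontal (hg : IsSemiRiemannianMetric g)
    (hπ : IsSemiRiemannianSubmersion g g' π) (x : M) :
    IsCompl (vertical (E' := E') π x) (horizontal (E' := E') g π x) := by
  have : FiniteDimensional ℝ (TangentSpace 𝓘(ℝ, E) x) := inferInstanceAs (FiniteDimensional ℝ E)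
  let B : LinearMap.BilinForm ℝ (TangentSpace 𝓘(ℝ, E) x) :=
    LinearMap.mk₂ ℝ (fun v w ↦ g x v w) (by simp) (by simp) (by simp) (by simp)
  have hB : B.IsRefl := fun v w h ↦ by
    have h' : g x v w = 0 := h
    change g x w v = 0
    rw [hg.symm, h']
  have heq : horizontal (E' := E') g π x = B.orthogonal (vertical (E' := E') π x) := by
    ext w
    exact Iff.rfl
  rw [heq, LinearMap.BilinForm.isCompl_orthogonal_iff_disjoint hB, Submodule.disjoint_def]
  intro v hv hv'
  exact hπ.vertical_nondegenerate x v hv fun w hw ↦ by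
    rw [hg.symm]
    exact hv' w hw

/-- The projection `v` of `T_x M` onto the vertical space along the horizontal one. -/
def verticalProj (hg : IsSemiRiemannianMetric g) (hπ : IsSemiRiemannianSubmersion g g' π) (x : M) :
    TangentSpace 𝓘(ℝ, E) x →ₗ[ℝ] TangentSpace 𝓘(ℝ, E) x :=
  Submodule.projection _ _ (isCompl_vertical_horizontal hg hπ x)

/-- The projection `h` of `T_x M` onto the horizontal space along the vertical one. -/
def horizontalProj (hg : IsSemiRiemannianMetric g) (hπ : IsSemiRiemannianSubmersion g g' π)
    (x : M) : TangentSpace 𝓘(ℝ, E) x →ₗ[ℝ] TangentSpace 𝓘(ℝ, E) x :=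
  Submodule.projection _ _ (isCompl_vertical_horizontal hg hπ x).symm

/-- The O'Neill tensor `A_X Y = v ∇_{hX} (hY) + h ∇_{hX} (vY)`. -/
def oneillA (hg : IsSemiRiemannianMetric g) (hπ : IsSemiRiemannianSubmersion g g' π)
    (nabla : LinearConnection E M) (X Y : Π x : M, TangentSpace 𝓘(ℝ, E) x) (x : M) :
    TangentSpace 𝓘(ℝ, E) x :=
  verticalProj hg hπ x
      (nabla (fun y ↦ horizontalProj hg hπ y (Y y)) x (horizontalProj hg hπ x (X x))) +
    horizontalProj hg hπ x
      (nabla (fun y ↦ verticalProj hg hπ y (Y y)) x (horizontalProj hg hπ x (X x)))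

end Submersions

end ParaQ

end

/-!
Let `X`, `Y` be horizontal and `V` vertical. The form `β(X, Y, V) = g (∇_X Y, V)` is tensorial,
and it is skew in `X`, `Y`, because basic horizontal fields have a scalar product which is
constant along the fibres (`ParaQ.IsLeviCivita.apply_add_apply_eq_zero`). The elements `J` of `σ`
preserve both distributions and `∇` preserves `σ`, so that `β(X, J Y, V) = -β(X, Y, J V)`; by
skewness the same holds for `J` in the first argument. Expanding `β(J₁ X, J₂ Y, V)` in two orders
yields `β(X, Y, J₁ J₂ V) = β(X, Y, J₂ J₁ V)`, and since `J₁` and `J₂` anticommute and `J₁ J₂ = J₃`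
is invertible, `β = 0` (`ParaQ.IsParaquaternionicSubmersion.nabla_mem_horizontal`). This is the
vanishing of the O'Neill tensor.

Consequently brackets of horizontal fields are horizontal. In a chart in which `π` is the
projection `E' × F → E'`, the horizontal distribution is the graph of a smooth family of linear maps
`L p : E' → F`, and its integral manifolds are the graphs of the solutions of the total
differential equation `s'(z) = L (z, s z)`. The brackets of the horizontal fields `(u, L u)`, with
`u` constant, are vertical and horizontal, hence zero, which is the integrability condition of this
equation. It is solved in `ParaQ.exists_solution_total_differential_equation`, by integration along
the rays from a point, and this gives `ParaQ.IsParaquaternionicSubmersion.isIntegrable`.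

Let `ι : N → M` be an integral manifold of the horizontal distribution. It is totally geodesic: if
`Y` is horizontal along `N` and `V` is vertical, then `g (∇_v Y, V) = - g (Y, ∇_v V) = 0` for `v`
tangent to `N`. The map `π ∘ ι : N → M'` is a local diffeomorphism, and the metric and the structure
induced on `N` from `M` agree with those induced from `M'`. Hence no intrinsic computation on `N`
is needed: paraquaternionic Kähler structures are pulled back by local diffeomorphisms
(`ParaQ.IsParaquaternionicKahler.induced`).
-/

noncomputable section

namespace ParaQ

/-! ### Completely integrable systems of total differential equations -/

section TotalDifferentialEquation

open Metric

/-- The solution of the Picard-Lindelöf theorem stays in the ball on which the vector field is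
controlled. -/
theorem _root_.IsPicardLindelof.exists_hasDerivWithinAt_mem_closedBall
    {E : Type*} [NormedAddCommGroup E] [NormedSpace ℝ E] [CompleteSpace E]
    {f : ℝ → E → E} {tmin tmax : ℝ} {t₀ : Icc tmin tmax} {x₀ x : E} {a r L K : NNReal}
    (hf : IsPicardLindelof f t₀ x₀ a r L K) (hx : x ∈ closedBall x₀ r) :
    ∃ α : ℝ → E, α t₀ = x ∧
      ∀ t ∈ Icc tmin tmax, HasDerivWithinAt α (f t (α t)) (Icc tmin tmax) t ∧
        α t ∈ closedBall x₀ a := by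
  obtain ⟨α, hα⟩ := ODE.FunSpace.exists_isFixedPt_next hf hx
  refine ⟨α.compProj, by rw [ODE.FunSpace.compProj_val, ← hα, ODE.FunSpace.next_apply₀],
    fun t ht ↦ ⟨?_, α.compProj_mem_closedBall hf.mul_max_le⟩⟩
  apply ODE.hasDerivWithinAt_picard_Icc t₀.2 hf.continuousOn_uncurry
    α.continuous_compProj.continuousOn (fun _ ht' ↦ α.compProj_mem_closedBall hf.mul_max_le)
    x ht |>.congr_of_mem _ ht
  intro t' ht'
  nth_rw 1 [← hα]
  rw [ODE.FunSpace.compProj_of_mem ht', ODE.FunSpace.next_apply]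

variable {G F : Type*} [NormedAddCommGroup G] [NormedSpace ℝ G]
  [NormedAddCommGroup F] [NormedSpace ℝ F]

/-- Uniform bounds for a smooth map on a small ball: it is bounded and Lipschitz there, its
derivative is bounded, and its first order Taylor remainder is quadratic. -/
theorem exists_closedBall_taylor_bound {P Q : Type*} [NormedAddCommGroup P] [NormedSpace ℝ P]
    [NormedAddCommGroup Q] [NormedSpace ℝ Q] {L : P → Q} {W : Set P} (hW : IsOpen W)
    (hL : ContDiffOn ℝ ∞ L W) {p₀ : P} (hp₀ : p₀ ∈ W) :
    ∃ ρ : ℝ, 0 < ρ ∧ ∃ C : NNReal, 0 < C ∧ closedBall p₀ ρ ⊆ W ∧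
      (∀ p ∈ closedBall p₀ ρ, ‖L p‖ ≤ C) ∧ LipschitzOnWith C L (closedBall p₀ ρ) ∧
      (∀ p ∈ closedBall p₀ ρ, ‖fderiv ℝ L p‖ ≤ C) ∧
      ∀ p ∈ closedBall p₀ ρ, ∀ q ∈ closedBall p₀ ρ,
        ‖L q - L p - fderiv ℝ L p (q - p)‖ ≤ C * ‖q - p‖ ^ 2 := by
  have hLat : ContDiffAt ℝ ∞ L p₀ := hL.contDiffAt (hW.mem_nhds hp₀)
  obtain ⟨K₁, t₁, ht₁, hK₁⟩ := (hLat.of_le (m := 1) (by simp)).exists_lipschitzOnWith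
  have hDat : ContDiffAt ℝ 1 (fderiv ℝ L) p₀ := (contDiffAt_infty.1 hLat 2).fderiv_right
    (m := 1) (by rw [one_add_one_eq_two]; rfl)
  obtain ⟨K₂, t₂, ht₂, hK₂⟩ := hDat.exists_lipschitzOnWith
  obtain ⟨ρ₀, hρ₀, hsub⟩ := nhds_basis_closedBall.mem_iff.1
    (Filter.inter_mem (Filter.inter_mem ht₁ ht₂) (hW.mem_nhds hp₀))
  let ρ := min ρ₀ 1
  have hρ : 0 < ρ := lt_min hρ₀ one_pos
  have hsub' : closedBall p₀ ρ ⊆ (t₁ ∩ t₂) ∩ W :=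
    (closedBall_subset_closedBall (min_le_left _ _)).trans hsub
  have hmem : p₀ ∈ closedBall p₀ ρ := mem_closedBall_self hρ.le
  let C : NNReal := ‖L p₀‖₊ + ‖fderiv ℝ L p₀‖₊ + K₁ + K₂ + 1
  have hC1 : (K₁ : ℝ) + ‖L p₀‖ ≤ C := by
    simp only [C, NNReal.coe_add, coe_nnnorm, NNReal.coe_one]
    have := norm_nonneg (fderiv ℝ L p₀)
    linarith [K₂.coe_nonneg]
  have hC2 : (K₂ : ℝ) + ‖fderiv ℝ L p₀‖ ≤ C := by
    simp only [C, NNReal.coe_add, coe_nnnorm, NNReal.coe_one]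
    have := norm_nonneg (L p₀)
    linarith [K₁.coe_nonneg]
  have hball : ∀ p ∈ closedBall p₀ ρ, ‖p - p₀‖ ≤ 1 := fun p hp ↦
    (mem_closedBall_iff_norm.1 hp).trans (min_le_right _ _)
  refine ⟨ρ, hρ, C, by positivity, fun p hp ↦ (hsub' hp).2, fun p hp ↦ ?_, ?_, fun p hp ↦ ?_,
    fun p hp q hq ↦ ?_⟩
  · have h := hK₁.norm_sub_le (hsub' hp).1.1 (hsub' hmem).1.1
    have h2 : ‖L p‖ ≤ ‖L p - L p₀‖ + ‖L p₀‖ := norm_le_norm_sub_add _ _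
    have h3 := mul_le_mul_of_nonneg_left (hball p hp) K₁.coe_nonneg
    linarith
  · refine (hK₁.mono fun p hp ↦ (hsub' hp).1.1).weaken ?_
    rw [← NNReal.coe_le_coe]
    linarith [norm_nonneg (L p₀)]
  · have h := hK₂.norm_sub_le (hsub' hp).1.2 (hsub' hmem).1.2
    have h2 : ‖fderiv ℝ L p‖ ≤ ‖fderiv ℝ L p - fderiv ℝ L p₀‖ + ‖fderiv ℝ L p₀‖ :=
      norm_le_norm_sub_add _ _
    have h3 := mul_le_mul_of_nonneg_left (hball p hp) K₂.coe_nonneg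
    linarith
  · -- on the segment from `p` to `q` the derivative is within `C * ‖q - p‖` of `fderiv ℝ L p`
    have hseg : segment ℝ p q ⊆ closedBall p₀ ρ := (convex_closedBall p₀ ρ).segment_subset hp hq
    have hbound : ∀ x ∈ segment ℝ p q, ‖fderiv ℝ L x - fderiv ℝ L p‖ ≤ C * ‖q - p‖ := by
      intro x hx
      have h := hK₂.norm_sub_le (hsub' (hseg hx)).1.2 (hsub' hp).1.2
      have hxp : ‖x - p‖ ≤ ‖q - p‖ := norm_sub_le_of_mem_segment hx
      have hKC : (K₂ : ℝ) ≤ C := by linarith [norm_nonneg (fderiv ℝ L p₀)]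
      exact h.trans (mul_le_mul hKC hxp (norm_nonneg _) C.coe_nonneg)
    have h := (convex_segment p q).norm_image_sub_le_of_norm_hasFDerivWithin_le'
      (f := L) (f' := fderiv ℝ L) (φ := fderiv ℝ L p)
      (fun x hx ↦ ((hL.contDiffAt (hW.mem_nhds (hsub' (hseg hx)).2)).differentiableAt
        (by simp)).hasFDerivAt.hasFDerivWithinAt) hbound
      (left_mem_segment ℝ p q) (right_mem_segment ℝ p q)
    calc _ ≤ C * ‖q - p‖ * ‖q - p‖ := h
      _ = _ := by ring

/-- A map whose increments agree with a linear map up to a quadratic error is differentiable. -/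
theorem hasFDerivAt_of_eventually_norm_sub_le_sq {s : G → F} {z : G} {A : G →L[ℝ] F} {D : ℝ}
    (h : ∀ᶠ k in 𝓝 (0 : G), ‖s (z + k) - s z - A k‖ ≤ D * ‖k‖ ^ 2) : HasFDerivAt s A z := by
  rw [hasFDerivAt_iff_isLittleO_nhds_zero]
  have h1 : (fun k ↦ s (z + k) - s z - A k) =O[𝓝 0] fun k : G ↦ ‖k‖ ^ 2 :=
    Asymptotics.IsBigO.of_bound D (by simpa using h)
  exact h1.trans_isLittleO (Asymptotics.isLittleO_norm_pow_id one_lt_two)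

/-- Local solvability of the total differential equation `s'(z) = L (z, s z)` under the
integrability condition `hint`, which says that `(u, w) ↦ D_{(u, Lu)} L w` is symmetric.
The value `s z` is obtained by integrating the equation along the segment from `p₀.1` to `z`. To
differentiate it in `z`, Grönwall's inequality compares the solutions along two neighbouring
segments: by `hint`, the first order prediction `t ↦ Y t + t • L (z t, Y t) k` solves the equation
along the second segment up to a quadratic error in `k`, so that no smooth dependence of ordinary
differential equations on parameters is needed. -/
theorem exists_solution_total_differential_equation [CompleteSpace F]
    {L : G × F → G →L[ℝ] F} {W : Set (G × F)}
    (hW : IsOpen W) (hL : ContDiffOn ℝ ∞ L W)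
    (hint : ∀ p ∈ W, ∀ u w, fderiv ℝ L p (u, L p u) w = fderiv ℝ L p (w, L p w) u)
    {p₀ : G × F} (hp₀ : p₀ ∈ W) :
    ∃ r > 0, ∃ s : G → F, s p₀.1 = p₀.2 ∧
      ∀ z ∈ ball p₀.1 r, (z, s z) ∈ W ∧ HasFDerivAt s (L (z, s z)) z := by
  obtain ⟨ρ, hρ, C, hC, hB, hLC, hLip, hDC, hQ⟩ := exists_closedBall_taylor_bound hW hL hp₀
  obtain ⟨z₀, y₀⟩ := p₀
  have hprod : ∀ {z y}, ‖z - z₀‖ ≤ ρ → ‖y - y₀‖ ≤ ρ → (z, y) ∈ closedBall (z₀, y₀) ρ := by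
    intro z y hz hy
    rw [mem_closedBall_iff_norm, Prod.mk_sub_mk, Prod.norm_def]
    exact max_le hz hy
  have hCr : (0 : ℝ) < C := hC
  let r : NNReal := ⟨ρ / (2 * (C + 1)), by positivity⟩
  have hr : (0 : ℝ) < r := by change 0 < ρ / (2 * ((C : ℝ) + 1)); positivity
  have hr1 : (r : ℝ) * (2 * (C + 1)) = ρ := by
    change ρ / (2 * ((C : ℝ) + 1)) * (2 * (C + 1)) = ρ
    field_simp
  have hrρ : (r : ℝ) ≤ ρ / 2 := by nlinarith
  have hCrρ : (C : ℝ) * r ≤ ρ / 2 := by nlinarith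
  let a : NNReal := ⟨ρ / 2, by positivity⟩
  have haρ : (a : ℝ) = ρ / 2 := rfl
  have hth : ∀ {h : G} {t : ℝ}, ‖h‖ ≤ r → t ∈ Icc (0 : ℝ) 1 → ‖z₀ + t • h - z₀‖ ≤ ρ := by
    intro h t hh ht
    rw [add_sub_cancel_left, norm_smul, Real.norm_of_nonneg ht.1]
    nlinarith [ht.2, norm_nonneg h, ht.1]
  have hlip : ∀ {h : G} {t : ℝ} {b : ℝ}, ‖h‖ ≤ r → t ∈ Icc (0 : ℝ) 1 → b ≤ ρ →
      LipschitzOnWith (C * r) (fun y ↦ L (z₀ + t • h, y) h) (closedBall y₀ b) := by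
    intro h t b hh ht hb
    refine LipschitzOnWith.of_dist_le_mul fun y hy y' hy' ↦ ?_
    have hy1 := (mem_closedBall_iff_norm.1 hy).trans hb
    have hy2 := (mem_closedBall_iff_norm.1 hy').trans hb
    have h1 := hLip.norm_sub_le (hprod (hth hh ht) hy1) (hprod (hth hh ht) hy2)
    have h2 : ‖(z₀ + t • h, y) - (z₀ + t • h, y')‖ = ‖y - y'‖ := by
      simp [Prod.norm_def]
    rw [h2] at h1
    rw [dist_eq_norm, dist_eq_norm, ← sub_apply]
    calc _ ≤ _ := ContinuousLinearMap.le_opNorm _ _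
      _ ≤ (C * ‖y - y'‖) * r := mul_le_mul h1 hh (norm_nonneg _) (by positivity)
      _ = _ := by push_cast; ring
  have hpic : ∀ h : G, ‖h‖ ≤ r → IsPicardLindelof (fun t y ↦ L (z₀ + t • h, y) h)
      (⟨0, by simp⟩ : Icc (0 : ℝ) 1) y₀ a 0 (C * r) (C * r) := by
    intro h hh
    refine ⟨fun t ht ↦ hlip hh ht (by rw [haρ]; linarith), fun y hy ↦ ?_, fun t ht y hy ↦ ?_, ?_⟩
    · have hcont : ContinuousOn (fun t : ℝ ↦ L (z₀ + t • h, y)) (Icc 0 1) := by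
        refine hL.continuousOn.comp (by fun_prop) fun t ht ↦ hB (hprod (hth hh ht) ?_)
        have := mem_closedBall_iff_norm.1 hy
        rw [haρ] at this
        linarith
      exact hcont.clm_apply continuousOn_const
    · have hy' := mem_closedBall_iff_norm.1 hy
      rw [haρ] at hy'
      have h1 := hLC _ (hprod (hth hh ht) (y := y) (by linarith))
      calc _ ≤ _ := ContinuousLinearMap.le_opNorm _ _
        _ ≤ (C : ℝ) * r := mul_le_mul h1 hh (norm_nonneg _) (by positivity)
        _ = _ := by push_cast; rfl
    · simpa [haρ] using hCrρ
  have hsol : ∀ h : G, ‖h‖ ≤ r → ∃ Y : ℝ → F, Y 0 = y₀ ∧ ∀ t ∈ Icc (0 : ℝ) 1,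
      HasDerivWithinAt Y (L (z₀ + t • h, Y t) h) (Icc 0 1) t ∧ Y t ∈ closedBall y₀ (ρ / 2) :=
    fun h hh ↦ (hpic h hh).exists_hasDerivWithinAt_mem_closedBall (mem_closedBall_self (by simp))
  choose! Y hY0 hY using hsol
  let s : G → F := fun z ↦ Y (z - z₀) 1
  have h01 : (1 : ℝ) ∈ Icc (0 : ℝ) 1 := by simp
  refine ⟨r, hr, s, ?_, fun z hz ↦ ?_⟩
  · -- along the constant segment the solution is constant
    have hz : ‖(0 : G)‖ ≤ r := by simp
    have hconst := constant_of_has_deriv_right_zero (f := Y 0) (a := 0) (b := 1)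
      (fun t ht ↦ (hY 0 hz t ht).1.continuousWithinAt) (fun t ht ↦ by
        have := (hY 0 hz t ⟨ht.1, ht.2.le⟩).1
        rw [map_zero] at this
        exact this.mono_of_mem_nhdsWithin (Icc_mem_nhdsGE_of_mem ht)) 1 h01
    change Y (z₀ - z₀) 1 = y₀
    rw [sub_self, hconst, hY0 0 hz]
  · have hzr : ‖z - z₀‖ < r := mem_ball_iff_norm.1 hz
    set h := z - z₀ with hh
    have hzh : z₀ + (1 : ℝ) • h = z := by rw [hh]; module
    have hY1 := mem_closedBall_iff_norm.1 (hY h hzr.le 1 h01).2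
    refine ⟨hB (hprod (by linarith) (by change ‖Y h 1 - y₀‖ ≤ ρ; linarith)), ?_⟩
    let ε : ℝ := C * (1 + C) ^ 2 * r + C * (1 + C)
    have hK : ((C * r : NNReal) : ℝ) ≠ 0 := by push_cast; positivity
    refine hasFDerivAt_of_eventually_norm_sub_le_sq
      (D := ε / ((C * r : NNReal) : ℝ) * (Real.exp (((C * r : NNReal) : ℝ) * (1 - 0)) - 1)) ?_
    have hk1 : ∀ᶠ k in 𝓝 (0 : G), ‖h + k‖ < r := by
      have : Filter.Tendsto (fun k : G ↦ ‖h + k‖) (𝓝 0) (𝓝 ‖h‖) :=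
        Continuous.tendsto' (by fun_prop) _ _ (by simp)
      exact this.eventually_lt_const hzr
    have hk2 : ∀ᶠ k in 𝓝 (0 : G), (C : ℝ) * ‖k‖ < ρ / 2 := by
      have : Filter.Tendsto (fun k : G ↦ (C : ℝ) * ‖k‖) (𝓝 0) (𝓝 0) :=
        Continuous.tendsto' (by fun_prop) _ _ (by simp)
      exact this.eventually_lt_const (by positivity)
    filter_upwards [hk1, hk2] with k hk1 hk2
    let p : ℝ → G × F := fun t ↦ (z₀ + t • h, Y h t)
    have hpB : ∀ t ∈ Icc (0 : ℝ) 1, p t ∈ closedBall (z₀, y₀) ρ := fun t ht ↦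
      hprod (hth hzr.le ht) (by linarith [mem_closedBall_iff_norm.1 (hY h hzr.le t ht).2])
    let Z : ℝ → F := fun t ↦ Y h t + t • L (p t) k
    let Z' : ℝ → F := fun t ↦
      L (p t) h + (t • fderiv ℝ L (p t) (h, L (p t) h) k + (1 : ℝ) • L (p t) k)
    have hZB : ∀ t ∈ Icc (0 : ℝ) 1, Z t ∈ closedBall y₀ ρ := by
      intro t ht
      rw [mem_closedBall_iff_norm]
      have h1 := mem_closedBall_iff_norm.1 (hY h hzr.le t ht).2
      have h2 : ‖t • L (p t) k‖ ≤ C * ‖k‖ := by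
        rw [norm_smul, Real.norm_of_nonneg ht.1]
        have h3 := (L (p t)).le_of_opNorm_le (hLC _ (hpB t ht)) k
        have h4 := norm_nonneg (L (p t) k)
        nlinarith [ht.1, ht.2]
      calc ‖Z t - y₀‖ = ‖(Y h t - y₀) + t • L (p t) k‖ := by congr 1; simp only [Z]; abel
        _ ≤ _ := norm_add_le _ _
        _ ≤ ρ := by linarith
    have hZder : ∀ t ∈ Icc (0 : ℝ) 1, HasDerivWithinAt Z (Z' t) (Icc 0 1) t := by
      intro t ht
      have hp : HasDerivWithinAt p (h, L (p t) h) (Icc 0 1) t := by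
        refine HasDerivWithinAt.prodMk ?_ (hY h hzr.le t ht).1
        simpa using ((hasDerivAt_id t).smul_const h).const_add z₀ |>.hasDerivWithinAt
      have hLp : HasFDerivAt L (fderiv ℝ L (p t)) (p t) :=
        ((hL.contDiffAt (hW.mem_nhds (hB (hpB t ht)))).differentiableAt (by simp)).hasFDerivAt
      have hLk : HasDerivWithinAt (fun t ↦ L (p t) k)
          (fderiv ℝ L (p t) (h, L (p t) h) k) (Icc 0 1) t := by
        have := (hLp.comp_hasDerivWithinAt t hp).clm_apply (hasDerivWithinAt_const t _ k)
        simpa using this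
      exact (hY h hzr.le t ht).1.add ((hasDerivWithinAt_id t _).smul hLk)
    have hright : ∀ {f : ℝ → F} {f' : F} {t : ℝ}, t ∈ Ico (0 : ℝ) 1 →
        HasDerivWithinAt f f' (Icc 0 1) t → HasDerivWithinAt f f' (Ici t) t :=
      fun ht hf ↦ hf.mono_of_mem_nhdsWithin (Icc_mem_nhdsGE_of_mem ht)
    have hcc : ∀ {t : ℝ}, t ∈ Ico (0 : ℝ) 1 → t ∈ Icc (0 : ℝ) 1 := fun ht ↦ ⟨ht.1, ht.2.le⟩
    have hgron := dist_le_of_approx_trajectories_ODE_of_mem (K := C * r) (a := 0) (b := 1)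
      (v := fun t y ↦ L (z₀ + t • (h + k), y) (h + k)) (s := fun _ ↦ closedBall y₀ ρ)
      (f := Y (h + k)) (g := Z) (f' := fun t ↦ L (z₀ + t • (h + k), Y (h + k) t) (h + k))
      (g' := Z') (εf := 0) (εg := ε * ‖k‖ ^ 2) (δ := 0)
      (fun t ht ↦ hlip hk1.le (hcc ht) le_rfl)
      (fun t ht ↦ (hY _ hk1.le t ht).1.continuousWithinAt)
      (fun t ht ↦ hright ht (hY _ hk1.le t (hcc ht)).1)
      (fun t ht ↦ by simp)
      (fun t ht ↦ closedBall_subset_closedBall (by linarith) (hY _ hk1.le t (hcc ht)).2)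
      (fun t ht ↦ (hZder t ht).continuousWithinAt)
      (fun t ht ↦ hright ht (hZder t (hcc ht))) ?_
      (fun t ht ↦ hZB t (hcc ht)) (by simp [Z, hY0 _ hk1.le, hY0 _ hzr.le]) 1 h01
    · rw [gronwallBound_of_K_ne_0 hK, dist_eq_norm] at hgron
      have e1 : z + k - z₀ = h + k := by rw [hh]; abel
      have e2 : p 1 = (z, s z) := by simp only [p, hzh, s]; rfl
      have e3 : s (z + k) - s z - L (z, s z) k = Y (h + k) 1 - Z 1 := by
        simp only [Z, e2, one_smul]
        simp only [s, e1, ← hh]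
        abel
      rw [e3]
      calc _ ≤ _ := hgron
        _ = _ := by ring
    · -- the first order prediction is an approximate solution
      intro t ht
      have ht' := hcc ht
      set A := L (p t) with hA
      let κ : G × F := (k, A k)
      have hκ : ‖κ‖ ≤ (1 + C) * ‖k‖ := by
        rw [Prod.norm_def]
        refine max_le ?_ ?_
        · nlinarith [norm_nonneg k]
        · have := A.le_of_opNorm_le (hLC _ (hpB t ht')) k
          linarith [norm_nonneg k]
      have hqp : (z₀ + t • (h + k), Z t) - p t = t • κ := by
        simp only [p, Z, κ, Prod.mk_sub_mk, Prod.smul_mk]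
        congr 1
        · module
        · module
      have hq : (z₀ + t • (h + k), Z t) ∈ closedBall (z₀, y₀) ρ :=
        hprod (hth hk1.le ht') (mem_closedBall_iff_norm.1 (hZB t ht'))
      have hR := hQ _ (hpB t ht') _ hq
      rw [hqp] at hR
      set R := L (z₀ + t • (h + k), Z t) - L (p t) - fderiv ℝ L (p t) (t • κ) with hRdef
      have hsymm := hint _ (hB (hpB t ht')) h k
      have key : Z' t - L (z₀ + t • (h + k), Z t) (h + k) =
          -(R (h + k)) - t • fderiv ℝ L (p t) κ k := by
        simp only [Z', hRdef, hsymm, map_smul, sub_apply,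
          smul_apply, map_add, κ, hA]
        module
      have htκ : ‖t • κ‖ ≤ (1 + C) * ‖k‖ := by
        rw [norm_smul, Real.norm_of_nonneg ht.1]
        nlinarith [norm_nonneg κ, ht.1, ht.2]
      have hR1 : ‖R (h + k)‖ ≤ C * ((1 + C) * ‖k‖) ^ 2 * r := by
        calc _ ≤ _ := R.le_opNorm _
          _ ≤ _ := mul_le_mul (hR.trans (by gcongr)) hk1.le (norm_nonneg _) (by positivity)
      have hD1 : ‖t • fderiv ℝ L (p t) κ k‖ ≤ C * ((1 + C) * ‖k‖) * ‖k‖ := by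
        have h1 : ‖fderiv ℝ L (p t) κ‖ ≤ C * ((1 + C) * ‖k‖) :=
          ((fderiv ℝ L (p t)).le_of_opNorm_le (hDC _ (hpB t ht')) κ).trans (by gcongr)
        have h2 := (fderiv ℝ L (p t) κ).le_of_opNorm_le h1 k
        rw [norm_smul, Real.norm_of_nonneg ht.1]
        nlinarith [norm_nonneg (fderiv ℝ L (p t) κ k), ht.1, ht.2]
      rw [dist_eq_norm, key]
      calc _ ≤ ‖-(R (h + k))‖ + ‖t • fderiv ℝ L (p t) κ k‖ := norm_sub_le _ _
        _ ≤ C * ((1 + C) * ‖k‖) ^ 2 * r + C * ((1 + C) * ‖k‖) * ‖k‖ := by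
          rw [norm_neg]; exact add_le_add hR1 hD1
        _ = _ := by simp only [ε]; ring

/-- Differentiable solutions of a total differential equation with smooth right-hand side are
smooth. -/
theorem contDiffOn_of_hasFDerivAt_graph {L : G × F → G →L[ℝ] F} {W : Set (G × F)}
    (hL : ContDiffOn ℝ ∞ L W) {s : G → F} {U : Set G} (hU : IsOpen U)
    (hs : ∀ z ∈ U, (z, s z) ∈ W ∧ HasFDerivAt s (L (z, s z)) z) : ContDiffOn ℝ ∞ s U := by
  have hnat : ∀ n : ℕ, ContDiffOn ℝ n s U := by
    intro n
    induction n with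
    | zero =>
      exact contDiffOn_zero.2 fun z hz ↦ (hs z hz).2.continuousAt.continuousWithinAt
    | succ n ih =>
      rw [Nat.cast_succ, contDiffOn_succ_iff_fderiv_of_isOpen hU]
      refine ⟨fun z hz ↦ (hs z hz).2.differentiableAt.differentiableWithinAt, by simp, ?_⟩
      have : ContDiffOn ℝ n (fun z ↦ L (z, s z)) U :=
        (hL.of_le (by exact_mod_cast le_top)).comp (contDiffOn_id.prodMk ih) fun z hz ↦ (hs z hz).1
      exact this.congr fun z hz ↦ (hs z hz).2.fderiv
  exact contDiffOn_infty.2 hnat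

end TotalDifferentialEquation

/-! ### Smoothness criteria for tensor fields and local inverses -/

section HomSections

open Bundle

variable {E : Type*} [NormedAddCommGroup E] [NormedSpace ℝ E]
  {M : Type*} [TopologicalSpace M] [ChartedSpace E M]

/-- A map into a space of linear maps on a finite-dimensional space is smooth as soon as its
evaluations are. -/
theorem contMDiffAt_clm_of_apply {Q : Type*} [NormedAddCommGroup Q] [NormedSpace ℝ Q]
    {V : Type*} [NormedAddCommGroup V] [NormedSpace ℝ V] [FiniteDimensional ℝ V]
    {f : M → V →L[ℝ] Q} {x : M}
    (h : ∀ a, ContMDiffAt 𝓘(ℝ, E) 𝓘(ℝ, Q) ∞ (fun y ↦ f y a) x) :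
    ContMDiffAt 𝓘(ℝ, E) 𝓘(ℝ, V →L[ℝ] Q) ∞ f x := by
  let b := Module.finBasis ℝ V
  let A : (Fin (Module.finrank ℝ V) → Q) → V →L[ℝ] Q := fun q ↦
    ∑ i, ContinuousLinearMap.smulRightL ℝ V Q (LinearMap.toContinuousLinearMap (b.coord i)) (q i)
  have hA : ContDiff ℝ ∞ A := ContDiff.sum fun i _ ↦
    (ContinuousLinearMap.contDiff _).comp (contDiff_apply ℝ Q i)
  have hf : f = A ∘ fun y i ↦ f y (b i) := by
    ext y v
    have hv : f y v = ∑ i, b.repr v i • f y (b i) := by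
      conv_lhs => rw [← b.sum_repr v, map_sum]
      simp only [map_smul]
    rw [hv]
    simp [A]
  rw [hf]
  exact hA.contMDiff.contMDiffAt.comp x (contMDiffAt_pi_space.2 fun i ↦ h (b i))

variable [IsManifold 𝓘(ℝ, E) ∞ M]

theorem SmoothEndOn.contMDiffAt_apply {S : EndField E M} {U : Set M} (hS : SmoothEndOn S U)
    (hU : IsOpen U) {x : M} (hx : x ∈ U) {X : Π x : M, TangentSpace 𝓘(ℝ, E) x}
    (hX : ContMDiffAt 𝓘(ℝ, E) 𝓘(ℝ, E).tangent ∞ (T% X) x) :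
    ContMDiffAt 𝓘(ℝ, E) 𝓘(ℝ, E).tangent ∞ (T% fun x ↦ S x (X x)) x :=
  (hS.contMDiffAt (hU.mem_nhds hx)).clm_bundle_apply hX

theorem SmoothEndOn.mdifferentiableAt_apply {S : EndField E M} {U : Set M} (hS : SmoothEndOn S U)
    (hU : IsOpen U) {x : M} (hx : x ∈ U) {X : Π x : M, TangentSpace 𝓘(ℝ, E) x}
    (hX : MDiffAt (T% X) x) : MDiffAt (T% fun x ↦ S x (X x)) x :=
  ((hS.contMDiffAt (hU.mem_nhds hx)).mdifferentiableAt (by simp)).clm_bundle_apply hX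

theorem IsSemiRiemannianMetric.contMDiffAt_apply {g : BilinField E M}
    (hg : IsSemiRiemannianMetric g) {x : M} {X Y : Π x : M, TangentSpace 𝓘(ℝ, E) x}
    (hX : ContMDiffAt 𝓘(ℝ, E) 𝓘(ℝ, E).tangent ∞ (T% X) x)
    (hY : ContMDiffAt 𝓘(ℝ, E) 𝓘(ℝ, E).tangent ∞ (T% Y) x) :
    ContMDiffAt 𝓘(ℝ, E) 𝓘(ℝ, ℝ) ∞ (fun x ↦ g x (X x) (Y x)) x := by
  have := (hg.smooth x).clm_bundle_apply₂ (F₃ := ℝ) (E₃ := Bundle.Trivial M ℝ) hX hY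
  exact (contMDiffAt_section _).1 this

theorem IsSemiRiemannianMetric.mdifferentiableAt_apply {g : BilinField E M}
    (hg : IsSemiRiemannianMetric g) {x : M} {X Y : Π x : M, TangentSpace 𝓘(ℝ, E) x}
    (hX : MDiffAt (T% X) x) (hY : MDiffAt (T% Y) x) :
    MDiffAt (fun x ↦ g x (X x) (Y x)) x := by
  have := ((hg.smooth x).mdifferentiableAt (by simp)).clm_bundle_apply₂
    (F₃ := ℝ) (E₃ := Bundle.Trivial M ℝ) hX hY
  exact (mdifferentiableAt_section 𝓘(ℝ, E) _).1 this

variable [FiniteDimensional ℝ E]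

/-- A section of `Hom(TM, V)` is smooth as soon as it maps smooth vector fields to smooth sections
of `V`. -/
theorem contMDiffAt_hom_section_of_apply
    {F : Type*} [NormedAddCommGroup F] [NormedSpace ℝ F] {V : M → Type*}
    [∀ x, AddCommGroup (V x)] [∀ x, Module ℝ (V x)] [TopologicalSpace (TotalSpace F V)]
    [∀ x, TopologicalSpace (V x)] [∀ x, IsTopologicalAddGroup (V x)]
    [∀ x, ContinuousSMul ℝ (V x)] [FiberBundle F V] [VectorBundle ℝ F V]
    [ContMDiffVectorBundle ∞ F V 𝓘(ℝ, E)]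
    {S : Π x : M, TangentSpace 𝓘(ℝ, E) x →L[ℝ] V x} {x₀ : M}
    (h : ∀ X : Π x : M, TangentSpace 𝓘(ℝ, E) x,
      ContMDiffAt 𝓘(ℝ, E) 𝓘(ℝ, E).tangent ∞ (T% X) x₀ →
      ContMDiffAt 𝓘(ℝ, E) (𝓘(ℝ, E).prod 𝓘(ℝ, F)) ∞ (fun x ↦ TotalSpace.mk' F x (S x (X x))) x₀) :
    ContMDiffAt 𝓘(ℝ, E) (𝓘(ℝ, E).prod 𝓘(ℝ, E →L[ℝ] F)) ∞
      (fun x ↦ TotalSpace.mk' (E →L[ℝ] F) (E := fun x ↦ TangentSpace 𝓘(ℝ, E) x →L[ℝ] V x)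
        x (S x)) x₀ := by
  rw [contMDiffAt_hom_bundle]
  refine ⟨contMDiffAt_id, contMDiffAt_clm_of_apply fun a ↦ ?_⟩
  let e := trivializationAt E (TangentSpace 𝓘(ℝ, E)) x₀
  have hx₀ : x₀ ∈ e.baseSet := FiberBundle.mem_baseSet_trivializationAt' x₀
  have hX : ContMDiffAt 𝓘(ℝ, E) 𝓘(ℝ, E).tangent ∞ (T% (fun y ↦ e.symm y a)) x₀ := by
    rw [contMDiffAt_section]
    refine contMDiffAt_const (c := a) |>.congr_of_eventuallyEq ?_
    filter_upwards [e.open_baseSet.mem_nhds hx₀] with y hy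
    exact congrArg Prod.snd (e.apply_mk_symm hy a)
  have hSX := (contMDiffAt_section _).1 (h _ hX)
  refine hSX.congr_of_eventuallyEq ?_
  have h2 := (trivializationAt F V x₀).open_baseSet.mem_nhds
    (FiberBundle.mem_baseSet_trivializationAt' x₀)
  filter_upwards [h2, e.open_baseSet.mem_nhds hx₀] with y hy hy'
  simp only [ContinuousLinearMap.inCoordinates, ContinuousLinearMap.comp_apply,
    Trivialization.continuousLinearMapAt_apply]
  rw [Trivialization.coe_linearMapAt_of_mem _ hy, Trivialization.symmL_apply]
  exact hy'

/-- A `(1,1)`-tensor field is smooth at a point as soon as it maps smooth vector fields to smooth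
vector fields. -/
theorem contMDiffAt_endField_of_apply {S : EndField E M} {x₀ : M}
    (h : ∀ X : Π x : M, TangentSpace 𝓘(ℝ, E) x,
      ContMDiffAt 𝓘(ℝ, E) 𝓘(ℝ, E).tangent ∞ (T% X) x₀ →
      ContMDiffAt 𝓘(ℝ, E) 𝓘(ℝ, E).tangent ∞ (T% fun x ↦ S x (X x)) x₀) :
    ContMDiffAt 𝓘(ℝ, E) (𝓘(ℝ, E).prod 𝓘(ℝ, E →L[ℝ] E)) ∞
      (fun x ↦ (⟨x, S x⟩ : TotalSpace (E →L[ℝ] E)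
        (fun x : M ↦ TangentSpace 𝓘(ℝ, E) x →L[ℝ] TangentSpace 𝓘(ℝ, E) x))) x₀ :=
  contMDiffAt_hom_section_of_apply h

/-- A `(0,2)`-tensor field is smooth at a point as soon as its values on smooth vector fields are
smooth functions. -/
theorem contMDiffAt_bilinField_of_apply {g : BilinField E M} {x₀ : M}
    (h : ∀ X Y : Π x : M, TangentSpace 𝓘(ℝ, E) x,
      ContMDiffAt 𝓘(ℝ, E) 𝓘(ℝ, E).tangent ∞ (T% X) x₀ →
      ContMDiffAt 𝓘(ℝ, E) 𝓘(ℝ, E).tangent ∞ (T% Y) x₀ →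
      ContMDiffAt 𝓘(ℝ, E) 𝓘(ℝ, ℝ) ∞ (fun x ↦ g x (X x) (Y x)) x₀) :
    ContMDiffAt 𝓘(ℝ, E) (𝓘(ℝ, E).prod 𝓘(ℝ, E →L[ℝ] E →L[ℝ] ℝ)) ∞
      (fun x ↦ (⟨x, g x⟩ : TotalSpace (E →L[ℝ] E →L[ℝ] ℝ)
        (fun x : M ↦ TangentSpace 𝓘(ℝ, E) x →L[ℝ] TangentSpace 𝓘(ℝ, E) x →L[ℝ] ℝ))) x₀ := by
  refine contMDiffAt_hom_section_of_apply fun X hX ↦ ?_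
  refine contMDiffAt_hom_section_of_apply (V := Bundle.Trivial M ℝ) fun Y hY ↦ ?_
  rw [contMDiffAt_section]
  exact h X Y hX hY

end HomSections

section LocalInverse

variable {F : Type*} [NormedAddCommGroup F] [NormedSpace ℝ F]
  {N : Type*} [TopologicalSpace N] [ChartedSpace F N]
  {E : Type*} [NormedAddCommGroup E] [NormedSpace ℝ E]
  {M : Type*} [TopologicalSpace M] [ChartedSpace E M]

/-- `ψ` is a smooth local inverse of `ϕ` at `y`. (Smoothness is required at all nearby points,
since `ContMDiffAt` of order `∞` at one point does not imply it.) -/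
structure IsLocalInverseAt (ϕ : N → M) (ψ : M → N) (y : N) : Prop where
  smooth : ∀ᶠ z in 𝓝 y, ContMDiffAt 𝓘(ℝ, F) 𝓘(ℝ, E) ∞ ϕ z
  smooth_inv : ∀ᶠ m in 𝓝 (ϕ y), ContMDiffAt 𝓘(ℝ, E) 𝓘(ℝ, F) ∞ ψ m
  left : ∀ᶠ z in 𝓝 y, ψ (ϕ z) = z
  right : ∀ᶠ m in 𝓝 (ϕ y), ϕ (ψ m) = m

namespace IsLocalInverseAt

variable {ϕ : N → M} {ψ : M → N} {y : N}

theorem inv_apply (h : IsLocalInverseAt (F := F) (E := E) ϕ ψ y) : ψ (ϕ y) = y :=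
  h.left.self_of_nhds

theorem contMDiffAt (h : IsLocalInverseAt (F := F) (E := E) ϕ ψ y) :
    ContMDiffAt 𝓘(ℝ, F) 𝓘(ℝ, E) ∞ ϕ y :=
  h.smooth.self_of_nhds

theorem contMDiffAt_inv (h : IsLocalInverseAt (F := F) (E := E) ϕ ψ y) :
    ContMDiffAt 𝓘(ℝ, E) 𝓘(ℝ, F) ∞ ψ (ϕ y) :=
  h.smooth_inv.self_of_nhds

theorem symm (h : IsLocalInverseAt (F := F) (E := E) ϕ ψ y) :
    IsLocalInverseAt (F := E) (E := F) ψ ϕ (ϕ y) :=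
  ⟨h.smooth_inv, by rw [h.inv_apply]; exact h.smooth, h.right,
    by rw [h.inv_apply]; exact h.left⟩

theorem eventually (h : IsLocalInverseAt (F := F) (E := E) ϕ ψ y) :
    ∀ᶠ z in 𝓝 y, IsLocalInverseAt (F := F) (E := E) ϕ ψ z := by
  have hc := h.contMDiffAt.continuousAt
  filter_upwards [h.smooth.eventually_nhds, hc.eventually h.smooth_inv.eventually_nhds,
    h.left.eventually_nhds, hc.eventually h.right.eventually_nhds] with z h1 h2 h3 h4
    using ⟨h1, h2, h3, h4⟩

theorem mfderiv_inv_comp (h : IsLocalInverseAt (F := F) (E := E) ϕ ψ y) :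
    (mfderiv 𝓘(ℝ, E) 𝓘(ℝ, F) ψ (ϕ y)).comp (mfderiv 𝓘(ℝ, F) 𝓘(ℝ, E) ϕ y) =
      ContinuousLinearMap.id ℝ (TangentSpace 𝓘(ℝ, F) y) := by
  have h1 := mfderiv_comp y (h.contMDiffAt_inv.mdifferentiableAt (by simp))
    (h.contMDiffAt.mdifferentiableAt (by simp))
  have h2 : ψ ∘ ϕ =ᶠ[𝓝 y] id := h.left
  rw [h2.mfderiv_eq, mfderiv_id] at h1
  exact h1.symm

theorem mfderiv_comp_inv (h : IsLocalInverseAt (F := F) (E := E) ϕ ψ y) :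
    (mfderiv 𝓘(ℝ, F) 𝓘(ℝ, E) ϕ y).comp (mfderiv 𝓘(ℝ, E) 𝓘(ℝ, F) ψ (ϕ y)) =
      ContinuousLinearMap.id ℝ (TangentSpace 𝓘(ℝ, E) (ϕ y)) := by
  have h1 := h.symm.mfderiv_inv_comp
  rw [h.inv_apply] at h1
  exact h1

end IsLocalInverseAt

/-- The inverse function theorem on manifolds. -/
theorem exists_isLocalInverseAt [FiniteDimensional ℝ F] [FiniteDimensional ℝ E]
    [IsManifold 𝓘(ℝ, F) ∞ N] [IsManifold 𝓘(ℝ, E) ∞ M] {ϕ : N → M}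
    (hϕ : ContMDiff 𝓘(ℝ, F) 𝓘(ℝ, E) ∞ ϕ)
    (hd : ∀ y, Function.Bijective (mfderiv 𝓘(ℝ, F) 𝓘(ℝ, E) ϕ y)) (y : N) :
    ∃ ψ : M → N, IsLocalInverseAt (F := F) (E := E) ϕ ψ y := by
  let c := chartAt F y
  let d := chartAt E (ϕ y)
  have hcs : y ∈ c.source := mem_chart_source F y
  have hds : ϕ y ∈ d.source := mem_chart_source E (ϕ y)
  have hc : c ∈ IsManifold.maximalAtlas 𝓘(ℝ, F) ∞ N := IsManifold.chart_mem_maximalAtlas y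
  have hd' : d ∈ IsManifold.maximalAtlas 𝓘(ℝ, E) ∞ M := IsManifold.chart_mem_maximalAtlas (ϕ y)
  have hcm : c.MDifferentiable 𝓘(ℝ, F) 𝓘(ℝ, F) :=
    mdifferentiable_of_mem_atlas (chart_mem_atlas F y)
  have hdm : d.MDifferentiable 𝓘(ℝ, E) 𝓘(ℝ, E) :=
    mdifferentiable_of_mem_atlas (chart_mem_atlas E (ϕ y))
  let f : F → E := d ∘ ϕ ∘ c.symm
  have hcy : c.symm (c y) = y := c.left_inv hcs
  have hn : (∞ : WithTop ℕ∞) ≠ 0 := by simp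
  -- `f` is smooth with invertible derivative wherever it reads `ϕ` in the two charts
  have hf : ∀ w ∈ c.target, ϕ (c.symm w) ∈ d.source → ContDiffAt ℝ ∞ f w ∧
      ∃ A : F ≃L[ℝ] E, HasFDerivAt f (A : F →L[ℝ] E) w := by
    intro w hw hw'
    have hcsymm : ContMDiffAt 𝓘(ℝ, F) 𝓘(ℝ, F) ∞ c.symm w :=
      contMDiffAt_symm_of_mem_maximalAtlas hc hw
    have hdat : ContMDiffAt 𝓘(ℝ, E) 𝓘(ℝ, E) ∞ d (ϕ (c.symm w)) :=
      contMDiffAt_of_mem_maximalAtlas hd' hw'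
    have hϕc := (hϕ (c.symm w)).comp w hcsymm
    have hfw : ContMDiffAt 𝓘(ℝ, F) 𝓘(ℝ, E) ∞ f w := ContMDiffAt.comp w hdat hϕc
    have hfd : Function.Bijective (fderiv ℝ f w) := by
      rw [← mfderiv_eq_fderiv]
      have e1 : mfderiv 𝓘(ℝ, F) 𝓘(ℝ, E) f w =
          (mfderiv 𝓘(ℝ, E) 𝓘(ℝ, E) d (ϕ (c.symm w))).comp
            ((mfderiv 𝓘(ℝ, F) 𝓘(ℝ, E) ϕ (c.symm w)).comp
              (mfderiv 𝓘(ℝ, F) 𝓘(ℝ, F) c.symm w)) := by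
        have a1 := mfderiv_comp w (hdat.mdifferentiableAt hn) (hϕc.mdifferentiableAt hn)
        have a2 := mfderiv_comp w ((hϕ (c.symm w)).mdifferentiableAt hn)
          (hcsymm.mdifferentiableAt hn)
        exact a1.trans (by rw [a2]; rfl)
      have e2 := (hdm.mfderiv_bijective hw').comp
        ((hd (c.symm w)).comp (hcm.symm.mfderiv_bijective hw))
      rw [e1]
      exact e2
    let A : F ≃L[ℝ] E := (LinearEquiv.ofBijective (fderiv ℝ f w).toLinearMap
      hfd).toContinuousLinearEquiv
    refine ⟨hfw.contDiffAt, A, ?_⟩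
    have : (A : F →L[ℝ] E) = fderiv ℝ f w := by ext v; rfl
    rw [this]
    exact (hfw.contDiffAt.differentiableAt hn).hasFDerivAt
  obtain ⟨hfy, A, hA⟩ := hf (c y) (c.map_source hcs) (by rwa [hcy])
  let R := hfy.toOpenPartialHomeomorph f hA hn
  have hRs : c y ∈ R.source := hfy.mem_toOpenPartialHomeomorph_source hA hn
  have hRf : ∀ z, R z = f z := fun z ↦ rfl
  have hfcy : f (c y) = d (ϕ y) := by simp [f, hcy]
  let ψ : M → N := c.symm ∘ R.symm ∘ d
  have hRy : R.symm (d (ϕ y)) = c y := by rw [← hfcy, ← hRf]; exact R.left_inv hRs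
  have hψy : ψ (ϕ y) = y := by simp [ψ, hRy, hcy]
  have hRt : d (ϕ y) ∈ R.target := by rw [← hfcy, ← hRf]; exact R.map_source hRs
  have hdc := d.continuousAt hds
  have hRc : ContinuousAt (R.symm ∘ d) (ϕ y) := ContinuousAt.comp (R.continuousAt_symm hRt) hdc
  have hψc : ContinuousAt ψ (ϕ y) := by
    refine ContinuousAt.comp (f := R.symm ∘ d) ?_ hRc
    have := c.continuousAt_symm (c.map_source hcs)
    simpa [hRy] using this
  have ev1 : ∀ᶠ m in 𝓝 (ϕ y), d m ∈ R.target := hdc.eventually (R.open_target.mem_nhds hRt)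
  have ev2 : ∀ᶠ m in 𝓝 (ϕ y), ϕ (ψ m) ∈ d.source := by
    have : ContinuousAt (ϕ ∘ ψ) (ϕ y) :=
      ContinuousAt.comp (by rw [hψy]; exact (hϕ y).continuousAt) hψc
    exact this.eventually (d.open_source.mem_nhds (by simpa [hψy] using hds))
  have ev3 : ∀ᶠ m in 𝓝 (ϕ y), R.symm (d m) ∈ c.target :=
    hRc.eventually (c.open_target.mem_nhds (by simpa [hRy] using c.map_source hcs))
  refine ⟨ψ, Filter.Eventually.of_forall hϕ, ?_, ?_, ?_⟩
  · filter_upwards [ev1, ev2, ev3, d.open_source.mem_nhds hds] with m hm1 hm2 hm3 hm4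
    obtain ⟨hfm, A', hA'⟩ := hf (R.symm (d m)) hm3 hm2
    have h1 : ContMDiffAt 𝓘(ℝ, E) 𝓘(ℝ, F) ∞ R.symm (d m) :=
      (R.contDiffAt_symm hm1 hA' hfm).contMDiffAt
    have h2 : ContMDiffAt 𝓘(ℝ, F) 𝓘(ℝ, F) ∞ c.symm (R.symm (d m)) :=
      contMDiffAt_symm_of_mem_maximalAtlas hc hm3
    exact ContMDiffAt.comp m h2 (ContMDiffAt.comp m h1 (contMDiffAt_of_mem_maximalAtlas hd' hm4))
  · have h1 : ∀ᶠ z in 𝓝 y, c z ∈ R.source :=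
      (c.continuousAt hcs).eventually (R.open_source.mem_nhds hRs)
    filter_upwards [h1, c.open_source.mem_nhds hcs] with z hz1 hz2
    have : d (ϕ z) = R (c z) := by rw [hRf]; simp [f, c.left_inv hz2]
    simp only [ψ, Function.comp_apply, this, R.left_inv hz1, c.left_inv hz2]
  · filter_upwards [ev1, ev2, d.open_source.mem_nhds hds] with m hm1 hm3 hm2
    refine d.injOn hm3 hm2 ?_
    have : d (ϕ (ψ m)) = R (R.symm (d m)) := by rw [hRf]; rfl
    rw [this, R.right_inv hm1]

end LocalInverse

/-! ### Paraquaternionic Kähler structures under local diffeomorphisms -/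

section Transport

variable {F : Type*} [NormedAddCommGroup F] [NormedSpace ℝ F]
  {N : Type*} [TopologicalSpace N] [ChartedSpace F N]
  {E : Type*} [NormedAddCommGroup E] [NormedSpace ℝ E]
  {M : Type*} [TopologicalSpace M] [ChartedSpace E M]
  {ϕ : N → M} {ψ : M → N} {y : N}

namespace IsLocalInverseAt

open VectorField

theorem isInvertible_mfderiv (h : IsLocalInverseAt (F := F) (E := E) ϕ ψ y) :
    (mfderiv 𝓘(ℝ, F) 𝓘(ℝ, E) ϕ y).IsInvertible :=
  .of_inverse (g := mfderiv 𝓘(ℝ, E) 𝓘(ℝ, F) ψ (ϕ y)) h.mfderiv_comp_inv h.mfderiv_inv_comp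

theorem inverse_mfderiv_inv (h : IsLocalInverseAt (F := F) (E := E) ϕ ψ y) :
    (mfderiv 𝓘(ℝ, E) 𝓘(ℝ, F) ψ (ϕ y)).inverse = mfderiv 𝓘(ℝ, F) 𝓘(ℝ, E) ϕ y :=
  ContinuousLinearMap.inverse_eq h.mfderiv_inv_comp h.mfderiv_comp_inv

/-- The pull-back of a vector field by the local inverse is its push-forward. -/
theorem mpullback_inv_apply (h : IsLocalInverseAt (F := F) (E := E) ϕ ψ y)
    (Y : Π z : N, TangentSpace 𝓘(ℝ, F) z) :
    mpullback 𝓘(ℝ, E) 𝓘(ℝ, F) ψ Y (ϕ y) = mfderiv 𝓘(ℝ, F) 𝓘(ℝ, E) ϕ y (Y y) := by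
  have h1 : (Y (ψ (ϕ y)) : F) = Y y := congrArg (fun z ↦ (Y z : F)) h.inv_apply
  have h2 := h.inverse_mfderiv_inv
  exact (congrArg (mfderiv 𝓘(ℝ, E) 𝓘(ℝ, F) ψ (ϕ y)).inverse h1).trans
    (congrArg (fun A : F →L[ℝ] E ↦ A (Y y : F)) h2)

theorem mfderiv_mpullback (h : IsLocalInverseAt (F := F) (E := E) ϕ ψ y)
    (X : Π z : M, TangentSpace 𝓘(ℝ, E) z) :
    mfderiv 𝓘(ℝ, F) 𝓘(ℝ, E) ϕ y (mpullback 𝓘(ℝ, F) 𝓘(ℝ, E) ϕ X y) = X (ϕ y) :=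
  h.isInvertible_mfderiv.self_apply_inverse _

theorem mpullback_mfderiv (h : IsLocalInverseAt (F := F) (E := E) ϕ ψ y)
    (v : TangentSpace 𝓘(ℝ, F) y) :
    (mfderiv 𝓘(ℝ, F) 𝓘(ℝ, E) ϕ y).inverse (mfderiv 𝓘(ℝ, F) 𝓘(ℝ, E) ϕ y v) = v :=
  h.isInvertible_mfderiv.inverse_apply_self _

variable [IsManifold 𝓘(ℝ, F) ∞ N] [IsManifold 𝓘(ℝ, E) ∞ M]

section

variable [FiniteDimensional ℝ F]

theorem contMDiffAt_mpullback (h : IsLocalInverseAt (F := F) (E := E) ϕ ψ y)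
    {X : Π z : M, TangentSpace 𝓘(ℝ, E) z}
    (hX : ContMDiffAt 𝓘(ℝ, E) 𝓘(ℝ, E).tangent ∞ (T% X) (ϕ y)) :
    ContMDiffAt 𝓘(ℝ, F) 𝓘(ℝ, F).tangent ∞ (T% (mpullback 𝓘(ℝ, F) 𝓘(ℝ, E) ϕ X)) y :=
  ContMDiffAt.mpullback_vectorField_preimage hX h.contMDiffAt h.isInvertible_mfderiv le_rfl

theorem mdifferentiableAt_mpullback (h : IsLocalInverseAt (F := F) (E := E) ϕ ψ y)
    {X : Π z : M, TangentSpace 𝓘(ℝ, E) z} (hX : MDiffAt (T% X) (ϕ y)) :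
    MDiffAt (T% (mpullback 𝓘(ℝ, F) 𝓘(ℝ, E) ϕ X)) y :=
  MDifferentiableAt.mpullback_vectorField hX h.contMDiffAt h.isInvertible_mfderiv
    ENat.LEInfty.out

end

variable [FiniteDimensional ℝ E]

theorem contMDiffAt_mpullback_inv (h : IsLocalInverseAt (F := F) (E := E) ϕ ψ y)
    {Y : Π z : N, TangentSpace 𝓘(ℝ, F) z}
    (hY : ContMDiffAt 𝓘(ℝ, F) 𝓘(ℝ, F).tangent ∞ (T% Y) y) :
    ContMDiffAt 𝓘(ℝ, E) 𝓘(ℝ, E).tangent ∞ (T% (mpullback 𝓘(ℝ, E) 𝓘(ℝ, F) ψ Y)) (ϕ y) :=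
  h.symm.contMDiffAt_mpullback (by rw [h.inv_apply]; exact hY)

theorem mdifferentiableAt_mpullback_inv (h : IsLocalInverseAt (F := F) (E := E) ϕ ψ y)
    {Y : Π z : N, TangentSpace 𝓘(ℝ, F) z} (hY : MDiffAt (T% Y) y) :
    MDiffAt (T% (mpullback 𝓘(ℝ, E) 𝓘(ℝ, F) ψ Y)) (ϕ y) :=
  h.symm.mdifferentiableAt_mpullback (by rw [h.inv_apply]; exact hY)

end IsLocalInverseAt

/-- The pull-back `(dϕ)⁻¹ S dϕ` of a `(1,1)`-tensor field by a local diffeomorphism. -/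
def pullbackEnd (ϕ : N → M) (S : EndField E M) : EndField F N := fun y ↦
  (mfderiv 𝓘(ℝ, F) 𝓘(ℝ, E) ϕ y).inverse.comp
    ((S (ϕ y)).comp (mfderiv 𝓘(ℝ, F) 𝓘(ℝ, E) ϕ y))

theorem pullbackEnd_apply (S : EndField E M) (v : TangentSpace 𝓘(ℝ, F) y) :
    pullbackEnd (F := F) ϕ S y v = (mfderiv 𝓘(ℝ, F) 𝓘(ℝ, E) ϕ y).inverse
      (S (ϕ y) (mfderiv 𝓘(ℝ, F) 𝓘(ℝ, E) ϕ y v)) := rfl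

open VectorField in
theorem IsLocalInverseAt.mpullback_inv_pullbackEnd (h : IsLocalInverseAt (F := F) (E := E) ϕ ψ y)
    (S : EndField F N) (Y : Π z : N, TangentSpace 𝓘(ℝ, F) z) :
    ∀ᶠ m in 𝓝 (ϕ y), mpullback 𝓘(ℝ, E) 𝓘(ℝ, F) ψ (fun z ↦ S z (Y z)) m =
      pullbackEnd ψ S m (mpullback 𝓘(ℝ, E) 𝓘(ℝ, F) ψ Y m) := by
  filter_upwards [h.symm.eventually] with m hm
  rw [pullbackEnd_apply, hm.mfderiv_mpullback, mpullback_apply]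

theorem IsLocalInverseAt.pullbackEnd_inv_mfderiv
    (h : IsLocalInverseAt (F := F) (E := E) ϕ ψ y) (S : EndField F N)
    (u : TangentSpace 𝓘(ℝ, F) y) :
    pullbackEnd ψ S (ϕ y) (mfderiv 𝓘(ℝ, F) 𝓘(ℝ, E) ϕ y u) =
      mfderiv 𝓘(ℝ, F) 𝓘(ℝ, E) ϕ y (S y u) :=
  (congrArg (fun w : F ↦ (mfderiv 𝓘(ℝ, E) 𝓘(ℝ, F) ψ (ϕ y)).inverse (S (ψ (ϕ y)) w))
    (DFunLike.congr_fun h.mfderiv_inv_comp u)).trans (h.mpullback_inv_apply fun z ↦ S z (u : F))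

theorem inducedMetric_apply (g : BilinField E M) (v w : TangentSpace 𝓘(ℝ, F) y) :
    inducedMetric (F := F) ϕ g y v w =
      g (ϕ y) (mfderiv 𝓘(ℝ, F) 𝓘(ℝ, E) ϕ y v) (mfderiv 𝓘(ℝ, F) 𝓘(ℝ, E) ϕ y w) := rfl

theorem mem_inducedStructure {σ : EndSubspaceField E M}
    {K : TangentSpace 𝓘(ℝ, F) y →L[ℝ] TangentSpace 𝓘(ℝ, F) y} :
    K ∈ inducedStructure (F := F) ϕ σ y ↔ ∃ J ∈ σ (ϕ y), ∀ v,
      mfderiv 𝓘(ℝ, F) 𝓘(ℝ, E) ϕ y (K v) = J (mfderiv 𝓘(ℝ, F) 𝓘(ℝ, E) ϕ y v) :=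
  exists_congr fun _ ↦ and_congr_right fun _ ↦ ContinuousLinearMap.ext_iff

/-- If `dϕ` is invertible, the induced structure is the conjugate of `σ` by `dϕ`. -/
theorem inducedStructure_eq_map {σ : EndSubspaceField E M}
    (e : TangentSpace 𝓘(ℝ, F) y ≃L[ℝ] TangentSpace 𝓘(ℝ, E) (ϕ y))
    (he : ∀ v, e v = mfderiv 𝓘(ℝ, F) 𝓘(ℝ, E) ϕ y v) :
    inducedStructure (F := F) ϕ σ y =
      (σ (ϕ y)).map (e.symm.arrowCongr e.symm).toLinearEquiv.toLinearMap := by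
  ext K
  rw [mem_inducedStructure, Submodule.mem_map]
  refine exists_congr fun J ↦ and_congr_right fun _ ↦ ?_
  rw [ContinuousLinearMap.ext_iff]
  refine forall_congr' fun v ↦ ?_
  rw [← he, ← he]
  change _ ↔ e.symm (J (e.symm.symm v)) = K v
  rw [ContinuousLinearEquiv.symm_symm, ContinuousLinearEquiv.symm_apply_eq]
  exact eq_comm

variable [FiniteDimensional ℝ F] [FiniteDimensional ℝ E] [IsManifold 𝓘(ℝ, F) ∞ N]
  [IsManifold 𝓘(ℝ, E) ∞ M]

open VectorField

namespace IsLocalInverseAt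

theorem contMDiffAt_pullbackEnd (h : IsLocalInverseAt (F := F) (E := E) ϕ ψ y)
    {S : EndField E M} {U : Set M} (hS : SmoothEndOn S U) (hU : IsOpen U) (hy : ϕ y ∈ U) :
    ContMDiffAt 𝓘(ℝ, F) (𝓘(ℝ, F).prod 𝓘(ℝ, F →L[ℝ] F)) ∞
      (fun x ↦ (⟨x, pullbackEnd ϕ S x⟩ : Bundle.TotalSpace (F →L[ℝ] F)
        (fun x : N ↦ TangentSpace 𝓘(ℝ, F) x →L[ℝ] TangentSpace 𝓘(ℝ, F) x))) y := by
  refine contMDiffAt_endField_of_apply fun X hX ↦ ?_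
  have h1 := h.contMDiffAt_mpullback (hS.contMDiffAt_apply hU hy (h.contMDiffAt_mpullback_inv hX))
  refine h1.congr_of_eventuallyEq ?_
  filter_upwards [h.eventually] with z hz
  congr 1
  rw [mpullback_apply, hz.mpullback_inv_apply, pullbackEnd_apply]

end IsLocalInverseAt

theorem IsSemiRiemannianMetric.inducedMetric {g : BilinField E M} (hg : IsSemiRiemannianMetric g)
    (hψ : ∀ y, ∃ ψ, IsLocalInverseAt (F := F) (E := E) ϕ ψ y) :
    IsSemiRiemannianMetric (inducedMetric (F := F) ϕ g) where
  symm y v w := hg.symm _ _ _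
  nondegenerate y v hv := by
    obtain ⟨ψ, h⟩ := hψ y
    have h1 : mfderiv 𝓘(ℝ, F) 𝓘(ℝ, E) ϕ y v = 0 := hg.nondegenerate _ _ fun w ↦ by
      have := hv ((mfderiv 𝓘(ℝ, F) 𝓘(ℝ, E) ϕ y).inverse w)
      rwa [inducedMetric_apply, h.isInvertible_mfderiv.self_apply_inverse] at this
    rw [← h.mpullback_mfderiv v, h1, map_zero]
  smooth y := by
    obtain ⟨ψ, h⟩ := hψ y
    refine contMDiffAt_bilinField_of_apply fun X Y hX hY ↦ ?_
    have h1 := (hg.contMDiffAt_apply (h.contMDiffAt_mpullback_inv hX)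
      (h.contMDiffAt_mpullback_inv hY)).comp y h.contMDiffAt
    refine h1.congr_of_eventuallyEq ?_
    filter_upwards [h.eventually] with z hz
    rw [inducedMetric_apply, Function.comp_apply, hz.mpullback_inv_apply, hz.mpullback_inv_apply]

theorem IsLocalBasis.pullbackEnd {σ : EndSubspaceField E M} {U : Set M} {J : Fin 3 → EndField E M}
    (hJ : IsLocalBasis σ U J) (hU : IsOpen U)
    (hψ : ∀ y, ∃ ψ, IsLocalInverseAt (F := F) (E := E) ϕ ψ y) :
    IsLocalBasis (inducedStructure (F := F) ϕ σ) (ϕ ⁻¹' U) (fun a ↦ pullbackEnd ϕ (J a)) where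
  smooth a y hy := by
    obtain ⟨ψ, h⟩ := hψ y
    exact (h.contMDiffAt_pullbackEnd (hJ.smooth a) hU hy).contMDiffWithinAt
  span_eq y hy := by
    obtain ⟨ψ, h⟩ := hψ y
    obtain ⟨e, he⟩ := h.isInvertible_mfderiv
    rw [inducedStructure_eq_map e fun v ↦ by rw [← he]; rfl, ← hJ.span_eq _ hy,
      Submodule.map_span, ← range_comp]
    congr 2
    ext a v
    rw [pullbackEnd_apply, ← he, ContinuousLinearMap.inverse_equiv]
    rfl
  sq y hy a := by
    obtain ⟨ψ, h⟩ := hψ y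
    ext v
    have := DFunLike.congr_fun (hJ.sq _ hy a) (mfderiv 𝓘(ℝ, F) 𝓘(ℝ, E) ϕ y v)
    rw [ContinuousLinearMap.comp_apply] at this
    rw [ContinuousLinearMap.comp_apply, pullbackEnd_apply, pullbackEnd_apply,
      h.isInvertible_mfderiv.self_apply_inverse, this]
    simp [h.mpullback_mfderiv]
  mul y hy a := by
    obtain ⟨ψ, h⟩ := hψ y
    ext v
    have := DFunLike.congr_fun (hJ.mul _ hy a) (mfderiv 𝓘(ℝ, F) 𝓘(ℝ, E) ϕ y v)
    rw [ContinuousLinearMap.comp_apply] at this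
    rw [ContinuousLinearMap.comp_apply, pullbackEnd_apply, pullbackEnd_apply,
      h.isInvertible_mfderiv.self_apply_inverse, this]
    simp [pullbackEnd_apply]
  mul_swap y hy a := by
    obtain ⟨ψ, h⟩ := hψ y
    ext v
    have := DFunLike.congr_fun (hJ.mul_swap _ hy a) (mfderiv 𝓘(ℝ, F) 𝓘(ℝ, E) ϕ y v)
    rw [ContinuousLinearMap.comp_apply] at this
    rw [ContinuousLinearMap.comp_apply, pullbackEnd_apply, pullbackEnd_apply,
      h.isInvertible_mfderiv.self_apply_inverse, this]
    simp [pullbackEnd_apply]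

end Transport

section Hermitian

variable {E : Type*} [NormedAddCommGroup E] [NormedSpace ℝ E]
  {M : Type*} [TopologicalSpace M] [ChartedSpace E M] [IsManifold 𝓘(ℝ, E) ∞ M]
  {σ : EndSubspaceField E M} {g : BilinField E M}

theorem IsAlmostParaquaternionicHermitian.skew (h : IsAlmostParaquaternionicHermitian σ g)
    {x : M} {J : TangentSpace 𝓘(ℝ, E) x →L[ℝ] TangentSpace 𝓘(ℝ, E) x} (hJ : J ∈ σ x)
    (v w : TangentSpace 𝓘(ℝ, E) x) : g x v (J w) + g x (J v) w = 0 := by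
  obtain ⟨U, hU, hx, B, hB⟩ := h.almost.exists_basis x
  rw [← hB.span_eq x hx] at hJ
  induction hJ using Submodule.span_induction with
  | mem K hK =>
    obtain ⟨a, rfl⟩ := hK
    exact h.hermitian U B hU hB x hx a v w
  | zero => simp
  | add K L _ _ hK hL =>
    simp only [add_apply, map_add]
    linear_combination hK + hL
  | smul c K _ hK =>
    simp only [smul_apply, map_smul, smul_eq_mul]
    linear_combination c * hK

theorem IsLocalBasis.mem {U : Set M} {J : Fin 3 → EndField E M} (hJ : IsLocalBasis σ U J)
    {x : M} (hx : x ∈ U) (a : Fin 3) : J a x ∈ σ x := by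
  rw [← hJ.span_eq x hx]
  exact Submodule.subset_span (mem_range_self a)

end Hermitian

section PullbackKahler

variable {F : Type*} [NormedAddCommGroup F] [NormedSpace ℝ F]
  {N : Type*} [TopologicalSpace N] [ChartedSpace F N]
  {E : Type*} [NormedAddCommGroup E] [NormedSpace ℝ E]
  {M : Type*} [TopologicalSpace M] [ChartedSpace E M]
  {ϕ : N → M} [FiniteDimensional ℝ E] [IsManifold 𝓘(ℝ, F) ∞ N]
  [IsManifold 𝓘(ℝ, E) ∞ M] {σ : EndSubspaceField E M} {g : BilinField E M}

open VectorField

/-- The pull-back of a linear connection by a local diffeomorphism `ϕ`, computed with the help of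
chosen local inverses `ψ y`. -/
def pullbackConnection (nabla : LinearConnection E M) (ψ : N → M → N)
    (hψ : ∀ y, IsLocalInverseAt (F := F) (E := E) ϕ (ψ y) y) : LinearConnection F N where
  toFun Y y := (mfderiv 𝓘(ℝ, F) 𝓘(ℝ, E) ϕ y).inverse.comp
    ((nabla (mpullback 𝓘(ℝ, E) 𝓘(ℝ, F) (ψ y) Y) (ϕ y)).comp (mfderiv 𝓘(ℝ, F) 𝓘(ℝ, E) ϕ y))
  isCovariantDerivativeOnUniv :=
    { add := fun {X Y y} hX hY _ ↦ by
        rw [mpullback_add, nabla.isCovariantDerivativeOnUniv.add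
          ((hψ y).mdifferentiableAt_mpullback_inv hX) ((hψ y).mdifferentiableAt_mpullback_inv hY),
          ContinuousLinearMap.add_comp, ContinuousLinearMap.comp_add]
      leibniz := fun {Y f y} hY hf _ ↦ by
        have h := hψ y
        have hψd := h.contMDiffAt_inv.mdifferentiableAt (by simp)
        rw [mpullback_smul, nabla.isCovariantDerivativeOnUniv.leibniz
          (h.mdifferentiableAt_mpullback_inv hY)
          (MDifferentiableAt.comp _ (by rw [h.inv_apply]; exact hf) hψd)]
        ext v
        have h1 := mvfderiv_comp_apply_of_eq (ϕ y) hf hψd h.inv_apply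
          (mfderiv 𝓘(ℝ, F) 𝓘(ℝ, E) ϕ y v)
        have h2 : mfderiv 𝓘(ℝ, E) 𝓘(ℝ, F) (ψ y) (ϕ y) (mfderiv 𝓘(ℝ, F) 𝓘(ℝ, E) ϕ y v) = (v : F) :=
          DFunLike.congr_fun h.mfderiv_inv_comp v
        have h3 : mvfderiv 𝓘(ℝ, E) (f ∘ ψ y) (ϕ y) (mfderiv 𝓘(ℝ, F) 𝓘(ℝ, E) ϕ y v) =
          mvfderiv 𝓘(ℝ, F) f y v := h1.trans (congrArg (mvfderiv 𝓘(ℝ, F) f y) h2)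
        change (mfderiv 𝓘(ℝ, F) 𝓘(ℝ, E) ϕ y).inverse (f (ψ y (ϕ y)) • nabla _ _ _ +
          mvfderiv 𝓘(ℝ, E) (f ∘ ψ y) (ϕ y) (mfderiv 𝓘(ℝ, F) 𝓘(ℝ, E) ϕ y v) •
            mpullback _ _ _ _ _) =
          f y • (mfderiv 𝓘(ℝ, F) 𝓘(ℝ, E) ϕ y).inverse _ + mvfderiv 𝓘(ℝ, F) f y v • Y y
        rw [map_add, map_smul, map_smul, h.mpullback_inv_apply, h.mpullback_mfderiv, h.inv_apply]
        exact congrArg₂ (· + ·) rfl (congrArg (· • Y y) h3) }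

theorem mfderiv_pullbackConnection (nabla : LinearConnection E M) {ψ : N → M → N}
    (hψ : ∀ y, IsLocalInverseAt (F := F) (E := E) ϕ (ψ y) y)
    (Y : Π z : N, TangentSpace 𝓘(ℝ, F) z) (y : N) (v : TangentSpace 𝓘(ℝ, F) y) :
    mfderiv 𝓘(ℝ, F) 𝓘(ℝ, E) ϕ y (pullbackConnection nabla ψ hψ Y y v) =
      nabla (mpullback 𝓘(ℝ, E) 𝓘(ℝ, F) (ψ y) Y) (ϕ y) (mfderiv 𝓘(ℝ, F) 𝓘(ℝ, E) ϕ y v) :=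
  (hψ y).isInvertible_mfderiv.self_apply_inverse _

variable [FiniteDimensional ℝ F]

theorem IsAlmostParaquaternionicHermitian.induced (h : IsAlmostParaquaternionicHermitian σ g)
    (hψ : ∀ y, ∃ ψ, IsLocalInverseAt (F := F) (E := E) ϕ ψ y) :
    IsAlmostParaquaternionicHermitian (inducedStructure (F := F) ϕ σ)
      (inducedMetric (F := F) ϕ g) where
  metric := h.metric.inducedMetric hψ
  almost :=
    { rank y := by
        obtain ⟨ψ, hy⟩ := hψ y
        obtain ⟨e, he⟩ := hy.isInvertible_mfderiv
        rw [inducedStructure_eq_map e fun v ↦ by rw [← he]; rfl]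
        exact (LinearEquiv.finrank_map_eq _ _).trans (h.almost.rank (ϕ y))
      exists_basis y := by
        obtain ⟨ψ, hy⟩ := hψ y
        obtain ⟨U, hU, hyU, J, hJ⟩ := h.almost.exists_basis (ϕ y)
        refine ⟨ϕ ⁻¹' U, hU.preimage ?_, hyU, _, hJ.pullbackEnd hU hψ⟩
        exact continuous_iff_continuousAt.2 fun z ↦ (hψ z).choose_spec.contMDiffAt.continuousAt }
  hermitian U J hU hJ y hy a v w := by
    obtain ⟨K, hK, hJK⟩ := mem_inducedStructure.1 (hJ.mem hy a)
    rw [inducedMetric_apply, inducedMetric_apply, hJK, hJK]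
    exact h.skew hK _ _

theorem IsLeviCivita.pullbackConnection {nabla : LinearConnection E M} (h : IsLeviCivita g nabla)
    (hg : IsSemiRiemannianMetric g) {ψ : N → M → N}
    (hψ : ∀ y, IsLocalInverseAt (F := F) (E := E) ϕ (ψ y) y) :
    IsLeviCivita (inducedMetric (F := F) ϕ g) (pullbackConnection nabla ψ hψ) where
  torsionFree := by
    refine (CovariantDerivative.torsion_eq_zero_iff _).2 fun {X Y y} hX hY ↦ ?_
    have hy := hψ y
    have hX' := hy.mdifferentiableAt_mpullback_inv hX
    have hY' := hy.mdifferentiableAt_mpullback_inv hY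
    have h1 := (CovariantDerivative.torsion_eq_zero_iff _).1 h.torsionFree hX' hY'
    have : IsManifold 𝓘(ℝ, F) (minSmoothness ℝ 2) N :=
      .of_le (n := ∞) (by simpa using ENat.LEInfty.out)
    have : IsManifold 𝓘(ℝ, E) (minSmoothness ℝ 2) M :=
      .of_le (n := ∞) (by simpa using ENat.LEInfty.out)
    have h2 := mpullback_mlieBracket (n := ∞) (f := ψ y) (x₀ := ϕ y) (V := X) (W := Y)
      (by rw [hy.inv_apply]; exact hX) (by rw [hy.inv_apply]; exact hY) hy.contMDiffAt_inv
      (by simpa using ENat.LEInfty.out)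
    rw [← h2, hy.mpullback_inv_apply, hy.mpullback_inv_apply, hy.mpullback_inv_apply] at h1
    refine hy.isInvertible_mfderiv.injective ?_
    rw [← h1, map_sub, mfderiv_pullbackConnection, mfderiv_pullbackConnection]
  metric y Y Z hY hZ v := by
    have hy := hψ y
    have hY' := hy.mdifferentiableAt_mpullback_inv hY
    have hZ' := hy.mdifferentiableAt_mpullback_inv hZ
    have h1 := h.metric _ _ _ hY' hZ' (mfderiv 𝓘(ℝ, F) 𝓘(ℝ, E) ϕ y v)
    rw [← mvfderiv_comp_apply y (hg.mdifferentiableAt_apply hY' hZ')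
      (hy.contMDiffAt.mdifferentiableAt (by simp))] at h1
    rw [inducedMetric_apply, inducedMetric_apply, mfderiv_pullbackConnection,
      mfderiv_pullbackConnection, ← hy.mpullback_inv_apply, ← hy.mpullback_inv_apply, ← h1]
    have h2 : (fun z ↦ inducedMetric (F := F) ϕ g z (Y z) (Z z)) =ᶠ[𝓝 y]
        (fun m ↦ g m (mpullback 𝓘(ℝ, E) 𝓘(ℝ, F) (ψ y) Y m)
          (mpullback 𝓘(ℝ, E) 𝓘(ℝ, F) (ψ y) Z m)) ∘ ϕ := by
      filter_upwards [hy.eventually] with z hz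
      rw [inducedMetric_apply, Function.comp_apply, hz.mpullback_inv_apply,
        hz.mpullback_inv_apply]
    exact congrArg (fun A : F →L[ℝ] ℝ ↦ A v) h2.mfderiv_eq

theorem PreservesSubbundle.pullbackConnection {nabla : LinearConnection E M}
    (h : PreservesSubbundle nabla σ) {ψ : N → M → N}
    (hψ : ∀ y, IsLocalInverseAt (F := F) (E := E) ϕ (ψ y) y) :
    PreservesSubbundle (pullbackConnection nabla ψ hψ) (inducedStructure (F := F) ϕ σ) := by
  intro U S hU hS hSσ y hyU v
  have hy := hψ y
  -- an open neighbourhood of `ϕ y` to which `S` is carried over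
  obtain ⟨U', hU'sub, hU', hyU'⟩ : ∃ U' : Set M, (∀ m ∈ U', ψ y m ∈ U ∧ ϕ (ψ y m) = m ∧
      IsLocalInverseAt (F := F) (E := E) ϕ (ψ y) (ψ y m)) ∧ IsOpen U' ∧ ϕ y ∈ U' := by
    have hc : Filter.Tendsto (ψ y) (𝓝 (ϕ y)) (𝓝 y) := by
      have := hy.contMDiffAt_inv.continuousAt
      rwa [ContinuousAt, hy.inv_apply] at this
    have := (hc.eventually (hU.mem_nhds hyU)).and (hy.right.and (hc.eventually hy.eventually))
    obtain ⟨U', h1, h2⟩ := eventually_nhds_iff.1 this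
    exact ⟨U', h1, h2⟩
  have hS' : SmoothEndOn (pullbackEnd (ψ y) S) U' := fun m hm ↦ by
    obtain ⟨h1, h2, h3⟩ := hU'sub m hm
    rw [← h2]
    exact (h3.symm.contMDiffAt_pullbackEnd hS hU (by rwa [h3.inv_apply])).contMDiffWithinAt
  have hSσ' : ∀ m ∈ U', pullbackEnd (ψ y) S m ∈ σ m := fun m hm ↦ by
    obtain ⟨h1, h2, h3⟩ := hU'sub m hm
    obtain ⟨z, hz⟩ : ∃ z, z = ψ y m := ⟨_, rfl⟩
    rw [← hz] at h1 h2 h3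
    subst h2
    obtain ⟨K, hK, hKS⟩ := mem_inducedStructure.1 (hSσ z h1)
    convert hK using 1
    ext w
    obtain ⟨u, rfl⟩ : ∃ u, mfderiv 𝓘(ℝ, F) 𝓘(ℝ, E) ϕ z u = w :=
      ⟨_, h3.isInvertible_mfderiv.self_apply_inverse w⟩
    rw [← hKS]
    exact h3.pullbackEnd_inv_mfderiv S u
  obtain ⟨T, hT, hTY⟩ := h U' _ hU' hS' hSσ' _ hyU' (mfderiv 𝓘(ℝ, F) 𝓘(ℝ, E) ϕ y v)
  refine ⟨(mfderiv 𝓘(ℝ, F) 𝓘(ℝ, E) ϕ y).inverse.comp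
    (T.comp (mfderiv 𝓘(ℝ, F) 𝓘(ℝ, E) ϕ y)), mem_inducedStructure.2 ⟨T, hT, fun w ↦ ?_⟩,
    fun Y hY ↦ ?_⟩
  · exact hy.isInvertible_mfderiv.self_apply_inverse _
  · have hY' := hy.mdifferentiableAt_mpullback_inv hY
    have h1 := hTY _ hY'
    have h2 : nabla (mpullback 𝓘(ℝ, E) 𝓘(ℝ, F) (ψ y) (fun z ↦ S z (Y z))) (ϕ y) = _ :=
      nabla.isCovariantDerivativeOnUniv.congr_of_eventuallyEq
      (hy.mdifferentiableAt_mpullback_inv (hS.mdifferentiableAt_apply hU hyU hY))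
      (hS'.mdifferentiableAt_apply hU' hyU' hY') Filter.univ_mem
      (hy.mpullback_inv_pullbackEnd S Y)
    have h3 : S y ((ParaQ.pullbackConnection nabla ψ hψ) Y y v) =
        (mfderiv 𝓘(ℝ, F) 𝓘(ℝ, E) ϕ y).inverse (pullbackEnd (ψ y) S (ϕ y)
          (nabla (mpullback 𝓘(ℝ, E) 𝓘(ℝ, F) (ψ y) Y) (ϕ y)
            (mfderiv 𝓘(ℝ, F) 𝓘(ℝ, E) ϕ y v))) := by
      rw [← mfderiv_pullbackConnection nabla hψ, hy.pullbackEnd_inv_mfderiv, hy.mpullback_mfderiv]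
    rw [h3]
    change (mfderiv 𝓘(ℝ, F) 𝓘(ℝ, E) ϕ y).inverse (nabla _ _ _) - _ =
      (mfderiv 𝓘(ℝ, F) 𝓘(ℝ, E) ϕ y).inverse (T _)
    rw [hy.mpullback_inv_apply] at h1
    rw [← map_sub, h2]
    exact congrArg (mfderiv 𝓘(ℝ, F) 𝓘(ℝ, E) ϕ y).inverse h1

/-- Paraquaternionic Kähler structures can be pulled back by local diffeomorphisms. -/
theorem IsParaquaternionicKahler.induced (h : IsParaquaternionicKahler σ g)
    (hϕ : ContMDiff 𝓘(ℝ, F) 𝓘(ℝ, E) ∞ ϕ)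
    (hd : ∀ y, Function.Bijective (mfderiv 𝓘(ℝ, F) 𝓘(ℝ, E) ϕ y)) :
    IsParaquaternionicKahler (inducedStructure (F := F) ϕ σ) (inducedMetric (F := F) ϕ g) := by
  choose ψ hψ using exists_isLocalInverseAt hϕ hd
  obtain ⟨nabla, h1, h2⟩ := h.kahler
  exact ⟨h.hermitian.induced fun y ↦ ⟨_, hψ y⟩, pullbackConnection nabla ψ hψ,
    h1.pullbackConnection h.hermitian.metric hψ, h2.pullbackConnection hψ⟩

end PullbackKahler

/-! ### Adapted charts and the horizontal distribution -/

section LinearAlgebra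

theorem projection_eq_of_mem {V : Type*} [AddCommGroup V] [Module ℝ V] {p q : Submodule ℝ V}
    (h : IsCompl p q) {v w : V} (hw : w ∈ p) (hvw : v - w ∈ q) :
    Submodule.projection p q h v = w := by
  rw [← sub_add_cancel v w, map_add, Submodule.projection_apply_of_mem_left h hw,
    (Submodule.projection_apply_eq_zero_iff h).2 hvw, zero_add]

end LinearAlgebra

theorem mdifferentiableAt_vectorField_iff_differentiableAt
    {V : Type*} [NormedAddCommGroup V] [NormedSpace ℝ V] {X : Π p : V, TangentSpace 𝓘(ℝ, V) p}
    {p : V} : (MDiffAt (T% X) p) ↔ DifferentiableAt ℝ (fun q ↦ (X q : V)) p := by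
  rw [mdifferentiableAt_section]
  have h : ∀ q, (trivializationAt V (TangentSpace 𝓘(ℝ, V)) p ⟨q, X q⟩).2 = X q := fun q ↦ by
    simp
    rfl
  simp only [h]
  exact mdifferentiableAt_iff_differentiableAt

section AdaptedCharts

universe u

variable {E : Type*} [NormedAddCommGroup E] [NormedSpace ℝ E]
  {M : Type*} [TopologicalSpace M] [ChartedSpace E M]
  {E' : Type*} [NormedAddCommGroup E'] [NormedSpace ℝ E']
  {M' : Type*} [TopologicalSpace M'] [ChartedSpace E' M']
  {F : Type*} [NormedAddCommGroup F] [NormedSpace ℝ F]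

/-- Charts `Φ` of `M` and `κ` of `M'` in which `π` is the projection `E' × F → E'`. -/
structure IsAdaptedChart (π : M → M') (Φ : OpenPartialHomeomorph M (E' × F))
    (κ : OpenPartialHomeomorph M' E') : Prop where
  isLocalInverseAt : ∀ x ∈ Φ.source, IsLocalInverseAt (F := E) (E := E' × F) Φ Φ.symm x
  isLocalInverseAt_cod : ∀ m ∈ κ.source, IsLocalInverseAt (F := E') (E := E') κ κ.symm m
  mapsTo : ∀ x ∈ Φ.source, π x ∈ κ.source
  fst : ∀ x ∈ Φ.source, (Φ x).1 = κ (π x)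

theorem isLocalInverseAt_of_mem_maximalAtlas [IsManifold 𝓘(ℝ, E) ∞ M]
    {c : OpenPartialHomeomorph M E} (hc : c ∈ IsManifold.maximalAtlas 𝓘(ℝ, E) ∞ M) {x : M}
    (hx : x ∈ c.source) : IsLocalInverseAt (F := E) (E := E) c c.symm x where
  smooth := by
    filter_upwards [c.open_source.mem_nhds hx] with z hz using contMDiffAt_of_mem_maximalAtlas hc hz
  smooth_inv := by
    filter_upwards [c.open_target.mem_nhds (c.map_source hx)] with z hz
      using contMDiffAt_symm_of_mem_maximalAtlas hc hz
  left := by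
    filter_upwards [c.open_source.mem_nhds hx] with z hz using c.left_inv hz
  right := by
    filter_upwards [c.open_target.mem_nhds (c.map_source hx)] with z hz using c.right_inv hz

/-- Adapted charts exist around each point: they are the charts of the normal form of a submersion,
after a linear change of coordinates. -/
theorem exists_isAdaptedChart {E : Type u} [NormedAddCommGroup E] [NormedSpace ℝ E]
    {M : Type*} [TopologicalSpace M] [ChartedSpace E M] [FiniteDimensional ℝ E]
    [IsManifold 𝓘(ℝ, E) ∞ M] [IsManifold 𝓘(ℝ, E') ∞ M']
    {π : M → M'} (hπ : Manifold.IsSubmersion 𝓘(ℝ, E) 𝓘(ℝ, E') ∞ π) (x : M) :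
    ∃ (F : Type u) (_ : NormedAddCommGroup F) (_ : NormedSpace ℝ F) (_ : FiniteDimensional ℝ F)
      (Φ : OpenPartialHomeomorph M (E' × F)) (κ : OpenPartialHomeomorph M' E'),
      x ∈ Φ.source ∧ IsAdaptedChart (E := E) π Φ κ := by
  obtain ⟨F, _, _, h⟩ := hπ
  have h : Manifold.IsSubmersionAtOfComplement F 𝓘(ℝ, E) 𝓘(ℝ, E') ∞ π x := h x
  let e : E ≃L[ℝ] E' × F := h.equiv
  have : FiniteDimensional ℝ F :=
    Module.Finite.of_surjective (LinearMap.snd ℝ E' F ∘ₗ e.toLinearMap)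
      (Prod.snd_surjective.comp e.surjective)
  let Φ := h.domChart.transHomeomorph e.toHomeomorph
  refine ⟨F, _, _, this, Φ, h.codChart, h.mem_domChart_source, ?_,
    fun m hm ↦ isLocalInverseAt_of_mem_maximalAtlas h.codChart_mem_maximalAtlas hm,
    fun y hy ↦ h.source_subset_preimage_source hy, fun y hy ↦ ?_⟩
  · intro y hy
    have hy' := isLocalInverseAt_of_mem_maximalAtlas h.domChart_mem_maximalAtlas hy
    refine ⟨?_, ?_, ?_, ?_⟩
    · filter_upwards [hy'.smooth] with z hz
      exact e.contDiff.contMDiff.contMDiffAt.comp z hz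
    · have h1 : ContinuousAt e.symm (Φ y) := e.symm.continuous.continuousAt
      have h2 : e.symm (Φ y) = h.domChart y := e.symm_apply_apply _
      have h3 := hy'.smooth_inv
      rw [← h2] at h3
      filter_upwards [h1.eventually h3] with z hz
      exact hz.comp z e.symm.contDiff.contMDiff.contMDiffAt
    · filter_upwards [Φ.open_source.mem_nhds hy] with z hz using Φ.left_inv hz
    · filter_upwards [Φ.open_target.mem_nhds (Φ.map_source hy)] with z hz using Φ.right_inv hz
  · have h1 := h.writtenInCharts ((h.domChart.extend 𝓘(ℝ, E)).map_source (x := y)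
      (by rw [h.domChart.extend_source]; exact hy))
    have h2 : h.codChart (π (h.domChart.symm (h.domChart y))) = (e (h.domChart y)).1 := h1
    rw [h.domChart.left_inv hy] at h2
    exact h2.symm

namespace IsAdaptedChart

open VectorField

variable {π : M → M'} {Φ : OpenPartialHomeomorph M (E' × F)} {κ : OpenPartialHomeomorph M' E'}
  {x : M}

theorem contMDiffAt (h : IsAdaptedChart (E := E) π Φ κ) (hx : x ∈ Φ.source) :
    ContMDiffAt 𝓘(ℝ, E) 𝓘(ℝ, E') ∞ π x := by
  have h1 := (h.isLocalInverseAt x hx).contMDiffAt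
  have h2 : ContMDiffAt 𝓘(ℝ, E) 𝓘(ℝ, E') ∞ (fun y ↦ (Φ y).1) x :=
    contDiff_fst.contMDiff.contMDiffAt.comp x h1
  have h3 := (h.isLocalInverseAt_cod _ (h.mapsTo x hx)).contMDiffAt_inv
  rw [← h.fst x hx] at h3
  refine (h3.comp x h2).congr_of_eventuallyEq ?_
  filter_upwards [Φ.open_source.mem_nhds hx] with y hy
  rw [Function.comp_apply, h.fst y hy, κ.left_inv (h.mapsTo y hy)]

theorem mfderiv_fst (h : IsAdaptedChart (E := E) π Φ κ) (hx : x ∈ Φ.source)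
    (w : TangentSpace 𝓘(ℝ, E) x) :
    mfderiv 𝓘(ℝ, E') 𝓘(ℝ, E') κ (π x) (mfderiv 𝓘(ℝ, E) 𝓘(ℝ, E') π x w) =
      (mfderiv 𝓘(ℝ, E) 𝓘(ℝ, E' × F) Φ x w : E' × F).1 := by
  have h1 := (h.isLocalInverseAt x hx).contMDiffAt.mdifferentiableAt (by simp)
  have h2 := (h.isLocalInverseAt_cod _ (h.mapsTo x hx)).contMDiffAt.mdifferentiableAt (by simp)
  have h3 := mfderiv_comp_apply x h2 ((h.contMDiffAt hx).mdifferentiableAt (by simp)) w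
  rw [← h3]
  have h4 : κ ∘ π =ᶠ[𝓝 x] Prod.fst ∘ Φ := by
    filter_upwards [Φ.open_source.mem_nhds hx] with y hy using (h.fst y hy).symm
  have h5 : MDifferentiableAt 𝓘(ℝ, E' × F) 𝓘(ℝ, E') (Prod.fst : E' × F → E') (Φ x) :=
    differentiableAt_fst.mdifferentiableAt
  have h6 := mfderiv_comp_apply x h5 h1 w
  have h7 : mfderiv 𝓘(ℝ, E' × F) 𝓘(ℝ, E') (Prod.fst : E' × F → E') (Φ x) =
      ContinuousLinearMap.fst ℝ E' F := by
    rw [mfderiv_eq_fderiv, fderiv_fst]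
  have h8 := congrArg (fun A : E →L[ℝ] E' ↦ A w) (h4.mfderiv_eq (I := 𝓘(ℝ, E)) (I' := 𝓘(ℝ, E')))
  exact h8.trans (h6.trans (congrArg (fun A : E' × F →L[ℝ] E' ↦ A _) h7))

theorem mem_vertical (h : IsAdaptedChart (E := E) π Φ κ) (hx : x ∈ Φ.source)
    {w : TangentSpace 𝓘(ℝ, E) x} :
    w ∈ vertical (E := E) (E' := E') π x ↔ (mfderiv 𝓘(ℝ, E) 𝓘(ℝ, E' × F) Φ x w : E' × F).1 = 0 := by
  have hκ := (h.isLocalInverseAt_cod _ (h.mapsTo x hx)).isInvertible_mfderiv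
  have h1 := h.mfderiv_fst hx w
  rw [← h1]
  exact (map_eq_zero_iff _ hκ.injective).symm

theorem exists_mfderiv_eq (h : IsAdaptedChart (E := E) π Φ κ) (hx : x ∈ Φ.source) (c : E' × F) :
    ∃ w, mfderiv 𝓘(ℝ, E) 𝓘(ℝ, E' × F) Φ x w = c :=
  ⟨_, (h.isLocalInverseAt x hx).isInvertible_mfderiv.self_apply_inverse c⟩

theorem mfderiv_surjective (h : IsAdaptedChart (E := E) π Φ κ) (hx : x ∈ Φ.source) :
    Function.Surjective (mfderiv 𝓘(ℝ, E) 𝓘(ℝ, E') π x) := fun u ↦ by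
  have hκ := (h.isLocalInverseAt_cod _ (h.mapsTo x hx)).isInvertible_mfderiv
  obtain ⟨w, hw⟩ := h.exists_mfderiv_eq hx (mfderiv 𝓘(ℝ, E') 𝓘(ℝ, E') κ (π x) u, 0)
  refine ⟨w, hκ.injective ?_⟩
  rw [h.mfderiv_fst hx, hw]

end IsAdaptedChart

end AdaptedCharts

section HorizontalGraph

variable {E : Type*} [NormedAddCommGroup E] [NormedSpace ℝ E]
  {M : Type*} [TopologicalSpace M] [ChartedSpace E M]
  {E' : Type*} [NormedAddCommGroup E'] [NormedSpace ℝ E']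
  {M' : Type*} [TopologicalSpace M'] [ChartedSpace E' M']
  {F : Type*} [NormedAddCommGroup F] [NormedSpace ℝ F]
  [FiniteDimensional ℝ E] [IsManifold 𝓘(ℝ, E) ∞ M]
  [FiniteDimensional ℝ E'] [FiniteDimensional ℝ F]
  {π : M → M'} {Φ : OpenPartialHomeomorph M (E' × F)} {κ : OpenPartialHomeomorph M' E'}
  {x : M} {g : BilinField E M} {g' : BilinField E' M'}

open VectorField

/-- In an adapted chart, the horizontal distribution consists of the graphs of linear maps
`L p : E' → F` depending smoothly on the point `p`. -/
structure IsHorizontalGraph (g : BilinField E M) (π : M → M')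
    (Φ : OpenPartialHomeomorph M (E' × F)) (L : E' × F → E' →L[ℝ] F) : Prop where
  smooth : ContDiffOn ℝ ∞ L Φ.target
  mem_horizontal : ∀ x ∈ Φ.source, ∀ w : TangentSpace 𝓘(ℝ, E) x,
    w ∈ horizontal (E' := E') g π x ↔ (mfderiv 𝓘(ℝ, E) 𝓘(ℝ, E' × F) Φ x w : E' × F).2 =
      L (Φ x) (mfderiv 𝓘(ℝ, E) 𝓘(ℝ, E' × F) Φ x w : E' × F).1

/-- The metric, read in a chart `Φ`. -/
def chartMetric (g : BilinField E M) (Φ : OpenPartialHomeomorph M (E' × F)) (p : E' × F) :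
    E' × F →L[ℝ] E' × F →L[ℝ] ℝ :=
  let A : E' × F →L[ℝ] E := (mfderiv 𝓘(ℝ, E) 𝓘(ℝ, E' × F) Φ (Φ.symm p)).inverse
  let b : E →L[ℝ] E →L[ℝ] ℝ := g (Φ.symm p)
  (ContinuousLinearMap.precomp ℝ A).comp (b.comp A)

theorem IsAdaptedChart.contDiffOn_chartMetric (h : IsAdaptedChart (E := E) π Φ κ)
    (hg : IsSemiRiemannianMetric g) : ContDiffOn ℝ ∞ (chartMetric (E := E) g Φ) Φ.target := by
  refine contDiffOn_clm_apply.2 fun a ↦ contDiffOn_clm_apply.2 fun b ↦ ?_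
  intro p hp
  have hx := h.isLocalInverseAt _ (Φ.map_target hp)
  have hc (c : E' × F) : ContMDiffAt 𝓘(ℝ, E) 𝓘(ℝ, E).tangent ∞
      (T% (mpullback 𝓘(ℝ, E) 𝓘(ℝ, E' × F) Φ (fun _ ↦ c))) (Φ.symm p) :=
    hx.contMDiffAt_mpullback (contMDiffAt_vectorSpace_iff_contDiffAt.2 contDiffAt_const)
  have h1 := hg.contMDiffAt_apply (hc a) (hc b)
  have h2 := hx.contMDiffAt_inv
  rw [Φ.right_inv hp] at h2
  exact (h1.comp p h2).contDiffAt.contDiffWithinAt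

/-- Since the metric is nondegenerate on the vertical spaces, the horizontal spaces are complements
of the vertical ones, so they are graphs over the first factor. -/
theorem IsAdaptedChart.exists_isHorizontalGraph (h : IsAdaptedChart (E := E) π Φ κ)
    (hg : IsSemiRiemannianMetric g) (hπ : IsSemiRiemannianSubmersion g g' π) :
    ∃ L : E' × F → E' →L[ℝ] F, IsHorizontalGraph (E := E) g π Φ L := by
  -- the condition `G(u, b) + G(f, b) = 0` for all `b` is solved for `f`
  let i : E' →L[ℝ] E' × F := ContinuousLinearMap.inl ℝ E' F
  let j : F →L[ℝ] E' × F := ContinuousLinearMap.inr ℝ E' F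
  let A : (E' × F →L[ℝ] E' × F →L[ℝ] ℝ) → F →L[ℝ] F →L[ℝ] ℝ := fun G ↦
    (ContinuousLinearMap.precomp ℝ j).comp (G.comp j)
  let B : (E' × F →L[ℝ] E' × F →L[ℝ] ℝ) → E' →L[ℝ] F →L[ℝ] ℝ := fun G ↦
    (ContinuousLinearMap.precomp ℝ j).comp (G.comp i)
  have hA : ContDiff ℝ ∞ A := contDiff_const.clm_comp (contDiff_id.clm_comp contDiff_const)
  have hB : ContDiff ℝ ∞ B := contDiff_const.clm_comp (contDiff_id.clm_comp contDiff_const)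
  let G := chartMetric (E := E) g Φ
  have hG : ContDiffOn ℝ ∞ G Φ.target := h.contDiffOn_chartMetric hg
  have key : ∀ x ∈ Φ.source, ∀ w w' : TangentSpace 𝓘(ℝ, E) x,
      G (Φ x) (mfderiv 𝓘(ℝ, E) 𝓘(ℝ, E' × F) Φ x w) (mfderiv 𝓘(ℝ, E) 𝓘(ℝ, E' × F) Φ x w') =
        g x w w' := by
    intro x hx w w'
    obtain ⟨p, hp⟩ : ∃ p, p = Φ x := ⟨_, rfl⟩
    obtain rfl : Φ.symm p = x := by rw [hp, Φ.left_inv hx]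
    rw [← hp]
    have hi := (h.isLocalInverseAt _ hx).mpullback_mfderiv
    exact congrArg₂ (fun a b : E ↦ g (Φ.symm p) a b) (hi w) (hi w')
  have hinv : ∀ p ∈ Φ.target, (A (G p)).IsInvertible := by
    intro p hp
    obtain ⟨x, hx, rfl⟩ : ∃ x ∈ Φ.source, Φ x = p := ⟨_, Φ.map_target hp, Φ.right_inv hp⟩
    have hinj : Function.Injective (A (G (Φ x))) := by
      refine (injective_iff_map_eq_zero _).2 fun f hf ↦ ?_
      obtain ⟨v, hv⟩ := h.exists_mfderiv_eq hx (0, f)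
      have hv0 : v = 0 := by
        refine hπ.vertical_nondegenerate x v ((h.mem_vertical hx).2 (by rw [hv])) fun w hw ↦ ?_
        rw [h.mem_vertical hx] at hw
        rw [← key x hx, hv]
        have h1 := DFunLike.congr_fun hf (mfderiv 𝓘(ℝ, E) 𝓘(ℝ, E' × F) Φ x w : E' × F).2
        have h2 : (mfderiv 𝓘(ℝ, E) 𝓘(ℝ, E' × F) Φ x w : E' × F) =
          (0, (mfderiv 𝓘(ℝ, E) 𝓘(ℝ, E' × F) Φ x w : E' × F).2) := Prod.ext hw rfl
        exact (congrArg (G (Φ x) (0, f)) h2).trans h1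
      rw [hv0, map_zero] at hv
      exact (congrArg Prod.snd hv).symm
    have hfr : Module.finrank ℝ F = Module.finrank ℝ (F →L[ℝ] ℝ) := by
      rw [← LinearMap.toContinuousLinearMap.finrank_eq]
      exact Subspace.dual_finrank_eq.symm
    refine ⟨(LinearEquiv.ofInjectiveOfFinrankEq (A (G (Φ x))).toLinearMap hinj
      hfr).toContinuousLinearEquiv, ?_⟩
    ext f b
    rfl
  refine ⟨fun p ↦ -(A (G p)).inverse.comp (B (G p)), ?_, fun x hx w ↦ ?_⟩
  · intro p hp
    have hGp := hG.contDiffAt (Φ.open_target.mem_nhds hp)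
    have h0 : ContDiffAt ℝ ∞ ContinuousLinearMap.inverse (A (G p)) :=
      (hinv p hp).contDiffAt_map_inverse
    have hAG : ContDiffAt ℝ ∞ (fun p ↦ A (G p)) p := hA.contDiffAt.comp p hGp
    have h1 : ContDiffAt ℝ ∞ (fun p ↦ (A (G p)).inverse) p :=
      ContDiffAt.comp (g := ContinuousLinearMap.inverse) p h0 hAG
    exact (h1.clm_comp (hB.contDiffAt.comp p hGp)).neg.contDiffWithinAt
  · have hAx := hinv _ (Φ.map_source hx)
    obtain ⟨a, ha⟩ : ∃ a, a = (mfderiv 𝓘(ℝ, E) 𝓘(ℝ, E' × F) Φ x w : E' × F) := ⟨_, rfl⟩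
    rw [← ha]
    have h1 : a.2 = -(A (G (Φ x))).inverse (B (G (Φ x)) a.1) ↔
        A (G (Φ x)) a.2 + B (G (Φ x)) a.1 = 0 := by
      rw [eq_neg_iff_add_eq_zero, ← hAx.injective.eq_iff, map_add, hAx.self_apply_inverse, map_zero]
    refine Iff.trans ?_ h1.symm
    have h2 : ∀ b, (A (G (Φ x)) a.2 + B (G (Φ x)) a.1) b = G (Φ x) a (0, b) := by
      intro b
      change G (Φ x) (0, a.2) (0, b) + G (Φ x) (a.1, 0) (0, b) = _
      rw [← add_apply, ← map_add]
      refine congrArg (fun c : E' × F ↦ G (Φ x) c (0, b)) (Prod.ext ?_ ?_)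
      · exact zero_add _
      · exact add_zero _
    have h3 : ∀ b v, mfderiv 𝓘(ℝ, E) 𝓘(ℝ, E' × F) Φ x v = (0, b) → G (Φ x) a (0, b) = g x v w := by
      intro b v hv
      rw [hg.symm, ← key x hx w v, ← ha, hv]
    constructor
    · intro hw
      ext b
      obtain ⟨v, hv⟩ := h.exists_mfderiv_eq hx (0, b)
      rw [h2, h3 b v hv]
      exact hw v ((h.mem_vertical hx).2 (by rw [hv]))
    · intro h0 v hv
      rw [h.mem_vertical hx] at hv
      rw [← h3 _ v (Prod.ext hv rfl), ← h2, h0]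
      rfl

end HorizontalGraph

/-! ### Connections and horizontal and vertical fields -/

section LeviCivitaUniqueness

variable {E : Type*} [NormedAddCommGroup E] [NormedSpace ℝ E] [FiniteDimensional ℝ E]
  {M : Type*} [TopologicalSpace M] [ChartedSpace E M] [IsManifold 𝓘(ℝ, E) ∞ M]
  {g : BilinField E M} {σ : EndSubspaceField E M} {nabla nabla' : LinearConnection E M}

/-- Uniqueness of the Levi-Civita connection: the difference of two of them is a tensor
`g (D y v) z`, symmetric in `v`, `y` and skew in `y`, `z`. -/
theorem IsLeviCivita.eq (h : IsLeviCivita g nabla) (h' : IsLeviCivita g nabla')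
    (hg : IsSemiRiemannianMetric g) {x : M} {Y : Π x : M, TangentSpace 𝓘(ℝ, E) x}
    (hY : MDiffAt (T% Y) x) : nabla Y x = nabla' Y x := by
  let D : TangentSpace 𝓘(ℝ, E) x → TangentSpace 𝓘(ℝ, E) x → TangentSpace 𝓘(ℝ, E) x :=
    fun y v ↦ nabla.difference nabla' x y v
  let e (y : TangentSpace 𝓘(ℝ, E) x) : Π x : M, TangentSpace 𝓘(ℝ, E) x := FiberBundle.extend E y
  have he (y) : MDiffAt (T% (e y)) x := FiberBundle.mdifferentiableAt_extend 𝓘(ℝ, E) E y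
  have hex (y) : e y x = y := FiberBundle.extend_apply_self E y
  have hD {Z : Π x : M, TangentSpace 𝓘(ℝ, E) x} (hZ : MDiffAt (T% Z) x) (v) :
      D (Z x) v = nabla Z x v - nabla' Z x v :=
    congrArg (fun A : TangentSpace 𝓘(ℝ, E) x →L[ℝ] TangentSpace 𝓘(ℝ, E) x ↦ A v)
      (IsCovariantDerivativeOn.difference_apply nabla.isCovariantDerivativeOnUniv
        nabla'.isCovariantDerivativeOnUniv (mem_univ x) hZ)
  have hDe (y v) : D y v = nabla (e y) x v - nabla' (e y) x v := by
    have := hD (he y) v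
    rwa [hex] at this
  have symm (y v) : D y v = D v y := by
    have h1 := (CovariantDerivative.torsion_eq_zero_iff _).1 h.torsionFree (he v) (he y)
    have h2 := (CovariantDerivative.torsion_eq_zero_iff _).1 h'.torsionFree (he v) (he y)
    rw [hex, hex, ← h2, hex, hex] at h1
    rw [hDe, hDe, sub_eq_sub_iff_sub_eq_sub]
    exact h1
  have skew (y z v) : g x (D y v) z + g x y (D z v) = 0 := by
    have h1 := h.metric x _ _ (he y) (he z) v
    have h2 := h'.metric x _ _ (he y) (he z) v
    rw [h2, hex, hex] at h1
    rw [hDe, hDe]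
    simp only [map_sub, sub_apply]
    linear_combination -h1
  have zero (y v) : D y v = 0 := by
    refine hg.nondegenerate x _ fun z ↦ ?_
    have s1 := skew y z v
    have s2 := skew v z y
    have s3 := skew y v z
    rw [symm v y] at s2
    rw [hg.symm x y] at s1
    rw [hg.symm x v] at s2
    rw [hg.symm x y (D v z), symm v z, symm y z] at s3
    linear_combination (1/2) * s1 + (1/2) * s2 - (1/2) * s3
  ext v
  have := hD hY v
  rw [zero] at this
  exact (sub_eq_zero.1 this.symm)

/-- In a paraquaternionic Kähler manifold every Levi-Civita connection preserves `σ`, not just the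
one provided by the definition. -/
theorem PreservesSubbundle.of_isLeviCivita (hp : PreservesSubbundle nabla σ)
    (h : IsLeviCivita g nabla) (h' : IsLeviCivita g nabla') (hg : IsSemiRiemannianMetric g) :
    PreservesSubbundle nabla' σ := by
  intro U S hU hS hSσ x hx v
  obtain ⟨T, hT, hTY⟩ := hp U S hU hS hSσ x hx v
  refine ⟨T, hT, fun Y hY ↦ ?_⟩
  rw [← hTY Y hY, h.eq h' hg hY, h.eq h' hg (hS.mdifferentiableAt_apply hU hx hY)]

end LeviCivitaUniqueness

section Sections

variable {E : Type*} [NormedAddCommGroup E] [NormedSpace ℝ E]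
  {M : Type*} [TopologicalSpace M] [ChartedSpace E M] [IsManifold 𝓘(ℝ, E) ∞ M]

/-- `Y` is a vector field, differentiable at `x`, which takes values in `D` near `x`. -/
structure IsSectionAt (D : SubspaceField E M) (Y : Π x : M, TangentSpace 𝓘(ℝ, E) x) (x : M) :
    Prop where
  mdifferentiableAt : MDiffAt (T% Y) x
  eventually_mem : ∀ᶠ y in 𝓝 x, Y y ∈ D y

theorem IsSectionAt.mem {D : SubspaceField E M} {Y : Π x : M, TangentSpace 𝓘(ℝ, E) x}
    {x : M} (h : IsSectionAt D Y x) : Y x ∈ D x :=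
  h.eventually_mem.self_of_nhds

end Sections

section AdaptedFields

variable {E : Type*} [NormedAddCommGroup E] [NormedSpace ℝ E]
  {M : Type*} [TopologicalSpace M] [ChartedSpace E M]
  {E' : Type*} [NormedAddCommGroup E'] [NormedSpace ℝ E']
  {M' : Type*} [TopologicalSpace M'] [ChartedSpace E' M']
  {F : Type*} [NormedAddCommGroup F] [NormedSpace ℝ F]
  {π : M → M'} {Φ : OpenPartialHomeomorph M (E' × F)} {κ : OpenPartialHomeomorph M' E'}
  {x : M} {g : BilinField E M} {g' : BilinField E' M'} {L : E' × F → E' →L[ℝ] F}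

/-- The horizontal field whose first component in the chart is the constant `u`. -/
def horizontalField (Φ : OpenPartialHomeomorph M (E' × F)) (L : E' × F → E' →L[ℝ] F) (u : E') :
    Π x : M, TangentSpace 𝓘(ℝ, E) x :=
  VectorField.mpullback 𝓘(ℝ, E) 𝓘(ℝ, E' × F) Φ (fun p ↦ ((u, L p u) : E' × F))

/-- The vertical field which is the constant `(0, f)` in the chart. -/
def verticalField (Φ : OpenPartialHomeomorph M (E' × F)) (f : F) :
    Π x : M, TangentSpace 𝓘(ℝ, E) x :=
  VectorField.mpullback 𝓘(ℝ, E) 𝓘(ℝ, E' × F) Φ (fun _ ↦ ((0, f) : E' × F))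

namespace IsAdaptedChart

theorem mfderiv_horizontalField (h : IsAdaptedChart (E := E) π Φ κ) (hx : x ∈ Φ.source) (u : E') :
    mfderiv 𝓘(ℝ, E) 𝓘(ℝ, E' × F) Φ x (horizontalField Φ L u x) = (u, L (Φ x) u) :=
  (h.isLocalInverseAt x hx).mfderiv_mpullback _

theorem mfderiv_verticalField (h : IsAdaptedChart (E := E) π Φ κ) (hx : x ∈ Φ.source) (f : F) :
    mfderiv 𝓘(ℝ, E) 𝓘(ℝ, E' × F) Φ x (verticalField Φ f x) = (0, f) :=
  (h.isLocalInverseAt x hx).mfderiv_mpullback _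

theorem horizontalField_mem (h : IsAdaptedChart (E := E) π Φ κ)
    (hL : IsHorizontalGraph (E := E) g π Φ L) (hx : x ∈ Φ.source) (u : E') :
    horizontalField Φ L u x ∈ horizontal (E' := E') g π x := by
  rw [hL.mem_horizontal x hx, h.mfderiv_horizontalField (L := L) hx]

theorem verticalField_mem (h : IsAdaptedChart (E := E) π Φ κ) (hx : x ∈ Φ.source) (f : F) :
    verticalField Φ f x ∈ vertical (E := E) (E' := E') π x := by
  rw [h.mem_vertical hx, h.mfderiv_verticalField hx]

theorem eq_horizontalField (h : IsAdaptedChart (E := E) π Φ κ)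
    (hL : IsHorizontalGraph (E := E) g π Φ L) (hx : x ∈ Φ.source) {w : TangentSpace 𝓘(ℝ, E) x}
    (hw : w ∈ horizontal (E' := E') g π x) :
    horizontalField Φ L (mfderiv 𝓘(ℝ, E) 𝓘(ℝ, E' × F) Φ x w : E' × F).1 x = w := by
  refine (h.isLocalInverseAt x hx).isInvertible_mfderiv.injective ?_
  rw [h.mfderiv_horizontalField hx]
  exact Prod.ext rfl ((hL.mem_horizontal x hx w).1 hw).symm

theorem eq_verticalField (h : IsAdaptedChart (E := E) π Φ κ) (hx : x ∈ Φ.source)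
    {w : TangentSpace 𝓘(ℝ, E) x} (hw : w ∈ vertical (E' := E') π x) :
    verticalField Φ (mfderiv 𝓘(ℝ, E) 𝓘(ℝ, E' × F) Φ x w : E' × F).2 x = w := by
  refine (h.isLocalInverseAt x hx).isInvertible_mfderiv.injective ?_
  rw [h.mfderiv_verticalField hx]
  exact Prod.ext ((h.mem_vertical hx).1 hw).symm rfl

variable [IsManifold 𝓘(ℝ, E) ∞ M] [FiniteDimensional ℝ E]

theorem isSectionAt_horizontalField (h : IsAdaptedChart (E := E) π Φ κ)
    (hL : IsHorizontalGraph (E := E) g π Φ L) (hx : x ∈ Φ.source) (u : E') :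
    IsSectionAt (horizontal (E' := E') g π) (horizontalField Φ L u) x where
  mdifferentiableAt := by
    refine (h.isLocalInverseAt x hx).mdifferentiableAt_mpullback
      (mdifferentiableAt_vectorField_iff_differentiableAt.2 ?_)
    have := (hL.smooth.contDiffAt (Φ.open_target.mem_nhds (Φ.map_source hx))).differentiableAt
      (by simp)
    fun_prop
  eventually_mem := by
    filter_upwards [Φ.open_source.mem_nhds hx] with y hy using h.horizontalField_mem hL hy u

theorem isSectionAt_verticalField (h : IsAdaptedChart (E := E) π Φ κ) (hx : x ∈ Φ.source) (f : F) :
    IsSectionAt (vertical (E := E) (E' := E') π) (verticalField Φ f) x where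
  mdifferentiableAt :=
    (h.isLocalInverseAt x hx).mdifferentiableAt_mpullback
      (mdifferentiableAt_vectorField_iff_differentiableAt.2 (differentiableAt_const _))
  eventually_mem := by
    filter_upwards [Φ.open_source.mem_nhds hx] with y hy using h.verticalField_mem hy f

open VectorField

/-- The bracket of two vector fields whose first components in an adapted chart are constant is
vertical, and its second component is computed as in a vector space. -/
theorem mlieBracket_mem_vertical [FiniteDimensional ℝ E'] [FiniteDimensional ℝ F]
    (h : IsAdaptedChart (E := E) π Φ κ) (hx : x ∈ Φ.source)
    {a b : E'} {A B : E' × F → F} (hA : DifferentiableAt ℝ A (Φ x))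
    (hB : DifferentiableAt ℝ B (Φ x)) :
    mlieBracket 𝓘(ℝ, E)
      (mpullback 𝓘(ℝ, E) 𝓘(ℝ, E' × F) Φ (fun p ↦ ((a, A p) : E' × F)))
      (mpullback 𝓘(ℝ, E) 𝓘(ℝ, E' × F) Φ (fun p ↦ ((b, B p) : E' × F))) x ∈
        vertical (E' := E') π x ∧
    (mfderiv 𝓘(ℝ, E) 𝓘(ℝ, E' × F) Φ x (mlieBracket 𝓘(ℝ, E)
      (mpullback 𝓘(ℝ, E) 𝓘(ℝ, E' × F) Φ (fun p ↦ ((a, A p) : E' × F)))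
      (mpullback 𝓘(ℝ, E) 𝓘(ℝ, E' × F) Φ (fun p ↦ ((b, B p) : E' × F))) x) : E' × F).2 =
      fderiv ℝ B (Φ x) (a, A (Φ x)) - fderiv ℝ A (Φ x) (b, B (Φ x)) := by
  have : IsManifold 𝓘(ℝ, E) (minSmoothness ℝ 2) M :=
    .of_le (n := ∞) (by simpa using ENat.LEInfty.out)
  have hl := h.isLocalInverseAt x hx
  have hA' : HasFDerivAt (fun p ↦ ((a, A p) : E' × F))
    ((0 : E' × F →L[ℝ] E').prod (fderiv ℝ A (Φ x))) (Φ x) :=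
    (hasFDerivAt_const a _).prodMk hA.hasFDerivAt
  have hB' : HasFDerivAt (fun p ↦ ((b, B p) : E' × F))
    ((0 : E' × F →L[ℝ] E').prod (fderiv ℝ B (Φ x))) (Φ x) :=
    (hasFDerivAt_const b _).prodMk hB.hasFDerivAt
  let V : Π p : E' × F, TangentSpace 𝓘(ℝ, E' × F) p := fun p ↦ ((a, A p) : E' × F)
  let W : Π p : E' × F, TangentSpace 𝓘(ℝ, E' × F) p := fun p ↦ ((b, B p) : E' × F)
  have h1 := mpullback_mlieBracket (n := ∞) (f := Φ) (x₀ := x) (V := V) (W := W)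
    (mdifferentiableAt_vectorField_iff_differentiableAt.2 hA'.differentiableAt)
    (mdifferentiableAt_vectorField_iff_differentiableAt.2 hB'.differentiableAt)
    hl.contMDiffAt (by simpa using ENat.LEInfty.out)
  have h2 : mlieBracket 𝓘(ℝ, E' × F) V W (Φ x) =
      ((0, fderiv ℝ B (Φ x) (a, A (Φ x)) - fderiv ℝ A (Φ x) (b, B (Φ x))) : E' × F) := by
    rw [← mlieBracketWithin_univ, mlieBracketWithin_eq_lieBracketWithin, lieBracketWithin_univ,
      lieBracket, hA'.fderiv, hB'.fderiv]
    exact Prod.ext (sub_self (0 : E')) rfl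
  have h3 := hl.mfderiv_mpullback (mlieBracket 𝓘(ℝ, E' × F) V W)
  rw [h1, h2] at h3
  rw [h.mem_vertical hx, h3]
  exact ⟨rfl, rfl⟩

end IsAdaptedChart

end AdaptedFields

/-! ### The O'Neill tensor -/

section Splitting

variable {E : Type*} [NormedAddCommGroup E] [NormedSpace ℝ E]
  {M : Type*} [TopologicalSpace M] [ChartedSpace E M] [IsManifold 𝓘(ℝ, E) ∞ M]
  {E' : Type*} [NormedAddCommGroup E'] [NormedSpace ℝ E']
  {M' : Type*} [TopologicalSpace M'] [ChartedSpace E' M']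
  {π : M → M'} {x : M} {g : BilinField E M} {g' : BilinField E' M'}

theorem apply_eq_zero_of_mem (hg : IsSemiRiemannianMetric g) {v w : TangentSpace 𝓘(ℝ, E) x}
    (hv : v ∈ horizontal (E' := E') g π x) (hw : w ∈ vertical (E' := E') π x) : g x v w = 0 := by
  rw [hg.symm]
  exact hv w hw

variable [FiniteDimensional ℝ E]

/-- The vertical space is the orthogonal complement of the horizontal one. -/
theorem mem_vertical_of_forall (hg : IsSemiRiemannianMetric g)
    (hπ : IsSemiRiemannianSubmersion g g' π) {v : TangentSpace 𝓘(ℝ, E) x}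
    (hv : ∀ w ∈ horizontal (E' := E') g π x, g x v w = 0) : v ∈ vertical (E' := E') π x := by
  have hc := isCompl_vertical_horizontal hg hπ x
  obtain ⟨a, ha, b, hb, rfl⟩ :=
    Submodule.mem_sup.1 (hc.sup_eq_top.ge (Submodule.mem_top (x := v)))
  suffices b = 0 by rwa [this, add_zero]
  refine hg.nondegenerate x b fun w ↦ ?_
  obtain ⟨c, hcv, d, hd, rfl⟩ :=
    Submodule.mem_sup.1 (hc.sup_eq_top.ge (Submodule.mem_top (x := w)))
  have h1 := hv d hd
  rw [map_add, add_apply, hg.symm x a, apply_eq_zero_of_mem hg hd ha, zero_add] at h1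
  rw [map_add, h1, apply_eq_zero_of_mem hg hb hcv, add_zero]

variable [IsManifold 𝓘(ℝ, E') ∞ M']

theorem exists_isSectionAt_vertical
    (hπ : IsSemiRiemannianSubmersion g g' π) {w : TangentSpace 𝓘(ℝ, E) x}
    (hw : w ∈ vertical (E' := E') π x) :
    ∃ Y, IsSectionAt (vertical (E' := E') π) Y x ∧ Y x = w := by
  obtain ⟨F, _, _, _, Φ, κ, hx, h⟩ := exists_isAdaptedChart hπ.submersion x
  exact ⟨_, h.isSectionAt_verticalField hx _, h.eq_verticalField hx hw⟩

variable [FiniteDimensional ℝ E']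

theorem exists_isSectionAt_horizontal (hg : IsSemiRiemannianMetric g)
    (hπ : IsSemiRiemannianSubmersion g g' π) {w : TangentSpace 𝓘(ℝ, E) x}
    (hw : w ∈ horizontal (E' := E') g π x) :
    ∃ Y, IsSectionAt (horizontal (E' := E') g π) Y x ∧ Y x = w := by
  obtain ⟨F, _, _, _, Φ, κ, hx, h⟩ := exists_isAdaptedChart hπ.submersion x
  obtain ⟨L, hL⟩ := h.exists_isHorizontalGraph hg hπ
  exact ⟨_, h.isSectionAt_horizontalField hL hx _, h.eq_horizontalField hL hx hw⟩

open VectorField in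
/-- In an adapted chart the horizontal projection is `(a, b) ↦ (a, L p a)`. -/
theorem isSectionAt_horizontalProj (hg : IsSemiRiemannianMetric g)
    (hπ : IsSemiRiemannianSubmersion g g' π) {Y : Π x : M, TangentSpace 𝓘(ℝ, E) x}
    (hY : MDiffAt (T% Y) x) :
    IsSectionAt (horizontal (E' := E') g π) (fun y ↦ horizontalProj hg hπ y (Y y)) x where
  eventually_mem := Filter.Eventually.of_forall fun y ↦ Submodule.projection_apply_mem _ _
  mdifferentiableAt := by
    obtain ⟨F, _, _, _, Φ, κ, hx, h⟩ := exists_isAdaptedChart hπ.submersion x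
    obtain ⟨L, hL⟩ := h.exists_isHorizontalGraph hg hπ
    have hl := h.isLocalInverseAt x hx
    let Z : E' × F → E' × F := mpullback 𝓘(ℝ, E' × F) 𝓘(ℝ, E) Φ.symm Y
    have hZ : DifferentiableAt ℝ Z (Φ x) := mdifferentiableAt_vectorField_iff_differentiableAt.1
      (hl.mdifferentiableAt_mpullback_inv hY)
    have hL' := (hL.smooth.contDiffAt (Φ.open_target.mem_nhds (Φ.map_source hx))).differentiableAt
      (by simp)
    let W : Π p : E' × F, TangentSpace 𝓘(ℝ, E' × F) p :=
      fun p ↦ (((Z p).1, L p (Z p).1) : E' × F)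
    have hW : DifferentiableAt ℝ (fun p ↦ (((Z p).1, L p (Z p).1) : E' × F)) (Φ x) :=
      hZ.fst.prodMk (hL'.clm_apply hZ.fst)
    have hW' := hl.mdifferentiableAt_mpullback (X := W)
      (mdifferentiableAt_vectorField_iff_differentiableAt.2 hW)
    refine hW'.congr_of_eventuallyEq ?_
    filter_upwards [Φ.open_source.mem_nhds hx] with y hy
    have hly := h.isLocalInverseAt y hy
    have h1 : mfderiv 𝓘(ℝ, E) 𝓘(ℝ, E' × F) Φ y (mpullback 𝓘(ℝ, E) 𝓘(ℝ, E' × F) Φ W y) = W (Φ y) :=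
      hly.mfderiv_mpullback W
    have h2 : Z (Φ y) = mfderiv 𝓘(ℝ, E) 𝓘(ℝ, E' × F) Φ y (Y y) := hly.mpullback_inv_apply Y
    congr 1
    refine projection_eq_of_mem _ ?_ ?_
    · rw [hL.mem_horizontal y hy, h1]
    · rw [h.mem_vertical hy, map_sub, h1, ← h2]
      exact sub_self (Z (Φ y)).1

theorem isSectionAt_verticalProj (hg : IsSemiRiemannianMetric g)
    (hπ : IsSemiRiemannianSubmersion g g' π) {Y : Π x : M, TangentSpace 𝓘(ℝ, E) x}
    (hY : MDiffAt (T% Y) x) :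
    IsSectionAt (vertical (E' := E') π) (fun y ↦ verticalProj hg hπ y (Y y)) x where
  eventually_mem := Filter.Eventually.of_forall fun y ↦ Submodule.projection_apply_mem _ _
  mdifferentiableAt := by
    have h1 := mdifferentiableAt_sub_section hY
      (isSectionAt_horizontalProj hg hπ hY).mdifferentiableAt
    convert h1 using 3 with y
    refine projection_eq_of_mem _ ?_ ?_
    · have := Submodule.projection_apply_mem (isCompl_vertical_horizontal hg hπ y) (Y y)
      convert this using 1
      rw [Pi.sub_apply, sub_eq_iff_eq_add]
      exact (LinearMap.congr_fun (Submodule.projection_add_projection_eq_id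
        (isCompl_vertical_horizontal hg hπ y)) (Y y)).symm
    · rw [Pi.sub_apply, sub_sub_cancel]
      exact Submodule.projection_apply_mem _ _

end Splitting

section Alternation

variable {E : Type*} [NormedAddCommGroup E] [NormedSpace ℝ E] [FiniteDimensional ℝ E]
  {M : Type*} [TopologicalSpace M] [ChartedSpace E M] [IsManifold 𝓘(ℝ, E) ∞ M]
  {E' : Type*} [NormedAddCommGroup E'] [NormedSpace ℝ E']
  {M' : Type*} [TopologicalSpace M'] [ChartedSpace E' M']
  {π : M → M'} {x : M} {g : BilinField E M} {g' : BilinField E' M'}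
  {nabla : LinearConnection E M}

/-- The derivative of `g (X, V) = 0` for `X` horizontal and `V` vertical. -/
theorem IsLeviCivita.apply_eq_neg (h : IsLeviCivita g nabla) (hg : IsSemiRiemannianMetric g)
    {X V : Π x : M, TangentSpace 𝓘(ℝ, E) x} (hX : IsSectionAt (horizontal (E' := E') g π) X x)
    (hV : IsSectionAt (vertical (E' := E') π) V x) (v : TangentSpace 𝓘(ℝ, E) x) :
    g x (nabla X x v) (V x) = -g x (X x) (nabla V x v) := by
  have h1 := h.metric x X V hX.mdifferentiableAt hV.mdifferentiableAt v
  have h2 : (fun y ↦ g y (X y) (V y)) =ᶠ[𝓝 x] fun _ ↦ (0 : ℝ) := by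
    filter_upwards [hX.eventually_mem, hV.eventually_mem] with y h1 h2
      using apply_eq_zero_of_mem hg h1 h2
  have h3 : mvfderiv 𝓘(ℝ, E) (fun y ↦ g y (X y) (V y)) x v = 0 :=
    (congrArg (fun A : E →L[ℝ] ℝ ↦ A v) (h2.mfderiv_eq (I := 𝓘(ℝ, E)) (I' := 𝓘(ℝ, ℝ)))).trans
      (congrArg (fun A : E →L[ℝ] ℝ ↦ A v) mfderiv_const)
  linarith

variable [FiniteDimensional ℝ E'] [IsManifold 𝓘(ℝ, E') ∞ M']

/-- The vertical part of `∇_X Y` is skew in the horizontal fields `X`, `Y`: this holds since the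
scalar product of basic horizontal fields is constant along the fibres and their brackets with the
vertical coordinate fields are vertical. -/
theorem IsLeviCivita.apply_add_apply_eq_zero (h : IsLeviCivita g nabla)
    (hg : IsSemiRiemannianMetric g) (hg' : IsSemiRiemannianMetric g')
    (hπ : IsSemiRiemannianSubmersion g g' π)
    {X Y : Π x : M, TangentSpace 𝓘(ℝ, E) x} (hX : IsSectionAt (horizontal (E' := E') g π) X x)
    (hY : IsSectionAt (horizontal (E' := E') g π) Y x) {v : TangentSpace 𝓘(ℝ, E) x}
    (hv : v ∈ vertical (E' := E') π x) :
    g x (nabla Y x (X x)) v + g x (nabla X x (Y x)) v = 0 := by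
  obtain ⟨F, _, _, _, Φ, κ, hx, hc⟩ := exists_isAdaptedChart hπ.submersion x
  obtain ⟨L, hL⟩ := hc.exists_isHorizontalGraph hg hπ
  let u := (mfderiv 𝓘(ℝ, E) 𝓘(ℝ, E' × F) Φ x (X x) : E' × F).1
  let w := (mfderiv 𝓘(ℝ, E) 𝓘(ℝ, E' × F) Φ x (Y x) : E' × F).1
  let f := (mfderiv 𝓘(ℝ, E) 𝓘(ℝ, E' × F) Φ x v : E' × F).2
  let V : Π x : M, TangentSpace 𝓘(ℝ, E) x := verticalField Φ f
  let H (u : E') : Π x : M, TangentSpace 𝓘(ℝ, E) x := horizontalField Φ L u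
  have hV : IsSectionAt (vertical (E' := E') π) V x := hc.isSectionAt_verticalField hx f
  have hVv : V x = v := hc.eq_verticalField hx hv
  have hH (u) : IsSectionAt (horizontal (E' := E') g π) (H u) x :=
    hc.isSectionAt_horizontalField hL hx u
  have hHX : H u x = X x := hc.eq_horizontalField hL hx hX.mem
  have hHY : H w x = Y x := hc.eq_horizontalField hL hx hY.mem
  have hLd : DifferentiableAt ℝ L (Φ x) :=
    (hL.smooth.contDiffAt (Φ.open_target.mem_nhds (Φ.map_source hx))).differentiableAt (by simp)
  -- the bracket of `H u` with `V` is vertical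
  have bracket (u z : E') :
      g x (nabla V x (H u x)) (H z x) = g x (nabla (H u) x (V x)) (H z x) := by
    have h1 := (CovariantDerivative.torsion_eq_zero_iff _).1 h.torsionFree
      (hH u).mdifferentiableAt hV.mdifferentiableAt
    have h2 : VectorField.mlieBracket 𝓘(ℝ, E) (H u) V x ∈ vertical (E' := E') π x :=
      (hc.mlieBracket_mem_vertical hx (hLd.clm_apply (differentiableAt_const u))
        (differentiableAt_const f)).1
    have h3 := (hH z).mem _ h2
    rw [← h1, map_sub, sub_apply] at h3
    exact sub_eq_zero.1 h3
  -- `g (H u, H w)` is constant along the fibres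
  have const : mvfderiv 𝓘(ℝ, E) (fun y ↦ g y (H u y) (H w y)) x (V x) = 0 := by
    let K (u : E') : Π m : M', TangentSpace 𝓘(ℝ, E') m :=
      VectorField.mpullback 𝓘(ℝ, E') 𝓘(ℝ, E') κ (fun _ ↦ (u : E'))
    have hK (u : E') : MDiffAt (T% (K u)) (π x) :=
      (hc.isLocalInverseAt_cod _ (hc.mapsTo x hx)).mdifferentiableAt_mpullback
        (mdifferentiableAt_vectorField_iff_differentiableAt.2 (differentiableAt_const _))
    have hHK (u : E') {y : M} (hy : y ∈ Φ.source) :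
        mfderiv 𝓘(ℝ, E) 𝓘(ℝ, E') π y (H u y) = K u (π y) := by
      have hκ := hc.isLocalInverseAt_cod _ (hc.mapsTo y hy)
      refine hκ.isInvertible_mfderiv.injective ?_
      rw [hc.mfderiv_fst hy, hc.mfderiv_horizontalField hy]
      exact (hκ.mfderiv_mpullback fun _ ↦ (u : E')).symm
    have h1 : (fun y ↦ g y (H u y) (H w y)) =ᶠ[𝓝 x]
        (fun m ↦ g' m (K u m) (K w m)) ∘ π := by
      filter_upwards [Φ.open_source.mem_nhds hx] with y hy
      rw [← hπ.isometry y _ (hc.horizontalField_mem hL hy u) _ (hc.horizontalField_mem hL hy w)]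
      exact congrArg₂ (fun a b : E' ↦ g' (π y) a b) (hHK u hy) (hHK w hy)
    have h2 := mvfderiv_comp_apply x (hg'.mdifferentiableAt_apply (hK u) (hK w))
      ((hc.contMDiffAt hx).mdifferentiableAt (by simp)) (V x)
    have h3 : mfderiv 𝓘(ℝ, E) 𝓘(ℝ, E') π x (V x) = 0 := hV.mem
    rw [h3, map_zero] at h2
    exact (congrArg (fun A : E →L[ℝ] ℝ ↦ A (V x))
      (h1.mfderiv_eq (I := 𝓘(ℝ, E)) (I' := 𝓘(ℝ, ℝ)))).trans h2
  rw [h.metric x _ _ (hH u).mdifferentiableAt (hH w).mdifferentiableAt, ← bracket,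
    hg.symm x (H u x), ← bracket] at const
  rw [← hVv, h.apply_eq_neg hg hX hV, h.apply_eq_neg hg hY hV, hg.symm x (X x), hg.symm x (Y x),
    ← hHX, ← hHY]
  linarith

end Alternation

section Vanishing

variable {E : Type*} [NormedAddCommGroup E] [NormedSpace ℝ E]
  {M : Type*} [TopologicalSpace M] [ChartedSpace E M] [IsManifold 𝓘(ℝ, E) ∞ M]
  {E' : Type*} [NormedAddCommGroup E'] [NormedSpace ℝ E']
  {M' : Type*} [TopologicalSpace M'] [ChartedSpace E' M'] [IsManifold 𝓘(ℝ, E') ∞ M']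
  {π : M → M'} {x : M} {g : BilinField E M} {g' : BilinField E' M'}
  {σ : EndSubspaceField E M} {σ' : EndSubspaceField E' M'}

theorem IsParaholomorphic.apply_mem_vertical (hπ : IsParaholomorphic σ σ' π)
    {J : TangentSpace 𝓘(ℝ, E) x →L[ℝ] TangentSpace 𝓘(ℝ, E) x} (hJ : J ∈ σ x)
    {v : TangentSpace 𝓘(ℝ, E) x} (hv : v ∈ vertical (E' := E') π x) :
    J v ∈ vertical (E' := E') π x := by
  obtain ⟨U, B, U', B', hU, hx, hB, hU', hx', hB', hBB'⟩ := hπ.2 x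
  rw [← hB.span_eq x hx] at hJ
  induction hJ using Submodule.span_induction with
  | mem K hK =>
    obtain ⟨a, rfl⟩ := hK
    have h1 := hBB' x hx hx' a v
    have h2 : mfderiv 𝓘(ℝ, E) 𝓘(ℝ, E') π x v = 0 := hv
    rw [h2, map_zero] at h1
    exact h1.symm
  | zero => exact zero_mem _
  | add K L _ _ hK hL => exact add_mem hK hL
  | smul c K _ hK => exact Submodule.smul_mem _ c hK

/-- The horizontal spaces are `σ`-invariant, since the vertical ones are and the elements of `σ` are
skew. -/
theorem IsParaholomorphic.apply_mem_horizontal (hπ : IsParaholomorphic σ σ' π)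
    (h : IsAlmostParaquaternionicHermitian σ g)
    {J : TangentSpace 𝓘(ℝ, E) x →L[ℝ] TangentSpace 𝓘(ℝ, E) x} (hJ : J ∈ σ x)
    {w : TangentSpace 𝓘(ℝ, E) x} (hw : w ∈ horizontal (E' := E') g π x) :
    J w ∈ horizontal (E' := E') g π x := fun v hv ↦ by
  have h1 := h.skew hJ v w
  rwa [hw _ (hπ.apply_mem_vertical hJ hv), add_zero] at h1

variable [FiniteDimensional ℝ E] [FiniteDimensional ℝ E'] {nabla : LinearConnection E M}

/-- The derivative of a horizontal field in a horizontal direction is horizontal. Indeed, the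
vertical part `β(X, Y, v) = g (∇_X Y, v)` is skew in `X`, `Y` and compatible with the local basis
`J` of `σ`, in the sense that `β(X, J_a Y, v) = -β(X, Y, J_a v)`. Computing `β(J₁ X, J₂ Y, v)` in
two ways gives `β(X, Y, J₁ J₂ v) = β(X, Y, J₂ J₁ v)`, which vanishes since `J₁` and `J₂`
anticommute and `J₁ J₂` is invertible. -/
theorem IsParaquaternionicSubmersion.nabla_mem_horizontal
    (hπ : IsParaquaternionicSubmersion σ g σ' g' π) (hM : IsParaquaternionicKahler σ g)
    (hg' : IsSemiRiemannianMetric g') (h : IsLeviCivita g nabla)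
    {Y : Π x : M, TangentSpace 𝓘(ℝ, E) x} (hY : IsSectionAt (horizontal (E' := E') g π) Y x)
    {w : TangentSpace 𝓘(ℝ, E) x} (hw : w ∈ horizontal (E' := E') g π x) :
    nabla Y x w ∈ horizontal (E' := E') g π x := by
  obtain ⟨nabla₀, h₀, hp₀⟩ := hM.kahler
  have hg := hM.hermitian.metric
  have hp := hp₀.of_isLeviCivita h₀ h hg
  obtain ⟨U, hU, hx, J, hJ⟩ := hM.hermitian.almost.exists_basis x
  have hJs (a : Fin 3) {Y : Π x : M, TangentSpace 𝓘(ℝ, E) x}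
      (hY : IsSectionAt (horizontal (E' := E') g π) Y x) :
      IsSectionAt (horizontal (E' := E') g π) (fun y ↦ J a y (Y y)) x := by
    refine ⟨(hJ.smooth a).mdifferentiableAt_apply hU hx hY.mdifferentiableAt, ?_⟩
    filter_upwards [hU.mem_nhds hx, hY.eventually_mem] with y hy hYy
      using hπ.paraholomorphic.apply_mem_horizontal hM.hermitian (hJ.mem hy a) hYy
  have comm (a : Fin 3) {X Y : Π x : M, TangentSpace 𝓘(ℝ, E) x}
      (hX : IsSectionAt (horizontal (E' := E') g π) X x)
      (hY : IsSectionAt (horizontal (E' := E') g π) Y x) {v : TangentSpace 𝓘(ℝ, E) x}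
      (hv : v ∈ vertical (E' := E') π x) :
      g x (nabla (fun y ↦ J a y (Y y)) x (X x)) v = -g x (nabla Y x (X x)) (J a x v) := by
    obtain ⟨T, hT, hTY⟩ := hp U (J a) hU (hJ.smooth a) (fun y hy ↦ hJ.mem hy a) x hx (X x)
    have h1 := hTY Y hY.mdifferentiableAt
    have h2 := hπ.paraholomorphic.apply_mem_horizontal hM.hermitian hT hY.mem v hv
    rw [← h1, map_sub, hg.symm x v, hg.symm x v] at h2
    have h3 := hM.hermitian.skew (hJ.mem hx a) (nabla Y x (X x)) v
    linarith
  have alt {X Y : Π x : M, TangentSpace 𝓘(ℝ, E) x}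
      (hX : IsSectionAt (horizontal (E' := E') g π) X x)
      (hY : IsSectionAt (horizontal (E' := E') g π) Y x) {v : TangentSpace 𝓘(ℝ, E) x}
      (hv : v ∈ vertical (E' := E') π x) :
      g x (nabla Y x (X x)) v = -g x (nabla X x (Y x)) v :=
    eq_neg_of_add_eq_zero_left (h.apply_add_apply_eq_zero hg hg' hπ.semiRiemannian hX hY hv)
  obtain ⟨X, hX, rfl⟩ := exists_isSectionAt_horizontal hg hπ.semiRiemannian hw
  have hJv (a : Fin 3) {v : TangentSpace 𝓘(ℝ, E) x} (hv : v ∈ vertical (E' := E') π x) :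
      J a x v ∈ vertical (E' := E') π x :=
    hπ.paraholomorphic.apply_mem_vertical (hJ.mem hx a) hv
  have swap {v : TangentSpace 𝓘(ℝ, E) x} (hv : v ∈ vertical (E' := E') π x) :
      g x (nabla Y x (X x)) (J 0 x (J 1 x v)) = g x (nabla Y x (X x)) (J 1 x (J 0 x v)) := by
    have e1 := comm 1 (hJs 0 hX) hY hv
    have e2 := alt (hJs 0 hX) hY (hJv 1 hv)
    have e3 := comm 0 hY hX (hJv 1 hv)
    have e4 := alt hY hX (hJv 0 (hJv 1 hv))
    have f1 := alt (hJs 0 hX) (hJs 1 hY) hv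
    have f2 := comm 0 (hJs 1 hY) hX hv
    have f3 := alt (hJs 1 hY) hX (hJv 0 hv)
    have f4 := comm 1 hX hY (hJv 0 hv)
    linarith
  have key {v : TangentSpace 𝓘(ℝ, E) x} (hv : v ∈ vertical (E' := E') π x) :
      g x (nabla Y x (X x)) (J 2 x v) = 0 := by
    have h1 : J 0 x (J 1 x v) = tau 2 • J 2 x v := DFunLike.congr_fun (hJ.mul x hx 0) v
    have h2 : J 1 x (J 0 x v) = -(tau 2 • J 2 x v) := DFunLike.congr_fun (hJ.mul_swap x hx 0) v
    have h3 := swap hv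
    have ht : tau 2 = 1 := rfl
    rw [h1, h2, ht, one_smul, map_neg] at h3
    linarith
  intro v hv
  have h1 : J 2 x (J 2 x v) = -tau 2 • v := DFunLike.congr_fun (hJ.sq x hx 2) v
  have h2 := key (hJv 2 hv)
  have ht : tau 2 = 1 := rfl
  rw [h1, ht, neg_one_smul, map_neg, neg_eq_zero] at h2
  rw [hg.symm, h2]

/-- Since `g (X, V) = 0`, the mixed term `g (X, ∇_w V) = - g (∇_w X, V)` vanishes as well. -/
theorem IsParaquaternionicSubmersion.nabla_mem_vertical
    (hπ : IsParaquaternionicSubmersion σ g σ' g' π) (hM : IsParaquaternionicKahler σ g)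
    (hg' : IsSemiRiemannianMetric g') (h : IsLeviCivita g nabla)
    {V : Π x : M, TangentSpace 𝓘(ℝ, E) x} (hV : IsSectionAt (vertical (E' := E') π) V x)
    {w : TangentSpace 𝓘(ℝ, E) x} (hw : w ∈ horizontal (E' := E') g π x) :
    nabla V x w ∈ vertical (E' := E') π x := by
  have hg := hM.hermitian.metric
  refine mem_vertical_of_forall hg hπ.semiRiemannian fun z hz ↦ ?_
  obtain ⟨Z, hZ, rfl⟩ := exists_isSectionAt_horizontal hg hπ.semiRiemannian hz
  have h1 := h.apply_eq_neg hg hZ hV w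
  rw [apply_eq_zero_of_mem hg (hπ.nabla_mem_horizontal hM hg' h hZ hw) hV.mem] at h1
  rw [hg.symm]
  linarith

theorem IsParaquaternionicSubmersion.oneillA_eq_zero
    (hπ : IsParaquaternionicSubmersion σ g σ' g' π) (hM : IsParaquaternionicKahler σ g)
    (hg' : IsSemiRiemannianMetric g') (h : IsLeviCivita g nabla)
    (X : Π x : M, TangentSpace 𝓘(ℝ, E) x) {Y : Π x : M, TangentSpace 𝓘(ℝ, E) x}
    (hY : MDiffAt (T% Y) x) :
    oneillA hM.hermitian.metric hπ.semiRiemannian nabla X Y x = 0 := by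
  have hg := hM.hermitian.metric
  have hX : horizontalProj hg hπ.semiRiemannian x (X x) ∈ horizontal (E' := E') g π x :=
    Submodule.projection_apply_mem _ _
  have h1 := hπ.nabla_mem_horizontal hM hg' h
    (isSectionAt_horizontalProj hg hπ.semiRiemannian hY) hX
  have h2 := hπ.nabla_mem_vertical hM hg' h (isSectionAt_verticalProj hg hπ.semiRiemannian hY) hX
  rw [oneillA]
  exact (congrArg₂ (· + ·) ((Submodule.projection_apply_eq_zero_iff _).2 h1)
    ((Submodule.projection_apply_eq_zero_iff _).2 h2)).trans (add_zero 0)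

end Vanishing

/-! ### Integrability of the horizontal distribution -/

section Shear

variable {Z : Type*} [NormedAddCommGroup Z] [NormedSpace ℝ Z]
  {F : Type*} [NormedAddCommGroup F] [NormedSpace ℝ F]

/-- The map `(z, y) ↦ (z, y - s z)` of `U × F`, which straightens the graph of `s`. -/
def shear (s : Z → F) (U : Set Z) (hU : IsOpen U) (hs : ContinuousOn s U) :
    OpenPartialHomeomorph (Z × F) (Z × F) where
  toFun p := (p.1, p.2 - s p.1)
  invFun p := (p.1, p.2 + s p.1)
  source := U ×ˢ univ
  target := U ×ˢ univ
  map_source' _ hp := ⟨hp.1, mem_univ _⟩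
  map_target' _ hp := ⟨hp.1, mem_univ _⟩
  left_inv' _ _ := Prod.ext rfl (sub_add_cancel _ _)
  right_inv' _ _ := Prod.ext rfl (add_sub_cancel_right _ _)
  open_source := hU.prod isOpen_univ
  open_target := hU.prod isOpen_univ
  continuousOn_toFun := continuousOn_fst.prodMk
    (continuousOn_snd.sub (hs.comp continuousOn_fst fun _ hp ↦ hp.1))
  continuousOn_invFun := continuousOn_fst.prodMk
    (continuousOn_snd.add (hs.comp continuousOn_fst fun _ hp ↦ hp.1))

theorem contDiffOn_shear {s : Z → F} {U : Set Z} (hU : IsOpen U) (hs : ContDiffOn ℝ ∞ s U) :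
    ContDiffOn ℝ ∞ (shear s U hU hs.continuousOn) (U ×ˢ univ) :=
  contDiffOn_fst.prodMk (contDiffOn_snd.sub (hs.comp contDiffOn_fst fun _ hp ↦ hp.1))

theorem contDiffOn_shear_symm {s : Z → F} {U : Set Z} (hU : IsOpen U) (hs : ContDiffOn ℝ ∞ s U) :
    ContDiffOn ℝ ∞ (shear s U hU hs.continuousOn).symm (U ×ˢ univ) :=
  contDiffOn_fst.prodMk (contDiffOn_snd.add (hs.comp contDiffOn_fst fun _ hp ↦ hp.1))

end Shear

section Integrability

variable {E : Type*} [NormedAddCommGroup E] [NormedSpace ℝ E]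
  {M : Type*} [TopologicalSpace M] [ChartedSpace E M] [IsManifold 𝓘(ℝ, E) ∞ M]
  {E' : Type*} [NormedAddCommGroup E'] [NormedSpace ℝ E'] [FiniteDimensional ℝ E']
  {M' : Type*} [TopologicalSpace M'] [ChartedSpace E' M']
  {F : Type*} [NormedAddCommGroup F] [NormedSpace ℝ F] [FiniteDimensional ℝ F]
  {π : M → M'} {Φ : OpenPartialHomeomorph M (E' × F)} {κ : OpenPartialHomeomorph M' E'}
  {g : BilinField E M} {g' : BilinField E' M'} {L : E' × F → E' →L[ℝ] F}

theorem univBall_mem_maximalAtlas {k : ℕ} (c : EuclideanSpace ℝ (Fin k)) {r : ℝ}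
    (hr : 0 < r) : OpenPartialHomeomorph.univBall c r ∈ IsManifold.maximalAtlas
      𝓘(ℝ, EuclideanSpace ℝ (Fin k)) ∞ (EuclideanSpace ℝ (Fin k)) := by
  refine OpenPartialHomeomorph.mem_maximalAtlas_of_contMDiffOn _
    OpenPartialHomeomorph.contDiff_univBall.contMDiff.contMDiffOn ?_
  rw [OpenPartialHomeomorph.univBall_target c hr]
  exact OpenPartialHomeomorph.contDiffOn_univBall_symm.contMDiffOn

/-- If the system `s' = L (·, s)` is completely integrable, the horizontal distribution has an
integral manifold through each point of the adapted chart: the graph of a solution. -/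
theorem IsAdaptedChart.exists_isIntegralManifold (h : IsAdaptedChart (E := E) π Φ κ)
    (hL : IsHorizontalGraph (E := E) g π Φ L)
    (hint : ∀ p ∈ Φ.target, ∀ u w, fderiv ℝ L p (u, L p u) w = fderiv ℝ L p (w, L p w) u)
    {x : M} (hx : x ∈ Φ.source) :
    ∃ ι : EuclideanSpace ℝ (Fin (Module.finrank ℝ E')) → M,
      IsIntegralManifold (F := EuclideanSpace ℝ (Fin (Module.finrank ℝ E')))
        (horizontal (E' := E') g π) ι ∧ x ∈ range ι := by
  obtain ⟨r, hr, s, hs0, hs⟩ := exists_solution_total_differential_equation Φ.open_target hL.smooth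
    hint (Φ.map_source hx)
  have hU : IsOpen (Metric.ball (Φ x).1 r) := Metric.isOpen_ball
  have hsU : ContDiffOn ℝ ∞ s (Metric.ball (Φ x).1 r) :=
    contDiffOn_of_hasFDerivAt_graph hL.smooth hU hs
  let N := EuclideanSpace ℝ (Fin (Module.finrank ℝ E'))
  let e : N ≃L[ℝ] E' := ContinuousLinearEquiv.ofFinrankEq (by simp [N])
  -- a ball of the Euclidean model which `e` maps into the domain of `s`
  obtain ⟨r', hr', hball⟩ : ∃ r' > 0, ∀ n ∈ Metric.ball (e.symm (Φ x).1) r',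
      e n ∈ Metric.ball (Φ x).1 r := by
    have := Metric.continuousAt_iff.1 (e.continuous.continuousAt (x := e.symm (Φ x).1)) r hr
    simpa using this
  -- `N` is the whole model space, and `B` is a diffeomorphism from it to a ball
  let B : OpenPartialHomeomorph N N := OpenPartialHomeomorph.univBall (e.symm (Φ x).1) r'
  have hB := univBall_mem_maximalAtlas (e.symm (Φ x).1) hr'
  have hBs (n : N) : n ∈ B.source := by
    rw [OpenPartialHomeomorph.univBall_source]; exact mem_univ n
  have hBU (n : N) : e (B n) ∈ Metric.ball (Φ x).1 r := by
    refine hball _ ?_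
    rw [← OpenPartialHomeomorph.univBall_target _ hr']
    exact B.map_source (hBs n)
  let G : N → E' × F := fun n ↦ (e (B n), s (e (B n)))
  have hGt (n : N) : G n ∈ Φ.target := (hs _ (hBU n)).1
  let ι : N → M := fun n ↦ Φ.symm (G n)
  have hι (n : N) : ι n ∈ Φ.source := Φ.map_target (hGt n)
  have hΦι (n : N) : Φ (ι n) = G n := Φ.right_inv (hGt n)
  have hBd (n : N) := isLocalInverseAt_of_mem_maximalAtlas hB (hBs n)
  have hBd' (n : N) : HasFDerivAt B (fderiv ℝ B n) n :=
    ((hBd n).contMDiffAt.contDiffAt.differentiableAt (by simp)).hasFDerivAt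
  have hGd (n : N) : HasFDerivAt G (((e : N →L[ℝ] E').comp (fderiv ℝ B n)).prod
      ((L (G n)).comp ((e : N →L[ℝ] E').comp (fderiv ℝ B n)))) n := by
    have h1 := (e.hasFDerivAt (x := B n)).comp n (hBd' n)
    exact h1.prodMk (HasFDerivAt.comp n (hs _ (hBU n)).2 h1)
  have hιd (n : N) : MDifferentiableAt 𝓘(ℝ, N) 𝓘(ℝ, E) ι n := by
    have h1 := (h.isLocalInverseAt _ (hι n)).contMDiffAt_inv
    rw [hΦι] at h1
    exact (h1.mdifferentiableAt (by simp)).comp n (hGd n).differentiableAt.mdifferentiableAt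
  have hd (n : N) (t : N) :
      mfderiv 𝓘(ℝ, E) 𝓘(ℝ, E' × F) Φ (ι n) (mfderiv 𝓘(ℝ, N) 𝓘(ℝ, E) ι n t) =
      (e (fderiv ℝ B n t), L (G n) (e (fderiv ℝ B n t))) := by
    have h1 := mfderiv_comp_apply n ((h.isLocalInverseAt _ (hι n)).contMDiffAt.mdifferentiableAt
      (by simp)) (hιd n) t
    have h2 : Φ ∘ ι = G := funext hΦι
    rw [← h1, h2, mfderiv_eq_fderiv, (hGd n).fderiv]
    rfl
  refine ⟨ι, ⟨?_, ?_, ?_⟩, 0, ?_⟩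
  · intro n m hnm
    have h1 : G n = G m := by rw [← hΦι, ← hΦι, hnm]
    exact B.injOn (hBs n) (hBs m) (e.injective (congrArg Prod.fst h1))
  · let j : E ≃L[ℝ] E' × F := (h.isLocalInverseAt x hx).isInvertible_mfderiv.choose
    -- the chart `c` of `M` in which the graph of `s` is `{(z, 0)}`
    let τ := shear s _ hU hsU.continuousOn
    let c : OpenPartialHomeomorph M E := (Φ.trans τ).transHomeomorph j.symm.toHomeomorph
    have hc : c ∈ IsManifold.maximalAtlas 𝓘(ℝ, E) ∞ M := by
      refine OpenPartialHomeomorph.mem_maximalAtlas_of_contMDiffOn _ ?_ ?_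
      · intro y hy
        have h1 : Φ y ∈ τ.source := hy.2
        have h2 := ((contDiffOn_shear hU hsU).contDiffAt (τ.open_source.mem_nhds h1)).contMDiffAt
        have h3 := (h.isLocalInverseAt y hy.1).contMDiffAt
        exact (j.symm.contDiff.contMDiff.contMDiffAt.comp y (h2.comp y h3)).contMDiffWithinAt
      · intro y hy
        have h0 : j y ∈ (Φ.trans τ).target := hy
        rw [OpenPartialHomeomorph.trans_target] at h0
        have h2 := ((contDiffOn_shear_symm hU hsU).contDiffAt
          (τ.open_target.mem_nhds h0.1)).contMDiffAt
        have h3 := (h.isLocalInverseAt _ (Φ.map_target h0.2)).contMDiffAt_inv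
        rw [Φ.right_inv h0.2] at h3
        exact (h3.comp y (h2.comp y j.contDiff.contMDiff.contMDiffAt)).contMDiffWithinAt
    have hcι (n : N) : ι n ∈ c.source := by
      refine ⟨hι n, ?_⟩
      change Φ (ι n) ∈ τ.source
      rw [hΦι]
      exact ⟨hBU n, mem_univ _⟩
    have him : Manifold.IsImmersionOfComplement F 𝓘(ℝ, N) 𝓘(ℝ, E) ∞ ι := fun n ↦ by
      refine .mk_of_charts ((e.prodCongr (.refl ℝ F)).trans j.symm) B c (hBs n) (hcι n) hB hc
        (fun n _ ↦ hcι n) fun y hy ↦ ?_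
      have hy' : y ∈ B.target := by simpa using hy
      have h1 : Φ (ι (B.symm y)) = (e y, s (e y)) := by
        rw [hΦι]
        simp only [G, B.right_inv hy']
      change j.symm (τ (Φ (ι (B.symm y)))) = j.symm (e y, 0)
      rw [h1]
      exact congrArg j.symm (Prod.ext rfl (sub_self (s (e y))))
    exact him.isImmersion
  · intro n
    ext w
    rw [hL.mem_horizontal _ (hι n), hΦι]
    constructor
    · rintro ⟨t, rfl⟩
      have := hd n t
      change (mfderiv 𝓘(ℝ, E) 𝓘(ℝ, E' × F) Φ (ι n) (mfderiv 𝓘(ℝ, N) 𝓘(ℝ, E) ι n t) : E' × F).2 =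
        L (G n) (mfderiv 𝓘(ℝ, E) 𝓘(ℝ, E' × F) Φ (ι n) (mfderiv 𝓘(ℝ, N) 𝓘(ℝ, E) ι n t) : E' × F).1
      rw [this]
    · intro hw
      obtain ⟨t, ht⟩ : ∃ t, fderiv ℝ B n t =
          e.symm (mfderiv 𝓘(ℝ, E) 𝓘(ℝ, E' × F) Φ (ι n) w : E' × F).1 :=
        ⟨_, by rw [← mfderiv_eq_fderiv]; exact (hBd n).isInvertible_mfderiv.self_apply_inverse _⟩
      refine ⟨t, (h.isLocalInverseAt _ (hι n)).isInvertible_mfderiv.injective ?_⟩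
      refine (hd n t).trans ?_
      rw [ht, e.apply_symm_apply]
      exact Prod.ext rfl hw.symm
  · have h1 : B 0 = e.symm (Φ x).1 := OpenPartialHomeomorph.univBall_apply_zero _ _
    change Φ.symm (e (B 0), s (e (B 0))) = x
    rw [h1, e.apply_symm_apply, hs0]
    exact Φ.left_inv hx

end Integrability

section HorizontalIntegrable

variable {E : Type*} [NormedAddCommGroup E] [NormedSpace ℝ E] [FiniteDimensional ℝ E]
  {M : Type*} [TopologicalSpace M] [ChartedSpace E M] [IsManifold 𝓘(ℝ, E) ∞ M]
  {E' : Type*} [NormedAddCommGroup E'] [NormedSpace ℝ E'] [FiniteDimensional ℝ E']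
  {M' : Type*} [TopologicalSpace M'] [ChartedSpace E' M'] [IsManifold 𝓘(ℝ, E') ∞ M']
  {π : M → M'} {g : BilinField E M} {g' : BilinField E' M'}
  {σ : EndSubspaceField E M} {σ' : EndSubspaceField E' M'}

/-- The brackets `[X, Y] = ∇_X Y - ∇_Y X` of horizontal fields are horizontal; for the horizontal
lifts of coordinate fields they are also vertical, hence zero, and this is the integrability
condition for the system of differential equations of the integral manifolds. -/
theorem IsParaquaternionicSubmersion.isIntegrable
    (hπ : IsParaquaternionicSubmersion σ g σ' g' π) (hM : IsParaquaternionicKahler σ g)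
    (hg' : IsSemiRiemannianMetric g') : IsIntegrable (horizontal (E' := E') g π) := by
  intro x
  have hg := hM.hermitian.metric
  obtain ⟨nabla, hLC, -⟩ := hM.kahler
  obtain ⟨F, _, _, _, Φ, κ, hx, h⟩ := exists_isAdaptedChart hπ.semiRiemannian.submersion x
  obtain ⟨L, hL⟩ := h.exists_isHorizontalGraph hg hπ.semiRiemannian
  have hint : ∀ p ∈ Φ.target, ∀ u w, fderiv ℝ L p (u, L p u) w = fderiv ℝ L p (w, L p w) u := by
    intro p hp u w
    obtain ⟨y, hy, rfl⟩ : ∃ y ∈ Φ.source, Φ y = p := ⟨_, Φ.map_target hp, Φ.right_inv hp⟩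
    have hu := h.isSectionAt_horizontalField hL hy u
    have hw := h.isSectionAt_horizontalField hL hy w
    have hLd : DifferentiableAt ℝ L (Φ y) :=
      (hL.smooth.contDiffAt (Φ.open_target.mem_nhds hp)).differentiableAt (by simp)
    have h1 := (CovariantDerivative.torsion_eq_zero_iff _).1 hLC.torsionFree
      hu.mdifferentiableAt hw.mdifferentiableAt
    obtain ⟨h2, h3⟩ := h.mlieBracket_mem_vertical hy (a := u) (b := w) (A := fun p ↦ L p u)
      (B := fun p ↦ L p w) (hLd.clm_apply (differentiableAt_const u))
      (hLd.clm_apply (differentiableAt_const w))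
    have h4 : VectorField.mlieBracket 𝓘(ℝ, E) (horizontalField Φ L u) (horizontalField Φ L w) y ∈
        horizontal (E' := E') g π y := by
      rw [← h1]
      exact sub_mem (hπ.nabla_mem_horizontal hM hg' hLC hw hu.mem)
        (hπ.nabla_mem_horizontal hM hg' hLC hu hw.mem)
    have h5 := (isCompl_vertical_horizontal hg hπ.semiRiemannian y).disjoint.le_bot ⟨h2, h4⟩
    have h6 : VectorField.mlieBracket 𝓘(ℝ, E) (horizontalField Φ L u)
        (horizontalField Φ L w) y = 0 := h5
    change (mfderiv 𝓘(ℝ, E) 𝓘(ℝ, E' × F) Φ y (VectorField.mlieBracket 𝓘(ℝ, E)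
      (horizontalField Φ L u) (horizontalField Φ L w) y) : E' × F).2 = _ at h3
    rw [h6, map_zero] at h3
    have h7 (u : E') (v : E' × F) : fderiv ℝ (fun p ↦ L p u) (Φ y) v = fderiv ℝ L (Φ y) v u := by
      rw [fderiv_clm_apply hLd (differentiableAt_const u)]
      simp
    rw [h7, h7] at h3
    exact (sub_eq_zero.1 h3.symm)
  obtain ⟨ι, hι, hxι⟩ := h.exists_isIntegralManifold hL hint hx
  exact ⟨_, _, inferInstance, inferInstance, inferInstance, inferInstance, inferInstance,
    ι, hι, hxι⟩

end HorizontalIntegrable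

/-! ### Integral manifolds of the horizontal distribution -/

section Immersion

variable {E : Type*} [NormedAddCommGroup E] [NormedSpace ℝ E]
  {M : Type*} [TopologicalSpace M] [ChartedSpace E M] [IsManifold 𝓘(ℝ, E) ∞ M]
  {F : Type*} [NormedAddCommGroup F] [NormedSpace ℝ F]
  {N : Type*} [TopologicalSpace N] [ChartedSpace F N] [IsManifold 𝓘(ℝ, F) ∞ N]
  {ι : N → M}

/-- In suitable charts an immersion is `y ↦ (y, 0)`, so it has smooth local left inverses. -/
theorem mfderiv_injective_of_isImmersion (hι : Manifold.IsImmersion 𝓘(ℝ, F) 𝓘(ℝ, E) ∞ ι) (y : N) :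
    Function.Injective (mfderiv 𝓘(ℝ, F) 𝓘(ℝ, E) ι y) := by
  have h := hι.isImmersionAt y
  have hιd := h.contMDiffAt.mdifferentiableAt (by simp)
  have hc := isLocalInverseAt_of_mem_maximalAtlas h.domChart_mem_maximalAtlas h.mem_domChart_source
  have hd := (isLocalInverseAt_of_mem_maximalAtlas h.codChart_mem_maximalAtlas
    h.mem_codChart_source).contMDiffAt.mdifferentiableAt (by simp)
  let r : E →L[ℝ] F := (ContinuousLinearMap.fst ℝ F h.complement).comp
    (h.equiv.symm : E →L[ℝ] F × h.complement)
  have hr : MDifferentiableAt 𝓘(ℝ, E) 𝓘(ℝ, F) (r ∘ h.codChart) (ι y) :=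
    (r.differentiableAt.mdifferentiableAt (x := h.codChart (ι y))).comp (ι y) hd
  have h1 : h.domChart =ᶠ[𝓝 y] (r ∘ h.codChart) ∘ ι := by
    filter_upwards [h.domChart.open_source.mem_nhds h.mem_domChart_source] with z hz
    have h1 := h.writtenInCharts ((h.domChart.extend 𝓘(ℝ, F)).map_source (x := z)
      (by rw [h.domChart.extend_source]; exact hz))
    have h2 : h.codChart (ι (h.domChart.symm (h.domChart z))) = h.equiv (h.domChart z, 0) := h1
    rw [h.domChart.left_inv hz] at h2
    simp [r, h2]
  intro v w hvw
  refine hc.isInvertible_mfderiv.injective ?_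
  have h2 (v : TangentSpace 𝓘(ℝ, F) y) : mfderiv 𝓘(ℝ, F) 𝓘(ℝ, F) h.domChart y v =
      mfderiv 𝓘(ℝ, E) 𝓘(ℝ, F) (r ∘ h.codChart) (ι y) (mfderiv 𝓘(ℝ, F) 𝓘(ℝ, E) ι y v) :=
    (congrArg (fun A : F →L[ℝ] F ↦ A v) (h1.mfderiv_eq (I := 𝓘(ℝ, F)) (I' := 𝓘(ℝ, F)))).trans
      (mfderiv_comp_apply y hr hιd v)
  have h3 := congrArg (mfderiv 𝓘(ℝ, E) 𝓘(ℝ, F) (r ∘ h.codChart) (ι y)) hvw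
  exact (h2 v).trans (h3.trans (h2 w).symm)

end Immersion

section HorizontalInjectivity

variable {E : Type*} [NormedAddCommGroup E] [NormedSpace ℝ E] [FiniteDimensional ℝ E]
  {M : Type*} [TopologicalSpace M] [ChartedSpace E M] [IsManifold 𝓘(ℝ, E) ∞ M]
  {E' : Type*} [NormedAddCommGroup E'] [NormedSpace ℝ E']
  {M' : Type*} [TopologicalSpace M'] [ChartedSpace E' M']
  {π : M → M'} {g : BilinField E M} {g' : BilinField E' M'}

/-- The differential of `π` is injective on horizontal vectors. -/
theorem eq_of_mfderiv_eq (hg : IsSemiRiemannianMetric g)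
    (hπ : IsSemiRiemannianSubmersion g g' π) {x : M} {v w : TangentSpace 𝓘(ℝ, E) x}
    (hv : v ∈ horizontal (E' := E') g π x) (hw : w ∈ horizontal (E' := E') g π x)
    (hvw : mfderiv 𝓘(ℝ, E) 𝓘(ℝ, E') π x v = mfderiv 𝓘(ℝ, E) 𝓘(ℝ, E') π x w) : v = w := by
  have h1 : v - w ∈ vertical (E' := E') π x := by
    change mfderiv 𝓘(ℝ, E) 𝓘(ℝ, E') π x (v - w) = 0
    rw [map_sub, hvw, sub_self]
  exact sub_eq_zero.1 ((isCompl_vertical_horizontal hg hπ x).disjoint.le_bot ⟨h1, sub_mem hv hw⟩)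

end HorizontalInjectivity

section IntegralManifold

variable {E : Type*} [NormedAddCommGroup E] [NormedSpace ℝ E]
  {M : Type*} [TopologicalSpace M] [ChartedSpace E M]
  {E' : Type*} [NormedAddCommGroup E'] [NormedSpace ℝ E']
  {M' : Type*} [TopologicalSpace M'] [ChartedSpace E' M']
  {F : Type*} [NormedAddCommGroup F] [NormedSpace ℝ F]
  {N : Type*} [TopologicalSpace N] [ChartedSpace F N]
  {π : M → M'} {g : BilinField E M} {g' : BilinField E' M'}
  {σ : EndSubspaceField E M} {σ' : EndSubspaceField E' M'} {ι : N → M} {y : N}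

theorem IsIntegralManifold.mfderiv_mem {D : SubspaceField E M}
    (hι : IsIntegralManifold (F := F) D ι) (v : TangentSpace 𝓘(ℝ, F) y) :
    mfderiv 𝓘(ℝ, F) 𝓘(ℝ, E) ι y v ∈ D (ι y) := by
  rw [← hι.tangent y]
  exact ⟨v, rfl⟩

theorem IsIntegralManifold.mfderiv_comp_apply (hι : IsIntegralManifold (F := F)
    (horizontal (E' := E') g π) ι) (hπ : IsSemiRiemannianSubmersion g g' π)
    (v : TangentSpace 𝓘(ℝ, F) y) :
    mfderiv 𝓘(ℝ, F) 𝓘(ℝ, E') (π ∘ ι) y v =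
      mfderiv 𝓘(ℝ, E) 𝓘(ℝ, E') π (ι y) (mfderiv 𝓘(ℝ, F) 𝓘(ℝ, E) ι y v) :=
  _root_.mfderiv_comp_apply y (hπ.submersion.contMDiff.contMDiffAt.mdifferentiableAt (by simp))
    (hι.immersion.contMDiff.contMDiffAt.mdifferentiableAt (by simp)) v

theorem IsIntegralManifold.inducedMetric_eq
    (hι : IsIntegralManifold (F := F) (horizontal (E' := E') g π) ι)
    (hπ : IsSemiRiemannianSubmersion g g' π) :
    inducedMetric (F := F) ι g = inducedMetric (F := F) (π ∘ ι) g' := by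
  ext y v w
  rw [inducedMetric_apply, inducedMetric_apply, hι.mfderiv_comp_apply hπ,
    hι.mfderiv_comp_apply hπ]
  exact (hπ.isometry _ _ (hι.mfderiv_mem v) _ (hι.mfderiv_mem w)).symm

variable [IsManifold 𝓘(ℝ, E) ∞ M] [IsManifold 𝓘(ℝ, E') ∞ M']

theorem IsParaholomorphic.exists_mem (hπ : IsParaholomorphic σ σ' π) {x : M}
    {J : TangentSpace 𝓘(ℝ, E) x →L[ℝ] TangentSpace 𝓘(ℝ, E) x} (hJ : J ∈ σ x) :
    ∃ J' ∈ σ' (π x), ∀ v, mfderiv 𝓘(ℝ, E) 𝓘(ℝ, E') π x (J v) =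
      J' (mfderiv 𝓘(ℝ, E) 𝓘(ℝ, E') π x v) := by
  obtain ⟨U, B, U', B', hU, hx, hB, hU', hx', hB', hBB'⟩ := hπ.2 x
  rw [← hB.span_eq x hx, Submodule.mem_span_range_iff_exists_fun] at hJ
  obtain ⟨c, rfl⟩ := hJ
  refine ⟨∑ a, c a • B' a (π x), sum_mem fun a _ ↦ Submodule.smul_mem _ _ (hB'.mem hx' a),
    fun v ↦ ?_⟩
  simp [hBB' x hx hx']

theorem IsParaholomorphic.exists_mem_of_mem (hπ : IsParaholomorphic σ σ' π) {x : M}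
    {J' : TangentSpace 𝓘(ℝ, E') (π x) →L[ℝ] TangentSpace 𝓘(ℝ, E') (π x)} (hJ' : J' ∈ σ' (π x)) :
    ∃ J ∈ σ x, ∀ v, mfderiv 𝓘(ℝ, E) 𝓘(ℝ, E') π x (J v) =
      J' (mfderiv 𝓘(ℝ, E) 𝓘(ℝ, E') π x v) := by
  obtain ⟨U, B, U', B', hU, hx, hB, hU', hx', hB', hBB'⟩ := hπ.2 x
  rw [← hB'.span_eq _ hx', Submodule.mem_span_range_iff_exists_fun] at hJ'
  obtain ⟨c, rfl⟩ := hJ'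
  refine ⟨∑ a, c a • B a x, sum_mem fun a _ ↦ Submodule.smul_mem _ _ (hB.mem hx a),
    fun v ↦ ?_⟩
  simp [hBB' x hx hx']

theorem IsIntegralManifold.isInvariantSubmanifold
    (hι : IsIntegralManifold (F := F) (horizontal (E' := E') g π) ι)
    (hπ : IsParaholomorphic σ σ' π) (h : IsAlmostParaquaternionicHermitian σ g) :
    IsInvariantSubmanifold (F := F) σ ι := fun y J hJ v hv ↦ by
  rw [hι.tangent y] at hv ⊢
  exact hπ.apply_mem_horizontal h hJ hv

variable [FiniteDimensional ℝ E]

/-- The restriction of `σ` to an integral manifold is also the pull-back of `σ'`: an endomorphism of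
the horizontal space is determined by its image under `dπ`. -/
theorem IsIntegralManifold.inducedStructure_eq
    (hι : IsIntegralManifold (F := F) (horizontal (E' := E') g π) ι)
    (hπ : IsParaquaternionicSubmersion σ g σ' g' π) (h : IsAlmostParaquaternionicHermitian σ g) :
    inducedStructure (F := F) ι σ = inducedStructure (F := F) (π ∘ ι) σ' := by
  have hπs := hπ.semiRiemannian
  ext y K
  rw [mem_inducedStructure, mem_inducedStructure]
  constructor
  · rintro ⟨J, hJ, hK⟩
    obtain ⟨J', hJ', hJJ'⟩ := hπ.paraholomorphic.exists_mem hJ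
    refine ⟨J', hJ', fun v ↦ ?_⟩
    rw [hι.mfderiv_comp_apply hπs, hι.mfderiv_comp_apply hπs, hK, hJJ']
  · rintro ⟨J', hJ', hK⟩
    obtain ⟨J, hJ, hJJ'⟩ := hπ.paraholomorphic.exists_mem_of_mem hJ'
    refine ⟨J, hJ, fun v ↦ eq_of_mfderiv_eq h.metric hπs (hι.mfderiv_mem _)
      (hπ.paraholomorphic.apply_mem_horizontal h hJ (hι.mfderiv_mem v)) ?_⟩
    rw [hJJ', ← hι.mfderiv_comp_apply hπs, hK, hι.mfderiv_comp_apply hπs]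

/-- On an integral manifold of the horizontal distribution, the submersion restricts to a local
diffeomorphism. -/
theorem IsIntegralManifold.mfderiv_comp_bijective [IsManifold 𝓘(ℝ, F) ∞ N]
    (hι : IsIntegralManifold (F := F) (horizontal (E' := E') g π) ι)
    (hg : IsSemiRiemannianMetric g) (hπ : IsSemiRiemannianSubmersion g g' π) (y : N) :
    Function.Bijective (mfderiv 𝓘(ℝ, F) 𝓘(ℝ, E') (π ∘ ι) y) := by
  refine ⟨fun v w hvw ↦ ?_, fun u ↦ ?_⟩
  · refine mfderiv_injective_of_isImmersion hι.immersion y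
      (eq_of_mfderiv_eq hg hπ (hι.mfderiv_mem v) (hι.mfderiv_mem w) ?_)
    rw [← hι.mfderiv_comp_apply hπ, ← hι.mfderiv_comp_apply hπ, hvw]
  · obtain ⟨_, _, _, _, Φ, κ, hx, h⟩ := exists_isAdaptedChart hπ.submersion (ι y)
    obtain ⟨w, rfl⟩ := h.mfderiv_surjective hx u
    obtain ⟨a, ha, b, hb, rfl⟩ := Submodule.mem_sup.1
      ((isCompl_vertical_horizontal hg hπ (ι y)).sup_eq_top.ge (Submodule.mem_top (x := w)))
    rw [← hι.tangent y] at hb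
    obtain ⟨t, rfl⟩ := hb
    refine ⟨t, ?_⟩
    have ha' : mfderiv 𝓘(ℝ, E) 𝓘(ℝ, E') π (ι y) a = 0 := ha
    rw [map_add, ha', zero_add]
    exact hι.mfderiv_comp_apply hπ t

/-- The induced structure and metric are pulled back from `M'` by the local diffeomorphism `π ∘ ι`,
so they inherit the paraquaternionic Kähler property from there. -/
theorem IsIntegralManifold.isParaquaternionicKahlerSubmanifold
    [FiniteDimensional ℝ E'] [FiniteDimensional ℝ F] [IsManifold 𝓘(ℝ, F) ∞ N]
    (hι : IsIntegralManifold (F := F) (horizontal (E' := E') g π) ι)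
    (hπ : IsParaquaternionicSubmersion σ g σ' g' π) (hM : IsParaquaternionicKahler σ g)
    (hM' : IsParaquaternionicKahler σ' g') :
    IsParaquaternionicKahlerSubmanifold (F := F) σ g ι where
  invariant := hι.isInvariantSubmanifold hπ.paraholomorphic hM.hermitian
  kahler := by
    rw [hι.inducedStructure_eq hπ hM.hermitian, hι.inducedMetric_eq hπ.semiRiemannian]
    exact hM'.induced (hπ.paraholomorphic.1.comp hι.immersion.contMDiff)
      (hι.mfderiv_comp_bijective hM.hermitian.metric hπ.semiRiemannian)

/-- If `Y` is horizontal along `N` and `V` is vertical, then `g (∇_v Y, V) = - g (Y, ∇_v V) = 0`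
for `v` tangent to `N`. -/
theorem IsIntegralManifold.isTotallyGeodesic [FiniteDimensional ℝ E']
    (hι : IsIntegralManifold (F := F) (horizontal (E' := E') g π) ι)
    (hπ : IsParaquaternionicSubmersion σ g σ' g' π) (hM : IsParaquaternionicKahler σ g)
    (hg' : IsSemiRiemannianMetric g') : IsTotallyGeodesic (F := F) g ι := by
  intro nabla h y Y hY hYt v hv
  have hg := hM.hermitian.metric
  have hYmem : Y (ι y) ∈ horizontal (E' := E') g π (ι y) := by
    rw [← hι.tangent y]; exact hYt.self_of_nhds
  rw [hι.tangent y]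
  intro w hw
  obtain ⟨V, hV, rfl⟩ := exists_isSectionAt_vertical hπ.semiRiemannian hw
  obtain ⟨t, rfl⟩ := hv
  have hιd : MDifferentiableAt 𝓘(ℝ, F) 𝓘(ℝ, E) ι y :=
    hι.immersion.contMDiff.contMDiffAt.mdifferentiableAt (by simp)
  have h1 : (fun x ↦ g x (Y x) (V x)) ∘ ι =ᶠ[𝓝 y] fun _ ↦ (0 : ℝ) := by
    filter_upwards [hYt, hιd.continuousAt.eventually hV.eventually_mem] with z hz hVz
    rw [hι.tangent z] at hz
    exact apply_eq_zero_of_mem hg hz hVz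
  have h2 := mvfderiv_comp_apply y (hg.mdifferentiableAt_apply hY hV.mdifferentiableAt) hιd t
  have h3 : mvfderiv 𝓘(ℝ, F) ((fun x ↦ g x (Y x) (V x)) ∘ ι) y t = 0 :=
    (congrArg (fun A : F →L[ℝ] ℝ ↦ A t) (h1.mfderiv_eq (I := 𝓘(ℝ, F)) (I' := 𝓘(ℝ, ℝ)))).trans
      (congrArg (fun A : F →L[ℝ] ℝ ↦ A t) mfderiv_const)
  have h4 := h.metric (ι y) Y V hY hV.mdifferentiableAt (mfderiv 𝓘(ℝ, F) 𝓘(ℝ, E) ι y t)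
  have h5 := apply_eq_zero_of_mem hg hYmem
    (hπ.nabla_mem_vertical hM hg' h hV (hι.mfderiv_mem t))
  have h6 := h4.symm.trans (h2.symm.trans h3)
  rw [h5, add_zero] at h6
  rw [hg.symm]
  exact h6

end IntegralManifold

end ParaQ

end

theorem mainTheorem4
    {E : Type*} [NormedAddCommGroup E] [NormedSpace ℝ E] [FiniteDimensional ℝ E]
    {M : Type*} [TopologicalSpace M] [T2Space M] [SecondCountableTopology M]
    [ChartedSpace E M] [IsManifold 𝓘(ℝ, E) ∞ M]
    {E' : Type*} [NormedAddCommGroup E'] [NormedSpace ℝ E'] [FiniteDimensional ℝ E']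
    {M' : Type*} [TopologicalSpace M'] [T2Space M'] [SecondCountableTopology M']
    [ChartedSpace E' M'] [IsManifold 𝓘(ℝ, E') ∞ M']
    (σ : ParaQ.EndSubspaceField E M) (g : ParaQ.BilinField E M)
    (σ' : ParaQ.EndSubspaceField E' M') (g' : ParaQ.BilinField E' M')
    (hM : ParaQ.IsParaquaternionicKahler σ g) (hM' : ParaQ.IsParaquaternionicKahler σ' g')
    (π : M → M') (hπ : ParaQ.IsParaquaternionicSubmersion σ g σ' g' π) :
    -- the O'Neill tensor vanishes
    (∀ nabla : ParaQ.LinearConnection E M, ParaQ.IsLeviCivita g nabla →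
      ∀ (X Y : Π x : M, TangentSpace 𝓘(ℝ, E) x) (x : M), MDiffAt (T% Y) x →
        ParaQ.oneillA hM.hermitian.metric hπ.semiRiemannian nabla X Y x = 0) ∧
    -- the horizontal distribution is integrable
    ParaQ.IsIntegrable (ParaQ.horizontal (E' := E') g π) ∧
    -- its integral manifolds are totally geodesic paraquaternionic Kähler submanifolds
    (∀ {F : Type*} [NormedAddCommGroup F] [NormedSpace ℝ F] [FiniteDimensional ℝ F]
      {N : Type*} [TopologicalSpace N] [ChartedSpace F N] [IsManifold 𝓘(ℝ, F) ∞ N] (ι : N → M),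
      ParaQ.IsIntegralManifold (F := F) (ParaQ.horizontal (E' := E') g π) ι →
        ParaQ.IsTotallyGeodesic (F := F) g ι ∧
        ParaQ.IsParaquaternionicKahlerSubmanifold (F := F) σ g ι) := by
  have hg' := hM'.hermitian.metric
  exact ⟨fun nabla h X Y x hY ↦ hπ.oneillA_eq_zero hM hg' h X hY, hπ.isIntegrable hM hg',
    fun ι hι ↦ ⟨hι.isTotallyGeodesic hπ hM hg',
      hι.isParaquaternionicKahlerSubmanifold hπ hM hM'⟩⟩
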